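/- For a graph $G$ on $n$ vertices and an integer $k\ge 2$, a $k$-section of $G$ is a partition $(V_1,\dots,V_k)$ of $V(G)$ (empty sets allowed) with $\lfloor n/k\rfloor\le|V_\ell|\le\lceil n/k\rceil$ for all $\ell$; its width is the number of edges of $G$ whose ends lie in different sets $V_\ell$, and $\operatorname{MinSec}(k,G)$ is the minimum width of a $k$-section of $G$. For a class $\mathcal G$ of graphs and a real number $c$, a polynomial-time $c$-approximation for the Minimum $k$-Section Problem restricted to $\mathcal G$ is an algorithm that, given a graph $G\in\mathcal G$ and an integer $k\ge 2$ (which is part of the input, in binary), computes, in time polynomial in the length of the input, a $k$-section of $G$ of width at most $c\cdot\operatorname{MinSec}(k,G)$. Let $\Delta_0\in\mathbb N$ (where $\Delta_0=0$ is allowed) and let $d>0$ be a real number. There is a constant $c>1$ such that, for every class $\mathcal T$ of trees in which every tree $T$, on $n$ vertices, has maximum degree $\Delta(T)\le\Delta_0$ and diameter (length of a longest path) $\operatorname{diam}(T)\ge dn$, there is a polynomial-time $c$-approximation for the Minimum $k$-Section Problem restricted to $\mathcal T$. Moreover, this also holds with $c=\left(2+\frac{16}{d}\right)\Delta_0$,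 and this value is larger than $1$ if $\Delta_0\ge 1$. (If $\Delta_0=0$, every such class is empty.) -/

import Mathlib

/-! ### Cuts and `k`-sections

An ordered partition `(V₁, …, V_k)` of the vertex set, empty sets allowed, is given by the
function `σ : V → Fin k` which sends each vertex to the index of the set that contains it. -/

/-- The width of a cut: the number of edges of `G` whose ends lie in different sets. -/
noncomputable def cutWidth {V : Type*} {k : ℕ} (G : SimpleGraph V) (σ : V → Fin k) : ℕ :=
  {e ∈ G.edgeSet | ∃ v w : V, e = s(v, w) ∧ σ v ≠ σ w}.ncard

/-- A `k`-section: every set of the partition has at least `⌊n / k⌋` and at most `⌈n / k⌉`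
elements, where `n` is the number of vertices. -/
def IsKSection {V : Type*} [Fintype V] {k : ℕ} (σ : V → Fin k) : Prop :=
  ∀ l : Fin k, Fintype.card V / k ≤ {v : V | σ v = l}.ncard ∧
    {v : V | σ v = l}.ncard ≤ Fintype.card V ⌈/⌉ k

/-- The minimum width of a `k`-section in `G`. -/
noncomputable def minSec {V : Type*} [Fintype V] (k : ℕ) (G : SimpleGraph V) : ℕ :=
  sInf {w : ℕ | ∃ σ : V → Fin k, IsKSection σ ∧ cutWidth G σ = w}

/-- The length (number of edges) of a longest path in `G`; for a tree, this is its diameter. -/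
noncomputable def longestPathLength {V : Type*} (G : SimpleGraph V) : ℕ :=
  sSup {l : ℕ | ∃ (u v : V) (p : G.Walk u v), p.IsPath ∧ p.length = l}

/-! ### A random access machine with a step count

Programs work on registers `x₀, x₁, …` and arrays `a₀, a₁, …` of natural numbers of unbounded
size; a program mentions only finitely many of them. The arithmetic operations are addition and
truncated subtraction, and each operation takes one step. As there is no multiplication, the bit
length of the numbers grows by at most a constant per step, so that polynomial time on this machine
is the usual notion of polynomial time. -/

namespace RAM

/-- Expressions over the registers and the arrays. -/
inductive Expr : Type
  /-- a constant -/
  | const (a : ℕ) : Expr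
  /-- the content of the register `x` -/
  | reg (x : ℕ) : Expr
  /-- the entry of the array `a` at the position given by `i` -/
  | get (a : ℕ) (i : Expr) : Expr
  /-- the sum -/
  | add (e f : Expr) : Expr
  /-- the truncated difference -/
  | sub (e f : Expr) : Expr

/-- Programs. -/
inductive Prog : Type
  /-- do nothing -/
  | skip : Prog
  /-- assign the value of `e` to the register `x` -/
  | set (x : ℕ) (e : Expr) : Prog
  /-- store the value of `e` in the array `a` at the position given by `i` -/
  | put (a : ℕ) (i e : Expr) : Prog
  /-- run `P`, then `Q` -/
  | seq (P Q : Prog) : Prog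
  /-- run `P` if the value of `e` is nonzero, otherwise run `Q` -/
  | ite (e : Expr) (P Q : Prog) : Prog
  /-- while the value of `e` is nonzero, run `P` -/
  | loop (e : Expr) (P : Prog) : Prog

/-- The content of the registers and the arrays. -/
structure State : Type where
  /-- the registers -/
  reg : ℕ → ℕ
  /-- the arrays -/
  arr : ℕ → ℕ → ℕ

/-- The value of an expression. -/
def Expr.eval (s : State) : Expr → ℕ
  | const a => a
  | reg x => s.reg x
  | get a i => s.arr a (i.eval s)
  | add e f => e.eval s + f.eval s
  | sub e f => e.eval s - f.eval s

/-- The number of steps that the evaluation of an expression takes. -/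
def Expr.cost : Expr → ℕ
  | const _ => 1
  | reg _ => 1
  | get _ i => i.cost + 1
  | add e f => e.cost + f.cost + 1
  | sub e f => e.cost + f.cost + 1

/-- `Runs P s t s'`: the program `P`, started in the state `s`, halts after `t` steps in the
state `s'`. -/
inductive Runs : Prog → State → ℕ → State → Prop
  | skip (s : State) : Runs .skip s 1 s
  | set (s : State) (x : ℕ) (e : Expr) :
      Runs (.set x e) s (e.cost + 1) { s with reg := Function.update s.reg x (e.eval s) }
  | put (s : State) (a : ℕ) (i e : Expr) :
      Runs (.put a i e) s (i.cost + e.cost + 1)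
        { s with
          arr := Function.update s.arr a (Function.update (s.arr a) (i.eval s) (e.eval s)) }
  | seq {P Q : Prog} {s s' s'' : State} {t t' : ℕ} :
      Runs P s t s' → Runs Q s' t' s'' → Runs (.seq P Q) s (t + t') s''
  | ite_true {e : Expr} {P Q : Prog} {s s' : State} {t : ℕ} :
      e.eval s ≠ 0 → Runs P s t s' → Runs (.ite e P Q) s (e.cost + 1 + t) s'
  | ite_false {e : Expr} {P Q : Prog} {s s' : State} {t : ℕ} :
      e.eval s = 0 → Runs Q s t s' → Runs (.ite e P Q) s (e.cost + 1 + t) s'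
  | loop_true {e : Expr} {P : Prog} {s s' s'' : State} {t t' : ℕ} :
      e.eval s ≠ 0 → Runs P s t s' → Runs (.loop e P) s' t' s'' →
        Runs (.loop e P) s (e.cost + 1 + t + t') s''
  | loop_false {e : Expr} {P : Prog} {s : State} :
      e.eval s = 0 → Runs (.loop e P) s (e.cost + 1) s

/-- The initial state for an input list of numbers: the list is in array `0`, its length is in
register `0`, and everything else is `0`. -/
def State.init (w : List ℕ) : State where
  reg x := if x = 0 then w.length else 0
  arr a i := if a = 0 then w.getD i 0 else 0

/-- The length of an input list: every number counts with its number of binary digits, plus one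
for a separator. -/
def inputLength (w : List ℕ) : ℕ :=
  (w.map fun a => Nat.size a + 1).sum

end RAM

/-! ### Approximation algorithms for Minimum `k`-Section -/

open Classical in
/-- The input list for the graph `G` on `{0, …, n - 1}` and the number `k`: the numbers `n` and
`k`, followed by the adjacency matrix of `G`, row by row. -/
noncomputable def encodeInstance {n : ℕ} (G : SimpleGraph (Fin n)) (k : ℕ) : List ℕ :=
  n :: k :: List.ofFn fun p : Fin (n * n) => if G.Adj p.divNat p.modNat then 1 else 0

/-- There is a polynomial-time `c`-approximation for the Minimum `k`-Section Problem restricted to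
the graph class `𝒢`, where `𝒢 n` is the set of those members of the class whose vertex set is
`{0, …, n - 1}`. The number `k ≥ 2` is part of the input. The computed `k`-section is read off
from array `1`, whose entry at `v` is the index in `{0, …, k - 1}` of the set that contains `v`. -/
def HasPolyTimeApprox (c : ℝ) (𝒢 : ∀ n : ℕ, Set (SimpleGraph (Fin n))) : Prop :=
  ∃ (P : RAM.Prog) (q : Polynomial ℕ),
    ∀ (n : ℕ) (G : SimpleGraph (Fin n)), G ∈ 𝒢 n → ∀ k : ℕ, 2 ≤ k →
      ∃ (t : ℕ) (s : RAM.State) (σ : Fin n → Fin k),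
        RAM.Runs P (RAM.State.init (encodeInstance G k)) t s ∧
        t ≤ q.eval (RAM.inputLength (encodeInstance G k)) ∧
        (∀ v : Fin n, s.arr 1 v = σ v) ∧
        IsKSection σ ∧ (cutWidth G σ : ℝ) ≤ c * minSec k G

open Classical in
/-- `𝒯` is a class of trees such that every tree `T` in it, on `n` vertices, has maximum degree at
most `Δ₀` and diameter at least `d * n`. -/
def IsBoundedTreeClass (Δ₀ : ℕ) (d : ℝ) (𝒯 : ∀ n : ℕ, Set (SimpleGraph (Fin n))) : Prop :=
  ∀ (n : ℕ) (T : SimpleGraph (Fin n)), T ∈ 𝒯 n →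
    T.IsTree ∧ T.maxDegree ≤ Δ₀ ∧ d * n ≤ longestPathLength T

/-! Lower bound: for k ≤ n all sets of a k-section are non-empty, and contracting them in a tree
leaves a connected graph on k vertices, so the width is at least k - 1 (`pred_le_minSec`). For k ≥ n
every k-section cuts all edges, so singletons are optimal. It remains, for k < n, to cut off the
sets one by one, each at the price of at most C = ⌊(2 + 16/d)Δ⌋ edges; the last set is what is left.

Cutting off one set: let P be a longest path, from the root a to b, and let U be the set of vertices
not yet dealt with. The invariant is that P has at least the proportion |P|/n > d in U. By
`IsSpine.exists_part`, any m < |U| vertices of U can be cut off with at most Δ + 1 + 16Δ|U|/|P ∩ U|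
edges of the tree so that the proportion of P in the rest does not fall; hence the invariant
persists. U need not be connected: all cuts are cuts of the whole tree, of which only the trace on U
matters (`exists_extension`).

The engine is `IsSpine.exists_exact_cut`. Order the vertices along P, so that initial segments
ending at path vertices have small boundary, and close the order of U to a cycle. If two path
vertices have cyclic distance r, the interval between them is the desired set. Otherwise the path
vertices shifted by r fall into the gaps between path vertices, and by averaging some gap receives
at least its share (`exists_dense_gap`). Repeated halving (`exists_approx_cut`) takes approximately
the right number from this gap, and the defect is corrected by induction inside a short interval
that is rich in path vertices.

Algorithm: C does not depend on the tree, and a set with at most C boundary edges is encoded by one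
bit and C vertices (`exists_parity_eq`). So every round can try all codes and use the first one with
the right size and density. The search is written in a language whose loops are all bounded by n,
and such programs run in polynomial time (`Stmt.exists_prog`). -/

/-! ### Rooted trees and edge boundaries. -/

/-- A rooted tree, given by the parent of each vertex; the root is its own parent. -/
structure ParentTree (V : Type*) where
  /-- the root -/
  root : V
  /-- the parent -/
  par : V → V
  /-- the distance from the root -/
  depth : V → ℕ
  depth_eq_zero : ∀ v, depth v = 0 ↔ v = root
  depth_par : ∀ v, depth (par v) = depth v - 1

namespace ParentTree

variable {V : Type*} (R : ParentTree V)

theorem par_root : R.par R.root = R.root := by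
  rw [← R.depth_eq_zero, R.depth_par, (R.depth_eq_zero _).2 rfl]

/-- `R.Anc u v`: the vertex `u` lies on the path from the root to `v`. -/
def Anc (u v : V) : Prop := ∃ j, R.par^[j] v = u

theorem anc_refl (v : V) : R.Anc v v := ⟨0, rfl⟩

theorem Anc.trans {R : ParentTree V} {u v w : V} (h : R.Anc u v) (h' : R.Anc v w) :
    R.Anc u w := by
  obtain ⟨i, rfl⟩ := h
  obtain ⟨j, rfl⟩ := h'
  exact ⟨i + j, Function.iterate_add_apply _ _ _ _⟩

theorem anc_par (v : V) : R.Anc (R.par v) v := ⟨1, rfl⟩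

theorem anc_iff (u v : V) : R.Anc u v ↔ u = v ∨ R.Anc u (R.par v) := by
  constructor
  · rintro ⟨j, hj⟩
    cases j with
    | zero => exact .inl hj.symm
    | succ j => exact .inr ⟨j, hj⟩
  · rintro (rfl | h)
    · exact R.anc_refl _
    · exact h.trans (R.anc_par v)

theorem depth_iterate (j : ℕ) (v : V) : R.depth (R.par^[j] v) = R.depth v - j := by
  induction j with
  | zero => rfl
  | succ j ih => rw [Function.iterate_succ_apply', R.depth_par, ih, Nat.sub_sub]

theorem Anc.depth_le {R : ParentTree V} {u v : V} (h : R.Anc u v) : R.depth u ≤ R.depth v := by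
  obtain ⟨j, rfl⟩ := h
  rw [depth_iterate]
  exact Nat.sub_le _ _

theorem anc_root (v : V) : R.Anc R.root v :=
  ⟨R.depth v, by rw [← R.depth_eq_zero, depth_iterate, Nat.sub_self]⟩

theorem depth_par_lt {v : V} (h : R.par v ≠ v) : R.depth (R.par v) < R.depth v := by
  have h0 : R.depth v ≠ 0 := by
    intro h0
    rw [R.depth_eq_zero] at h0
    exact h (h0 ▸ R.par_root)
  rw [R.depth_par]
  omega

theorem Anc.total {R : ParentTree V} {u w v : V} (h : R.Anc u v) (h' : R.Anc w v) :
    R.Anc u w ∨ R.Anc w u := by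
  obtain ⟨i, rfl⟩ := h
  obtain ⟨j, rfl⟩ := h'
  rcases le_total i j with hij | hij
  · exact .inr ⟨j - i, by rw [← Function.iterate_add_apply, Nat.sub_add_cancel hij]⟩
  · exact .inl ⟨i - j, by rw [← Function.iterate_add_apply, Nat.sub_add_cancel hij]⟩

theorem Anc.antisymm {R : ParentTree V} {u v : V} (h : R.Anc u v) (h' : R.Anc v u) : u = v := by
  by_contra hne
  have h1 := (R.anc_iff u v).1 h
  have h2 : R.Anc u (R.par v) := h1.resolve_left hne
  have h3 := h2.depth_le
  have h4 := h'.depth_le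
  have h5 : R.par v = v := by
    by_contra h5
    have := R.depth_par_lt h5
    omega
  have h6 : ∀ j, R.par^[j] v = v := fun j => Function.iterate_fixed h5 j
  obtain ⟨j, rfl⟩ := h
  exact hne (h6 j)

variable [Fintype V] [DecidableEq V]

/-- The edge boundary of `B`; an edge is represented by its end that is farther from the root. -/
def bd (B : Finset V) : Finset V := {v | ¬(v ∈ B ↔ R.par v ∈ B)}

theorem mem_bd {B : Finset V} {v : V} : v ∈ R.bd B ↔ ¬(v ∈ B ↔ R.par v ∈ B) := by simp [bd]

theorem bd_empty : R.bd ∅ = ∅ := by ext; simp [mem_bd]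

theorem bd_univ : R.bd Finset.univ = ∅ := by ext; simp [mem_bd]

theorem bd_union_subset (A B : Finset V) : R.bd (A ∪ B) ⊆ R.bd A ∪ R.bd B := by
  intro v
  simp only [mem_bd, Finset.mem_union]
  tauto

theorem bd_compl (A : Finset V) : R.bd Aᶜ = R.bd A := by
  ext v
  simp only [mem_bd, Finset.mem_compl]
  tauto

/-- A set that is determined, on `U`, by the sets in the list `Ss` extends to a set whose boundary
consists of edges from the boundaries of these sets. -/
theorem exists_extension (Ss : List (Finset V)) (U B : Finset V) (hB : B ⊆ U)
    (h : ∀ u ∈ U, ∀ w ∈ U, (∀ S ∈ Ss, u ∈ S ↔ w ∈ S) → u ∈ B → w ∈ B) :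
    ∃ B' : Finset V, B' ∩ U = B ∧ (R.bd B').card ≤ (Ss.map fun S => (R.bd S).card).sum := by
  classical
  -- All vertices with the same membership pattern in the sets of `Ss` as some vertex of `B`. Along
  -- an edge the pattern changes only if the edge is in the boundary of one of these sets.
  refine ⟨Finset.univ.filter fun v => ∃ u ∈ B, ∀ S ∈ Ss, u ∈ S ↔ v ∈ S, ?_, ?_⟩
  · ext v
    simp only [Finset.mem_inter, Finset.mem_filter, Finset.mem_univ, true_and]
    constructor
    · rintro ⟨⟨u, hu, hS⟩, hv⟩
      exact h u (hB hu) v hv hS hu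
    · intro hv
      exact ⟨⟨v, hv, fun _ _ => Iff.rfl⟩, hB hv⟩
  · have hsub : R.bd (Finset.univ.filter fun v => ∃ u ∈ B, ∀ S ∈ Ss, u ∈ S ↔ v ∈ S) ⊆
        Finset.univ.filter fun v => ∃ S ∈ Ss, v ∈ R.bd S := by
      intro v hv
      simp only [Finset.mem_filter, Finset.mem_univ, true_and]
      by_contra hcon
      push Not at hcon
      rw [mem_bd] at hv
      apply hv
      simp only [Finset.mem_filter, Finset.mem_univ, true_and]
      have key : ∀ S ∈ Ss, (v ∈ S ↔ R.par v ∈ S) := by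
        intro S hS
        have := hcon S hS
        rw [mem_bd, not_not] at this
        exact this
      constructor
      · rintro ⟨u, hu, hS⟩
        exact ⟨u, hu, fun S hSs => (hS S hSs).trans (key S hSs)⟩
      · rintro ⟨u, hu, hS⟩
        exact ⟨u, hu, fun S hSs => (hS S hSs).trans (key S hSs).symm⟩
    refine (Finset.card_le_card hsub).trans ?_
    clear hsub h
    induction Ss with
    | nil => simp
    | cons S Ss ih =>
      rw [List.map_cons, List.sum_cons]
      refine le_trans ?_ (Nat.add_le_add_left ih _)
      refine le_trans (Finset.card_le_card ?_) (Finset.card_union_le _ _)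
      intro v
      simp

open Classical in
/-- The subtree that hangs at `u`. -/
noncomputable def desc (u : V) : Finset V := {v | R.Anc u v}

theorem mem_desc {u v : V} : v ∈ R.desc u ↔ R.Anc u v := by simp [desc]

theorem bd_desc_subset (u : V) : R.bd (R.desc u) ⊆ {u} := by
  intro v hv
  rw [mem_bd, mem_desc, mem_desc, R.anc_iff u v] at hv
  simp only [Finset.mem_singleton]
  tauto

/-- The children of `v`. -/
def children (v : V) : Finset V := {c | R.par c = v ∧ c ≠ v}

theorem mem_children {v c : V} : c ∈ R.children v ↔ R.par c = v ∧ c ≠ v := by simp [children]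

theorem bd_biUnion_desc_subset (S : Finset V) : R.bd (S.biUnion R.desc) ⊆ S := by
  intro v hv
  by_contra hvS
  rw [mem_bd] at hv
  apply hv
  simp only [Finset.mem_biUnion, mem_desc]
  refine exists_congr fun a => and_congr_right fun ha => ?_
  rw [R.anc_iff a v]
  have : a ≠ v := fun h => hvS (h ▸ ha)
  tauto

theorem desc_eq_insert (v : V) : R.desc v = insert v ((R.children v).biUnion R.desc) := by
  ext w
  simp only [mem_desc, Finset.mem_insert, Finset.mem_biUnion, mem_children]
  constructor
  · rintro ⟨j, hj⟩
    induction j generalizing w with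
    | zero => exact .inl hj
    | succ j ih =>
      by_cases hw : w = v
      · exact .inl hw
      right
      rcases ih (R.par w) hj with h | ⟨c, hc, h⟩
      · exact ⟨w, ⟨h, hw⟩, R.anc_refl w⟩
      · exact ⟨c, hc, h.trans (R.anc_par w)⟩
  · rintro (rfl | ⟨c, ⟨rfl, -⟩, h⟩)
    · exact R.anc_refl _
    · exact (R.anc_par c).trans h

/-- Without `v`, the subtree falls apart into the subtrees at the children, so only the edges to the
children are cut. -/
theorem bd_desc_erase_subset (v : V) : R.bd ((R.desc v).erase v) ⊆ R.children v := by
  have h : (R.desc v).erase v ⊆ (R.children v).biUnion R.desc := by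
    rw [desc_eq_insert]
    exact Finset.erase_insert_subset _ _
  have h' : (R.desc v).erase v = (R.children v).biUnion R.desc := by
    refine Finset.Subset.antisymm h fun w hw => ?_
    rw [Finset.mem_erase]
    refine ⟨?_, by rw [desc_eq_insert]; exact Finset.mem_insert_of_mem hw⟩
    rintro rfl
    simp only [Finset.mem_biUnion, mem_children, mem_desc] at hw
    obtain ⟨c, ⟨h1, h2⟩, h3⟩ := hw
    exact h2 (h3.antisymm (h1 ▸ R.anc_par c))
  rw [h']
  exact R.bd_biUnion_desc_subset _

/-! ### Approximate cuts in trees of bounded degree. -/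

variable {R}

/-- In a tree of bounded degree, one can cut off between `m / 2` and `m` elements of a given set by
cutting few edges. -/
theorem exists_half_cut {Δ : ℕ} (hΔ : 1 ≤ Δ) (hR : ∀ v, (R.children v).card ≤ Δ)
    (W : Finset V) (m : ℕ) (hm : m ≤ W.card) :
    ∃ S : Finset V, m ≤ 2 * (S ∩ W).card ∧ (S ∩ W).card ≤ m ∧ (R.bd S).card ≤ Δ := by
  classical
  have hd1 : ∀ u, (R.bd (R.desc u)).card ≤ Δ := fun u =>
    (Finset.card_le_card (R.bd_desc_subset u)).trans (by simpa using hΔ)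
  have hne : (Finset.univ.filter fun v => m ≤ (R.desc v ∩ W).card).Nonempty := by
    refine ⟨R.root, ?_⟩
    have : R.desc R.root = Finset.univ := by
      ext v
      simp [mem_desc, R.anc_root v]
    simpa [this] using hm
  -- A deepest vertex whose subtree holds at least `m` elements of `W`; the subtree of each child
  -- then holds fewer.
  obtain ⟨v, hv, hmax⟩ := Finset.exists_max_image _ R.depth hne
  simp only [Finset.mem_filter, Finset.mem_univ, true_and] at hv hmax
  have hch : ∀ c ∈ R.children v, (R.desc c ∩ W).card < m := by
    intro c hc
    by_contra hcm
    have h1 := hmax c (not_lt.1 hcm)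
    rw [mem_children] at hc
    have h2 := R.depth_par_lt (v := c) (by rw [hc.1]; exact hc.2.symm)
    rw [hc.1] at h2
    omega
  rcases hv.eq_or_lt with hv | hv
  · exact ⟨R.desc v, by omega, hv.ge, hd1 v⟩
  have hall : m ≤ ((R.children v).biUnion R.desc ∩ W).card := by
    have h1 : (R.desc v ∩ W).card ≤ ((R.children v).biUnion R.desc ∩ W).card + 1 := by
      rw [desc_eq_insert]
      refine (Finset.card_le_card ?_).trans (Finset.card_insert_le v _)
      intro w
      simp only [Finset.mem_inter, Finset.mem_insert]
      tauto
    omega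
  -- Take a largest family of child subtrees with at most `m` elements in total. If it has fewer
  -- than `m / 2`, any further child subtree would exceed `m`, so this subtree alone has more than
  -- `m / 2`.
  have hne' : ((R.children v).powerset.filter
      fun S => (S.biUnion R.desc ∩ W).card ≤ m).Nonempty := ⟨∅, by simp⟩
  obtain ⟨S, hS, hSmax⟩ := Finset.exists_max_image _ Finset.card hne'
  simp only [Finset.mem_filter, Finset.mem_powerset] at hS hSmax
  have hbd : (R.bd (S.biUnion R.desc)).card ≤ Δ :=
    (Finset.card_le_card (R.bd_biUnion_desc_subset S)).trans
      ((Finset.card_le_card hS.1).trans (hR v))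
  by_cases hhalf : m ≤ 2 * (S.biUnion R.desc ∩ W).card
  · exact ⟨_, hhalf, hS.2, hbd⟩
  have hne : S ≠ R.children v := by
    rintro rfl
    omega
  obtain ⟨c, hc, hcS⟩ := Finset.exists_of_ssubset (hS.1.ssubset_of_ne hne)
  refine ⟨R.desc c, ?_, (hch c hc).le, hd1 c⟩
  by_contra hcm
  have hun : ((insert c S).biUnion R.desc ∩ W).card ≤
      (R.desc c ∩ W).card + (S.biUnion R.desc ∩ W).card := by
    rw [Finset.biUnion_insert, Finset.union_inter_distrib_right]
    exact Finset.card_union_le _ _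
  have := hSmax (insert c S) ⟨Finset.insert_subset hc hS.1, by omega⟩
  rw [Finset.card_insert_of_notMem hcS] at this
  omega

/-- Repeated halving. -/
theorem exists_approx_cut {Δ : ℕ} (hΔ : 1 ≤ Δ) (hR : ∀ v, (R.children v).card ≤ Δ) {q : ℝ}
    (hq : 0 < q) (r : ℕ) (W : Finset V) (hr : r ≤ W.card) :
    ∃ S : Finset V, (S ∩ W).card ≤ r ∧ (r : ℝ) ≤ (S ∩ W).card + q ∧
      (R.bd S).card * q ≤ Δ * r := by
  induction r using Nat.strong_induction_on generalizing W with
  | _ r ih =>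
    by_cases hrq : (r : ℝ) ≤ q
    · exact ⟨∅, by simp, by simpa using hrq, by simp [bd_empty]; positivity⟩
    push Not at hrq
    have hr0 : 0 < r := by
      have : (0 : ℝ) < r := hq.trans hrq
      exact_mod_cast this
    obtain ⟨S, h1, h2, h3⟩ := exists_half_cut hΔ hR W r hr
    have h3' : ((R.bd S).card : ℝ) ≤ Δ := by exact_mod_cast h3
    by_cases hq1 : ((r - (S ∩ W).card : ℕ) : ℝ) ≤ q
    · refine ⟨S, h2, ?_, ?_⟩
      · rw [Nat.cast_sub h2] at hq1
        linarith
      · have : (0 : ℝ) ≤ Δ := by positivity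
        nlinarith
    -- The missing amount r' satisfies q < r' ≤ r / 2, so the price Δ of this step and the price Δ
    -- r' / q of the remaining ones add up to at most Δ r / q.
    push Not at hq1
    have hcard : (W \ S).card = W.card - (S ∩ W).card := by
      rw [Finset.card_sdiff]
    obtain ⟨S', h1', h2', h4'⟩ := ih (r - (S ∩ W).card) (by omega) (W \ S) (by omega)
    have hun : ((S ∪ S') ∩ W).card = (S ∩ W).card + (S' ∩ (W \ S)).card := by
      rw [← Finset.card_union_of_disjoint]
      · congr 1
        ext v
        simp only [Finset.mem_inter, Finset.mem_union, Finset.mem_sdiff]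
        tauto
      · rw [Finset.disjoint_left]
        intro v
        simp only [Finset.mem_inter, Finset.mem_sdiff]
        tauto
    refine ⟨S ∪ S', by omega, ?_, ?_⟩
    · rw [hun]
      rw [Nat.cast_sub h2] at h2'
      push_cast
      linarith
    · have hb : ((R.bd (S ∪ S')).card : ℝ) ≤ (R.bd S).card + (R.bd S').card := by
        exact_mod_cast (Finset.card_le_card (R.bd_union_subset S S')).trans
          (Finset.card_union_le _ _)
      have hh : 2 * ((r - (S ∩ W).card : ℕ) : ℝ) ≤ r := by
        have : 2 * (r - (S ∩ W).card) ≤ r := by omega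
        exact_mod_cast this
      have hΔ0 : (0 : ℝ) ≤ Δ := by positivity
      calc ((R.bd (S ∪ S')).card : ℝ) * q ≤ ((R.bd S).card + (R.bd S').card) * q := by gcongr
        _ = (R.bd S).card * q + (R.bd S').card * q := by ring
        _ ≤ Δ * ((r - (S ∩ W).card : ℕ) : ℝ) + Δ * ((r - (S ∩ W).card : ℕ) : ℝ) := by
            refine add_le_add ?_ h4'
            exact mul_le_mul h3' hq1.le hq.le hΔ0
        _ ≤ Δ * r := by nlinarith

end ParentTree

/-! ### Intervals on a cycle and averaging. -/

/-- The number of steps from `a` forward to `b` on a cycle with the vertices `0, …, N - 1`. -/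
def cdist (N a b : ℕ) : ℕ := if a ≤ b then b - a else b + N - a

theorem cdist_spec (N a b : ℕ) :
    a ≤ b ∧ cdist N a b = b - a ∨ b < a ∧ cdist N a b = b + N - a := by
  grind [cdist]

theorem cdist_lt {N a b : ℕ} (ha : a < N) (hb : b < N) : cdist N a b < N := by
  grind [cdist]

/-- For fixed `y`, the map t ↦ y - t is an involution of ℤ / N. -/
theorem card_filter_cdist_left {N y : ℕ} (hy : y < N) (Q : ℕ → Prop) [DecidablePred Q] :
    ((Finset.range N).filter fun t => Q (cdist N t y)).card =
      ((Finset.range N).filter Q).card := by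
  refine Finset.card_nbij' (fun t => cdist N t y) (fun t => cdist N t y) ?_ ?_ ?_ ?_
  · intro t ht
    simp only [Finset.coe_filter, Finset.mem_range, Set.mem_ofPred_eq] at ht ⊢
    exact ⟨cdist_lt ht.1 hy, ht.2⟩
  · intro t ht
    simp only [Finset.coe_filter, Finset.mem_range, Set.mem_ofPred_eq] at ht ⊢
    have : cdist N (cdist N t y) y = t := by grind [cdist]
    exact ⟨cdist_lt ht.1 hy, by rw [this]; exact ht.2⟩
  · intro t ht
    simp only [Finset.coe_filter, Finset.mem_range, Set.mem_ofPred_eq] at ht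
    grind [cdist]
  · intro t ht
    simp only [Finset.coe_filter, Finset.mem_range, Set.mem_ofPred_eq] at ht
    grind [cdist]

theorem card_filter_cdist_right {N y : ℕ} (hy : y < N) (Q : ℕ → Prop) [DecidablePred Q] :
    ((Finset.range N).filter fun t => Q (cdist N y t)).card =
      ((Finset.range N).filter Q).card := by
  refine Finset.card_nbij' (fun t => cdist N y t)
    (fun j => if y + j < N then y + j else y + j - N) ?_ ?_ ?_ ?_
  · intro t ht
    simp only [Finset.coe_filter, Finset.mem_range, Set.mem_ofPred_eq] at ht ⊢
    exact ⟨cdist_lt hy ht.1, ht.2⟩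
  · intro t ht
    simp only [Finset.coe_filter, Finset.mem_range, Set.mem_ofPred_eq] at ht ⊢
    have : cdist N y (if y + t < N then y + t else y + t - N) = t := by grind [cdist]
    exact ⟨by split_ifs <;> omega, by rw [this]; exact ht.2⟩
  · intro t ht
    simp only [Finset.coe_filter, Finset.mem_range, Set.mem_ofPred_eq] at ht
    grind [cdist]
  · intro t ht
    simp only [Finset.coe_filter, Finset.mem_range, Set.mem_ofPred_eq] at ht
    grind [cdist]

theorem card_filter_range_Ico {N a b : ℕ} (hb : b ≤ N) :
    ((Finset.range N).filter fun t => a ≤ t ∧ t < b).card = b - a := by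
  rw [← Nat.card_Ico]
  congr 1
  ext t
  simp only [Finset.mem_filter, Finset.mem_range, Finset.mem_Ico]
  omega

/-- If no two elements of `A ⊆ ℤ / N` have the difference `r`, then there is a gap of `A`, between
consecutive elements `y` and `z`, which contains more than its share of `A + r`. -/
theorem exists_dense_gap {N r : ℕ} (hr : r < N) (A : Finset ℕ) (hA : ∀ a ∈ A, a < N)
    (hne : A.Nonempty) (hit : ∀ x ∈ A, ∀ y ∈ A, cdist N x y ≠ r) :
    ∃ y ∈ A, ∃ z ∈ A, (∀ x ∈ A, cdist N x y ≤ cdist N z y) ∧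
      ∃ X ⊆ A, X.Nonempty ∧
        (∀ x ∈ X, cdist N x y < r ∧ r ≤ cdist N x y + (N - 1 - cdist N z y)) ∧
        (N - 1 - cdist N z y) * A.card ≤ (N - A.card) * X.card := by
  have hmin : ∀ t, ∃ y ∈ A, ∀ x ∈ A, cdist N y t ≤ cdist N x t := fun t =>
    Finset.exists_min_image A (fun w => cdist N w t) hne
  -- `o t` is the last element of `A` at or before `t`, so that its fibres outside `A` are the gaps
  -- of `A`; `sh` is the shift by `r`.
  choose o ho homin using hmin
  set sh : ℕ → ℕ := fun x => if x + r < N then x + r else x + r - N with hsh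
  have hmax : ∀ y, ∃ z ∈ A, ∀ x ∈ A, cdist N x y ≤ cdist N z y := fun y =>
    Finset.exists_max_image A (fun w => cdist N w y) hne
  -- `z y` is the element of `A` that follows `y` on the cycle; the gap between them has `N - 1 -
  -- cdist N (z y) y` elements.
  choose z hz hzmax using hmax
  have hshN : ∀ x ∈ A, sh x < N := by
    intro x hx
    have := hA x hx
    grind
  have hshA : ∀ x ∈ A, sh x ∉ A := by
    intro x hx hs
    have h1 := hA x hx
    apply hit x hx _ hs
    grind [cdist]
  have hX : ∀ y ∈ A, ∀ x ∈ A, o (sh x) = y →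
      cdist N x y < r ∧ r ≤ cdist N x y + (N - 1 - cdist N (z y) y) := by
    rintro y hy x hx rfl
    have h1 := hA x hx
    have h2 := hA _ hy
    have h3 := hshN x hx
    have h4 := hshA x hx
    have h5 := homin (sh x) _ (hz (o (sh x)))
    have h6 := homin (sh x) x hx
    have h7 := hA _ (hz (o (sh x)))
    have h8 := hzmax (o (sh x)) x hx
    have h9 : o (sh x) ≠ sh x := fun h => h4 (h ▸ hy)
    have h10 : x + r < N ∧ sh x = x + r ∨ N ≤ x + r ∧ sh x = x + r - N := by grind
    have c1 := cdist_spec N x (o (sh x))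
    have c2 := cdist_spec N (z (o (sh x))) (o (sh x))
    have c3 := cdist_spec N (o (sh x)) (sh x)
    have c4 := cdist_spec N x (sh x)
    have c5 := cdist_spec N (z (o (sh x))) (sh x)
    omega
  have hΓ : ∀ y ∈ A, N - 1 - cdist N (z y) y ≤
      ((Finset.range N \ A).filter fun t => o t = y).card := by
    intro y hy
    have h2 := hA _ hy
    have h := card_filter_cdist_right h2
      (fun j => 1 ≤ j ∧ j < N - 1 - cdist N (z y) y + 1)
    rw [card_filter_range_Ico (by omega), Nat.add_sub_cancel] at h
    rw [← h]
    refine Finset.card_le_card fun t ht => ?_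
    simp only [Finset.mem_filter, Finset.mem_range, Finset.mem_sdiff] at ht ⊢
    obtain ⟨htN, ht1, ht2⟩ := ht
    have htA : t ∉ A := by
      intro htA
      have := hzmax y t htA
      have := hA _ (hz y)
      have c1 := cdist_spec N y t
      have c2 := cdist_spec N t y
      have c3 := cdist_spec N (z y) y
      omega
    refine ⟨⟨htN, htA⟩, ?_⟩
    have h3 := homin t y hy
    have h4 := hzmax y (o t) (ho t)
    have h5 := hA _ (ho t)
    have h6 := hA _ (hz y)
    have c1 := cdist_spec N y t
    have c2 := cdist_spec N (o t) t
    have c3 := cdist_spec N (z y) y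
    have c4 := cdist_spec N (o t) y
    omega
  -- Otherwise every gap that receives a shifted element receives less than its share, and summing
  -- over all gaps yields (N - |A|)|A| < (N - |A|)|A|.
  by_contra hcon
  push Not at hcon
  have hle : A.card ≤ N := by
    have : A ⊆ Finset.range N := fun a ha => Finset.mem_range.2 (hA a ha)
    simpa using Finset.card_le_card this
  have hpt : ∀ y ∈ A, (A.filter fun x => o (sh x) = y).Nonempty →
      (N - A.card) * (A.filter fun x => o (sh x) = y).card <
      ((Finset.range N \ A).filter fun t => o t = y).card * A.card := by
    intro y hy hyne
    refine lt_of_lt_of_le (hcon y hy (z y) (hz y) (hzmax y) _ (Finset.filter_subset _ _) hyne ?_) ?_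
    · intro x hx
      rw [Finset.mem_filter] at hx
      exact hX y hy x hx.1 hx.2
    · exact Nat.mul_le_mul_right _ (hΓ y hy)
  have hlt : ∑ y ∈ A, (N - A.card) * (A.filter fun x => o (sh x) = y).card <
      ∑ y ∈ A, ((Finset.range N \ A).filter fun t => o t = y).card * A.card := by
    obtain ⟨a, ha⟩ := hne
    refine Finset.sum_lt_sum (fun y hy => ?_)
      ⟨o (sh a), ho _, hpt _ (ho _) ⟨a, Finset.mem_filter.2 ⟨ha, rfl⟩⟩⟩
    rcases (A.filter fun x => o (sh x) = y).eq_empty_or_nonempty with h | h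
    · simp [h]
    · exact (hpt y hy h).le
  rw [← Finset.mul_sum, ← Finset.sum_mul,
    ← Finset.card_eq_sum_card_fiberwise (f := fun x => o (sh x)) (fun x _ => ho _),
    ← Finset.card_eq_sum_card_fiberwise (f := o) (fun x _ => ho _),
    Finset.card_sdiff_of_subset (fun a ha => Finset.mem_range.2 (hA a ha)),
    Finset.card_range] at hlt
  exact lt_irrefl _ hlt

/-- Some window of length `m` that starts right after an element of `A ⊆ ℤ / N` contains at most
the average number of elements of `A`. -/
theorem exists_sparse_window {N m : ℕ} (hm : m < N) (A : Finset ℕ) (hA : ∀ a ∈ A, a < N)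
    (hne : A.Nonempty) :
    ∃ y ∈ A, (A.filter fun x => N - m ≤ cdist N x y).card * N ≤ m * A.card ∧
      ∀ w ∈ A, (A.filter fun x => N - m ≤ cdist N x y).card ≤
        (A.filter fun x => N - m ≤ cdist N x w).card := by
  obtain ⟨y, hy, hmin⟩ := Finset.exists_min_image A
    (fun y => (A.filter fun x => N - m ≤ cdist N x y).card) hne
  refine ⟨y, hy, ?_, hmin⟩
  have hmin' : ∀ t, ∃ y ∈ A, ∀ x ∈ A, cdist N y t ≤ cdist N x t := fun t =>
    Finset.exists_min_image A (fun w => cdist N w t) hne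
  choose o ho homin using hmin'
  -- After `o t` there is no element of `A` up to `t`, so the part of `A` in the window after `o t`
  -- also lies in the window after `t`. Hence the minimum over windows that start after elements of
  -- `A` is at most the average over all `N` windows, and every `x` lies in exactly `m` of these.
  have key : ∀ t ∈ Finset.range N, (A.filter fun x => N - m ≤ cdist N x y).card ≤
      (A.filter fun x => N - m ≤ cdist N x t).card := by
    intro t ht
    rw [Finset.mem_range] at ht
    refine (hmin (o t) (ho t)).trans (Finset.card_le_card fun x hx => ?_)
    rw [Finset.mem_filter] at hx ⊢
    refine ⟨hx.1, ?_⟩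
    have h1 := homin t x hx.1
    have h2 := hA _ (ho t)
    have h3 := hA _ hx.1
    have h4 := hx.2
    have c1 := cdist_spec N (o t) t
    have c2 := cdist_spec N x t
    have c3 := cdist_spec N x (o t)
    omega
  have hsum := Finset.sum_le_sum key
  have hdc := Finset.sum_card_bipartiteAbove_eq_sum_card_bipartiteBelow
    (s := Finset.range N) (t := A) (fun t x => N - m ≤ cdist N x t)
  simp only [Finset.bipartiteAbove, Finset.bipartiteBelow] at hdc
  rw [hdc, Finset.sum_const, Finset.card_range, smul_eq_mul] at hsum
  have hcol : ∀ x ∈ A, ((Finset.range N).filter fun t => N - m ≤ cdist N x t).card = m := by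
    intro x hx
    rw [card_filter_cdist_right (hA x hx) (fun j => N - m ≤ j)]
    have := card_filter_range_Ico (N := N) (a := N - m) (b := N) le_rfl
    rw [show N - (N - m) = m by omega] at this
    rw [← this]
    congr 1
    ext t
    simp only [Finset.mem_filter, Finset.mem_range]
    omega
  rw [Finset.sum_congr rfl hcol, Finset.sum_const, smul_eq_mul] at hsum
  linarith

/-- These three lemmas say that membership in a cyclic interval is determined by the initial
segments of the linear order at its two ends. Strict and weak inequalities are distinguished because
the two kinds of segments have different prices in `ParentTree.IsSpine`. -/
theorem cdist_lt_congr {N u w x y : ℕ} (hx : x < N) (hu : u < N) (hw : w < N) (h1 : u ≤ x ↔ w ≤ x)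
    (h2 : u ≤ y ↔ w ≤ y) : cdist N u y < cdist N x y ↔ cdist N w y < cdist N x y := by
  have c1 := cdist_spec N u y
  have c2 := cdist_spec N w y
  have c3 := cdist_spec N x y
  omega

theorem cdist_le_congr {N u w x y : ℕ} (hx : x < N) (hu : u < N) (hw : w < N) (h1 : u < x ↔ w < x)
    (h2 : u ≤ y ↔ w ≤ y) : cdist N u y ≤ cdist N x y ↔ cdist N w y ≤ cdist N x y := by
  have c1 := cdist_spec N u y
  have c2 := cdist_spec N w y
  have c3 := cdist_spec N x y
  omega

theorem cdist_pos_le_congr {N u w x y : ℕ} (hx : x < N) (hu : u < N) (hw : w < N) (h1 : u < x ↔ w < x)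
    (h2 : u < y ↔ w < y) : (1 ≤ cdist N u y ∧ cdist N u y ≤ cdist N x y) ↔
      (1 ≤ cdist N w y ∧ cdist N w y ≤ cdist N x y) := by
  have c1 := cdist_spec N u y
  have c2 := cdist_spec N w y
  have c3 := cdist_spec N x y
  omega

/-! ### Positions within a subset of the vertices. -/

section Position

variable {V : Type*}

/-- The number of elements of `U` that come before `v`. -/
def position (κ : V → ℕ) (U : Finset V) (v : V) : ℕ := (U.filter fun u => κ u < κ v).card

variable {κ : V → ℕ} {U : Finset V}

theorem position_lt_iff {u v : V} (hu : u ∈ U) :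
    position κ U u < position κ U v ↔ κ u < κ v := by
  constructor
  · intro h
    by_contra hcon
    refine absurd h (not_lt.2 (Finset.card_le_card fun w hw => ?_))
    rw [Finset.mem_filter] at hw ⊢
    exact ⟨hw.1, by omega⟩
  · intro h
    refine Finset.card_lt_card ⟨fun w hw => ?_, fun hsub => ?_⟩
    · rw [Finset.mem_filter] at hw ⊢
      exact ⟨hw.1, by omega⟩
    · have := hsub (Finset.mem_filter.2 ⟨hu, h⟩)
      simp at this

theorem position_le_iff {u v : V} (hv : v ∈ U) :
    position κ U u ≤ position κ U v ↔ κ u ≤ κ v := by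
  rw [← not_lt, ← not_lt, position_lt_iff hv]

theorem position_lt_card {u : V} (hu : u ∈ U) : position κ U u < U.card := by
  refine Finset.card_lt_card ⟨Finset.filter_subset _ _, fun hsub => ?_⟩
  have := hsub hu
  simp at this

theorem position_injOn (hκ : Function.Injective κ) : Set.InjOn (position κ U) U := by
  intro u hu v hv huv
  apply hκ
  have h1 := position_lt_iff (κ := κ) (v := v) hu
  have h2 := position_lt_iff (κ := κ) (v := u) hv
  omega

theorem image_position (hκ : Function.Injective κ) :
    U.image (position κ U) = Finset.range U.card := by
  classical
  refine Finset.eq_of_subset_of_card_le ?_ ?_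
  · intro t ht
    rw [Finset.mem_image] at ht
    obtain ⟨u, hu, rfl⟩ := ht
    exact Finset.mem_range.2 (position_lt_card hu)
  · rw [Finset.card_image_of_injOn (position_injOn hκ), Finset.card_range]

theorem card_filter_position (hκ : Function.Injective κ) (Q : ℕ → Prop) [DecidablePred Q] :
    (U.filter fun u => Q (position κ U u)).card = ((Finset.range U.card).filter Q).card := by
  rw [← image_position hκ, Finset.filter_image, Finset.card_image_of_injOn]
  exact (position_injOn hκ).mono (Finset.coe_subset.2 (Finset.filter_subset _ _))

theorem card_filter_cdist_position (hκ : Function.Injective κ) {y : V} (hy : y ∈ U)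
    (Q : ℕ → Prop) [DecidablePred Q] :
    (U.filter fun u => Q (cdist U.card (position κ U u) (position κ U y))).card =
      ((Finset.range U.card).filter Q).card := by
  rw [card_filter_position hκ (fun t => Q (cdist U.card t (position κ U y))),
    card_filter_cdist_left (position_lt_card hy)]

end Position

/-! ### Exact cuts along a path. -/

namespace ParentTree

variable {V : Type*} [Fintype V] [DecidableEq V]

/-- The order `κ` of the vertices runs along the path `P` in such a way that few edges cross each
vertex of `P`. -/
structure IsSpine (R : ParentTree V) (Δ : ℕ) (P : Finset V) (κ : V → ℕ) : Prop where
  injective : Function.Injective κ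
  card_children_le : ∀ v, (R.children v).card ≤ Δ
  card_bd_lt : ∀ x ∈ P, (R.bd {v | κ v < κ x}).card ≤ 1
  card_bd_le : ∀ x ∈ P, (R.bd {v | κ v ≤ κ x}).card ≤ Δ

/-- This is the account for the inductive step of `IsSpine.exists_exact_cut`. With s = g / u and t =
u / p', both at least 1, and with the two summands 1 absorbed by 2 ≤ Δ, the price is at most 4Δ(1 +
st) because (4t - 1)(s - 1) ≥ 0; and `hg` says (1 + st)p ≤ N. -/
theorem cost_bound {Δ N p g u p' a b : ℕ} (hΔ : 2 ≤ Δ) (hp' : 1 ≤ p') (hpu : p' ≤ u)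
    (hug : u ≤ g) (hp : p ≤ N) (hg : g * p ≤ (N - p) * p') (ha : (a : ℝ) * u ≤ Δ * g)
    (hb : b * p' ≤ 4 * Δ * u) : (1 + (Δ + (Δ + (1 + (a + b))))) * p ≤ 4 * Δ * N := by
  have hb' : (b : ℝ) * p' ≤ 4 * Δ * u := by exact_mod_cast hb
  have hg' : (g : ℝ) * p ≤ (N - p) * p' := by
    rw [← Nat.cast_sub hp]
    exact_mod_cast hg
  have hp0 : (0 : ℝ) < p' := by exact_mod_cast hp'
  have hu0 : (0 : ℝ) < u := by exact_mod_cast hp'.trans hpu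
  have hpu' : (p' : ℝ) ≤ u := by exact_mod_cast hpu
  have hug' : (u : ℝ) ≤ g := by exact_mod_cast hug
  have hΔ' : (2 : ℝ) ≤ Δ := by exact_mod_cast hΔ
  obtain ⟨s, hs⟩ : ∃ s : ℝ, s = g / u := ⟨_, rfl⟩
  obtain ⟨t, ht⟩ : ∃ t : ℝ, t = u / p' := ⟨_, rfl⟩
  have hs1 : 1 ≤ s := by rw [hs, le_div_iff₀ hu0]; linarith
  have ht1 : 1 ≤ t := by rw [ht, le_div_iff₀ hp0]; linarith
  have ha' : (a : ℝ) ≤ Δ * s := by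
    rw [hs, ← mul_div_assoc, le_div_iff₀ hu0]
    exact ha
  have hb'' : (b : ℝ) ≤ 4 * Δ * t := by
    rw [ht, ← mul_div_assoc, le_div_iff₀ hp0]
    exact hb'
  have hN : (s * t) * p ≤ N - p := by
    have : s * t = g / p' := by
      rw [hs, ht]
      field_simp
    rw [this, div_mul_eq_mul_div, div_le_iff₀ hp0]
    exact hg'
  have hkey : (1 + (Δ + (Δ + (1 + (a + b)))) : ℝ) ≤ 4 * Δ * (1 + s * t) := by
    have : 0 ≤ (Δ : ℝ) * ((4 * t - 1) * (s - 1)) := by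
      refine mul_nonneg (by linarith) (mul_nonneg (by linarith) (by linarith))
    nlinarith
  have : ((1 + (Δ + (Δ + (1 + (a + b)))) : ℝ)) * p ≤ 4 * Δ * N := by
    calc ((1 + (Δ + (Δ + (1 + (a + b)))) : ℝ)) * p ≤ 4 * Δ * (1 + s * t) * p := by gcongr
      _ = 4 * Δ * (p + (s * t) * p) := by ring
      _ ≤ 4 * Δ * N := by
        refine mul_le_mul_of_nonneg_left ?_ (by linarith)
        linarith
  exact_mod_cast this

/-- In a tree with a path that contains a proportion `1 / ρ` of the vertices in `U`, one can cut
off any number of vertices in `U` by cutting at most `4 Δ ρ` edges. -/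
theorem IsSpine.exists_exact_cut {R : ParentTree V} {Δ : ℕ} {P : Finset V} {κ : V → ℕ}
    (h : R.IsSpine Δ P κ) (hΔ : 2 ≤ Δ) (U : Finset V) (r : ℕ) (hr : r ≤ U.card)
    (hne : (P ∩ U).Nonempty) :
    ∃ B : Finset V, (B ∩ U).card = r ∧ (R.bd B).card * (P ∩ U).card ≤ 4 * Δ * U.card := by
  induction hn : U.card using Nat.strong_induction_on generalizing U r with
  | _ N ih =>
    subst hn
    rcases hr.eq_or_lt with rfl | hr
    · exact ⟨Finset.univ, by simp, by simp [bd_univ]⟩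
    have hpN : (P ∩ U).card ≤ U.card := Finset.card_le_card Finset.inter_subset_right
    set N := U.card with hN
    set π := position κ U with hπ
    have hπN : ∀ u ∈ U, π u < N := fun u hu => position_lt_card hu
    have hlt : ∀ {x}, x ∈ U → ∀ {u w}, u ∈ U → w ∈ U →
        (u ∈ (Finset.univ.filter fun v => κ v < κ x) ↔
          w ∈ (Finset.univ.filter fun v => κ v < κ x)) → (π u < π x ↔ π w < π x) := by
      intro x hx u w hu hw huw
      simpa [hπ, position_lt_iff, hu, hw] using huw
    have hle : ∀ {x}, x ∈ U → ∀ {u w}, u ∈ U → w ∈ U →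
        (u ∈ (Finset.univ.filter fun v => κ v ≤ κ x) ↔
          w ∈ (Finset.univ.filter fun v => κ v ≤ κ x)) → (π u ≤ π x ↔ π w ≤ π x) := by
      intro x hx u w hu hw huw
      simpa [hπ, position_le_iff, hx] using huw
    -- The cyclic interval from `x` inclusive to `y` exclusive then has exactly `r` elements and is
    -- determined by two cuts of at most one edge each.
    by_cases hit : ∃ x ∈ P ∩ U, ∃ y ∈ P ∩ U, cdist N (π x) (π y) = r
    · obtain ⟨x, hx, y, hy, hxy⟩ := hit
      rw [Finset.mem_inter] at hx hy
      obtain ⟨B, hB, hbd⟩ := R.exists_extension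
        [Finset.univ.filter fun v => κ v < κ x, Finset.univ.filter fun v => κ v < κ y] U
        (U.filter fun u => 1 ≤ cdist N (π u) (π y) ∧ cdist N (π u) (π y) ≤ cdist N (π x) (π y))
        (Finset.filter_subset _ _) (by
          intro u hu w hw hS huB
          simp only [List.mem_cons, List.not_mem_nil, or_false, forall_eq_or_imp, forall_eq] at hS
          rw [Finset.mem_filter] at huB ⊢
          exact ⟨hw, (cdist_pos_le_congr (hπN x hx.2) (hπN u hu) (hπN w hw) (hlt hx.2 hu hw hS.1)
            (hlt hy.2 hu hw hS.2)).1 huB.2⟩)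
      refine ⟨B, ?_, ?_⟩
      · rw [hB, hxy, card_filter_cdist_position h.injective hy.2 (fun j => 1 ≤ j ∧ j ≤ r)]
        have := card_filter_range_Ico (N := N) (a := 1) (b := r + 1) hr
        simpa [Nat.lt_succ_iff] using this
      · have h1 := h.card_bd_lt x hx.1
        have h2 := h.card_bd_lt y hy.1
        simp only [List.map_cons, List.map_nil, List.sum_cons, List.sum_nil] at hbd
        have h3 : (R.bd B).card ≤ 2 := by omega
        calc (R.bd B).card * (P ∩ U).card ≤ 2 * N := Nat.mul_le_mul h3 hpN
          _ ≤ 4 * Δ * N := Nat.mul_le_mul_right _ (by omega)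
    · push Not at hit
      have hinj : Set.InjOn π (P ∩ U : Finset V) :=
        (position_injOn h.injective).mono (Finset.coe_subset.2 Finset.inter_subset_right)
      obtain ⟨y', hy', z', hz', hmax, X', hX'A, hX'ne, hX', hXcard⟩ :=
        exists_dense_gap hr ((P ∩ U).image π) (by
          intro a ha
          obtain ⟨u, hu, rfl⟩ := Finset.mem_image.1 ha
          exact hπN u (Finset.mem_inter.1 hu).2) (hne.image _) (by
          intro a ha b hb
          obtain ⟨u, hu, rfl⟩ := Finset.mem_image.1 ha
          obtain ⟨w, hw, rfl⟩ := Finset.mem_image.1 hb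
          exact hit u hu w hw)
      rw [Finset.card_image_of_injOn hinj] at hXcard
      obtain ⟨y, hy, rfl⟩ := Finset.mem_image.1 hy'
      obtain ⟨z, hz, rfl⟩ := Finset.mem_image.1 hz'
      obtain ⟨X, hXA, hXX', hXc⟩ : ∃ X ⊆ P ∩ U, X.image π = X' ∧ X.card = X'.card := by
        obtain ⟨X, hX, rfl⟩ := Finset.subset_image_iff.1 hX'A
        exact ⟨X, hX, rfl, (Finset.card_image_of_injOn (hinj.mono (by exact_mod_cast hX))).symm⟩
      subst hXX'
      have hXne : X.Nonempty := Finset.image_nonempty.1 hX'ne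
      -- The number of steps from `u` forward to `y`. The gap after `y` is the range β > β z; in
      -- `X`, the element `xa` is farthest behind `y` and `xb` is nearest to it.
      set β : V → ℕ := fun u => cdist N (π u) (π y) with hβ
      have hX : ∀ x ∈ X, β x < r ∧ r ≤ β x + (N - 1 - β z) := fun x hx =>
        hX' _ (Finset.mem_image_of_mem _ hx)
      have hmaxz : ∀ x ∈ X, β x ≤ β z := fun x hx => hmax _ (Finset.mem_image_of_mem _ (hXA hx))
      obtain ⟨xa, hxa, hxamax⟩ := Finset.exists_max_image X β hXne
      obtain ⟨xb, hxb, hxbmin⟩ := Finset.exists_min_image X β hXne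
      have hcard : ∀ (Q : ℕ → Prop) [DecidablePred Q], (U.filter fun u => Q (β u)).card =
          ((Finset.range N).filter Q).card := fun Q _ =>
        card_filter_cdist_position h.injective (Finset.mem_inter.1 hy).2 Q
      have hβN : ∀ u ∈ U, β u < N := fun u hu =>
        cdist_lt (hπN u hu) (hπN y (Finset.mem_inter.1 hy).2)
      have hxaU := Finset.mem_inter.1 (hXA hxa)
      have hxbU := Finset.mem_inter.1 (hXA hxb)
      have hyU := Finset.mem_inter.1 hy
      have hzU := Finset.mem_inter.1 hz
      have ha1 := hX xa hxa
      have hb1 := hX xb hxb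
      have hba := hxbmin xa hxa
      have haN := hβN xa hxaU.2
      have hzN := hβN z hzU.2
      have haz := hmaxz xa hxa
      set U' := U.filter fun u => β xb ≤ β u ∧ β u < β xa + 1 with hU'
      set G := U.filter fun u => β z + 1 ≤ β u ∧ β u < N with hG
      set M := U.filter fun u => 0 ≤ β u ∧ β u < β xb with hM
      have hU'c : U'.card = β xa + 1 - β xb := by
        rw [hU', hcard (fun j => β xb ≤ j ∧ j < β xa + 1), card_filter_range_Ico (by omega)]
      have hGc : G.card = N - (β z + 1) := by
        rw [hG, hcard (fun j => β z + 1 ≤ j ∧ j < N), card_filter_range_Ico le_rfl]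
      have hMc : M.card = β xb - 0 := by
        rw [hM, hcard (fun j => 0 ≤ j ∧ j < β xb), card_filter_range_Ico (by omega)]
      have hXU' : X ⊆ P ∩ U' := by
        intro x hx
        have hxU := Finset.mem_inter.1 (hXA hx)
        rw [Finset.mem_inter, hU', Finset.mem_filter]
        exact ⟨hxU.1, hxU.2, hxbmin x hx, Nat.lt_succ_of_le (hxamax x hx)⟩
      have hU'0 : (0 : ℝ) < U'.card := by
        have : 0 < U'.card := by omega
        exact_mod_cast this
      -- The tolerance is |U'|, so that whatever is missing can be taken from `U'` by induction.
      obtain ⟨S, hS1, hS2, hS3⟩ := exists_approx_cut (by omega) h.card_children_le hU'0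
        (r - β xb) G (by omega)
      have hS2' : r - β xb ≤ (S ∩ G).card + U'.card := by exact_mod_cast hS2
      obtain ⟨B₁, hB₁, hB₁c⟩ := ih U'.card (by omega) U' (r - β xb - (S ∩ G).card) (by omega)
        (hXne.mono hXU') rfl
      obtain ⟨B, hB, hbd⟩ := R.exists_extension
        [Finset.univ.filter fun v => κ v < κ xa, Finset.univ.filter fun v => κ v ≤ κ xb,
          Finset.univ.filter fun v => κ v ≤ κ y, Finset.univ.filter fun v => κ v < κ z, S, B₁] U
        (M ∪ ((S ∩ G) ∪ (B₁ ∩ U'))) (by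
          intro u hu
          simp only [hM, hG, hU', Finset.mem_union, Finset.mem_inter, Finset.mem_filter] at hu
          tauto) (by
          intro u hu w hw hS huB
          simp only [List.mem_cons, List.not_mem_nil, or_false, forall_eq_or_imp, forall_eq] at hS
          obtain ⟨s1, s2, s3, s4, s5, s6⟩ := hS
          have t1 := hlt hxaU.2 hu hw s1
          have t2 := hle hxbU.2 hu hw s2
          have t3 := hle hyU.2 hu hw s3
          have t4 := hlt hzU.2 hu hw s4
          have e1 : β u ≤ β xa ↔ β w ≤ β xa := cdist_le_congr (hπN _ hxaU.2) (hπN u hu) (hπN w hw) t1 t3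
          have e2 : β u < β xb ↔ β w < β xb := cdist_lt_congr (hπN _ hxbU.2) (hπN u hu) (hπN w hw) t2 t3
          have e3 : β u ≤ β z ↔ β w ≤ β z := cdist_le_congr (hπN _ hzU.2) (hπN u hu) (hπN w hw) t4 t3
          have e4 := hβN u hu
          have e5 := hβN w hw
          simp only [hM, hG, hU', Finset.mem_union, Finset.mem_inter, Finset.mem_filter] at huB ⊢
          simp only [hu, hw, true_and] at huB ⊢
          rw [s5, s6] at huB
          rcases huB with hh | ⟨hh, hh'⟩ | ⟨hh, hh'⟩
          · exact .inl (by omega)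
          · exact .inr (.inl ⟨hh, by omega⟩)
          · exact .inr (.inr ⟨hh, by omega⟩))
      refine ⟨B, ?_, ?_⟩
      · rw [hB, Finset.card_union_of_disjoint, Finset.card_union_of_disjoint, hB₁, hMc]
        · omega
        · rw [Finset.disjoint_left]
          intro u h1 h2
          simp only [hG, hU', Finset.mem_inter, Finset.mem_filter] at h1 h2
          omega
        · rw [Finset.disjoint_left]
          intro u h1 h2
          simp only [hM, hG, hU', Finset.mem_union, Finset.mem_inter, Finset.mem_filter] at h1 h2
          omega
      · have c1 := h.card_bd_lt xa hxaU.1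
        have c2 := h.card_bd_le xb hxbU.1
        have c3 := h.card_bd_le y hyU.1
        have c4 := h.card_bd_lt z hzU.1
        simp only [List.map_cons, List.map_nil, List.sum_cons, List.sum_nil] at hbd
        have hpp : X.card ≤ (P ∩ U').card := Finset.card_le_card hXU'
        refine le_trans (Nat.mul_le_mul_right _ (hbd.trans ?_))
          (cost_bound (g := G.card) (u := U'.card) (p' := (P ∩ U').card) (a := (R.bd S).card)
            (b := (R.bd B₁).card) hΔ ?_ ?_ ?_ hpN ?_ ?_ hB₁c)
        · omega
        · exact (Finset.card_pos.2 hXne).trans_le hpp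
        · exact Finset.card_le_card Finset.inter_subset_right
        · omega
        · rw [hGc, show N - (β z + 1) = N - 1 - β z by omega]
          refine hXcard.trans (Nat.mul_le_mul_left _ ?_)
          rw [← hXc]
          exact hpp
        · refine hS3.trans ?_
          have : r - β xb ≤ G.card := by omega
          gcongr

end ParentTree

/-! ### Cutting off a set without losing density on the path. -/

namespace ParentTree

variable {V : Type*} [Fintype V] [DecidableEq V]

set_option maxHeartbeats 1000000 in
/-- One can cut off any number `m` of vertices in `U` by cutting few edges, in such a way that the
proportion of vertices on the path `P` does not decrease in the rest. -/
theorem IsSpine.exists_part {R : ParentTree V} {Δ : ℕ} {P : Finset V} {κ : V → ℕ}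
    (h : R.IsSpine Δ P κ) (hΔ : 2 ≤ Δ) (U : Finset V) (m : ℕ) (hm : m < U.card)
    (hne : (P ∩ U).Nonempty) :
    ∃ B : Finset V, (B ∩ U).card = m ∧ (P ∩ (B ∩ U)).card * U.card ≤ m * (P ∩ U).card ∧
      (R.bd B).card * (P ∩ U).card ≤ (Δ + 1) * (P ∩ U).card + 16 * Δ * U.card := by
  rcases Nat.eq_zero_or_pos m with rfl | hm0
  · exact ⟨∅, by simp, by simp, by simp [bd_empty]⟩
  have hpN : (P ∩ U).card ≤ U.card := Finset.card_le_card Finset.inter_subset_right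
  have hp0 : 0 < (P ∩ U).card := Finset.card_pos.2 hne
  set N := U.card with hN
  set π := position κ U with hπ
  have hπN : ∀ u ∈ U, π u < N := fun u hu => position_lt_card hu
  have hlt : ∀ {x}, x ∈ U → ∀ {u w}, u ∈ U → w ∈ U →
      (u ∈ (Finset.univ.filter fun v => κ v < κ x) ↔
        w ∈ (Finset.univ.filter fun v => κ v < κ x)) → (π u < π x ↔ π w < π x) := by
    intro x hx u w hu hw huw
    simpa [hπ, position_lt_iff, hu, hw] using huw
  have hle : ∀ {x}, x ∈ U → ∀ {u w}, u ∈ U → w ∈ U →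
      (u ∈ (Finset.univ.filter fun v => κ v ≤ κ x) ↔
        w ∈ (Finset.univ.filter fun v => κ v ≤ κ x)) → (π u ≤ π x ↔ π w ≤ π x) := by
    intro x hx u w hu hw huw
    simpa [hπ, position_le_iff, hx] using huw
  have hinj : Set.InjOn π (P ∩ U : Finset V) :=
    (position_injOn h.injective).mono (Finset.coe_subset.2 Finset.inter_subset_right)
  have himg : ∀ y, ((((P ∩ U).image π)).filter fun x => N - m ≤ cdist N x y).card =
      ((P ∩ U).filter fun x => N - m ≤ cdist N (π x) y).card := by
    intro y
    rw [Finset.filter_image, Finset.card_image_of_injOn]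
    exact hinj.mono (by exact_mod_cast Finset.filter_subset _ _)
  obtain ⟨y', hy', havg, hmin⟩ := exists_sparse_window hm ((P ∩ U).image π) (by
    intro a ha
    obtain ⟨u, hu, rfl⟩ := Finset.mem_image.1 ha
    exact hπN u (Finset.mem_inter.1 hu).2) (hne.image _)
  obtain ⟨y, hy, rfl⟩ := Finset.mem_image.1 hy'
  have hyU := Finset.mem_inter.1 hy
  have hmin' : ∀ w ∈ P ∩ U, ((P ∩ U).filter fun x => N - m ≤ cdist N (π x) (π y)).card ≤
      ((P ∩ U).filter fun x => N - m ≤ cdist N (π x) (π w)).card := by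
    intro w hw
    have := hmin _ (Finset.mem_image_of_mem _ hw)
    rwa [himg, himg] at this
  rw [himg, Finset.card_image_of_injOn hinj] at havg
  clear hmin himg hy'
  set β : V → ℕ := fun u => cdist N (π u) (π y) with hβ
  set F := ((P ∩ U).filter fun x => N - m ≤ β x).card with hF
  have hβN : ∀ u ∈ U, β u < N := fun u hu => cdist_lt (hπN u hu) (hπN y hyU.2)
  have hcard : ∀ (Q : ℕ → Prop) [DecidablePred Q], (U.filter fun u => Q (β u)).card =
      ((Finset.range N).filter Q).card := fun Q _ =>
    card_filter_cdist_position h.injective hyU.2 Q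
  have hβy : β y = 0 := by simp [hβ, cdist]
  -- The window consists of the `m` elements after `y`, that is, β ≥ N - m, and `F` counts its path
  -- vertices. The first path vertex beyond it is `z`; prolonging the window up to `z` gives `Y`,
  -- which has no further path vertices and is determined by two cheap cuts.
  obtain ⟨z, hz, hzmax⟩ := Finset.exists_max_image ((P ∩ U).filter fun x => β x < N - m) β
    ⟨y, Finset.mem_filter.2 ⟨hy, by omega⟩⟩
  rw [Finset.mem_filter] at hz
  have hzU := Finset.mem_inter.1 hz.1
  have hzm := hz.2
  set Y := U.filter fun u => β z + 1 ≤ β u ∧ β u < N with hY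
  have hYc : Y.card = N - (β z + 1) := by
    rw [hY, hcard (fun j => β z + 1 ≤ j ∧ j < N), card_filter_range_Ico le_rfl]
  have hYU : Y ⊆ U := Finset.filter_subset _ _
  have hPY : P ∩ Y = (P ∩ U).filter fun x => N - m ≤ β x := by
    ext x
    rw [hY, Finset.mem_inter, Finset.mem_filter, Finset.mem_filter, Finset.mem_inter]
    constructor
    · rintro ⟨h1, h2, h3, -⟩
      refine ⟨⟨h1, h2⟩, ?_⟩
      by_contra h4
      have := hzmax x (Finset.mem_filter.2 ⟨Finset.mem_inter.2 ⟨h1, h2⟩, by omega⟩)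
      omega
    · rintro ⟨⟨h1, h2⟩, h3⟩
      exact ⟨h1, h2, by omega, hβN x h2⟩
  have hYcongr : ∀ u ∈ U, ∀ w ∈ U,
      (u ∈ (Finset.univ.filter fun v => κ v ≤ κ y) ↔
        w ∈ (Finset.univ.filter fun v => κ v ≤ κ y)) →
      (u ∈ (Finset.univ.filter fun v => κ v < κ z) ↔
        w ∈ (Finset.univ.filter fun v => κ v < κ z)) → (u ∈ Y ↔ w ∈ Y) := by
    intro u hu w hw s1 s2
    have e3 : β u ≤ β z ↔ β w ≤ β z := cdist_le_congr (hπN _ hzU.2) (hπN u hu) (hπN w hw)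
      (hlt hzU.2 hu hw s2) (hle hyU.2 hu hw s1)
    have e4 := hβN u hu
    have e5 := hβN w hw
    simp only [hY, Finset.mem_filter, hu, hw, true_and]
    omega
  have c1 := h.card_bd_le y hyU.1
  have c2 := h.card_bd_lt z hzU.1
  -- If `F` is below half the average, `Y` supplies `m` elements up to an error of m|P ∩ U| / (2N).
  -- The missing ones come from the rest of `U`: even if all of them are path vertices, these and
  -- the `F` in the window are together at most the average.
  by_cases hsparse : 2 * F * N < m * (P ∩ U).card
  · have hN0 : (0 : ℝ) < N := by
      have : 0 < N := by omega
      exact_mod_cast this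
    have hm0' : (0 : ℝ) < m := by exact_mod_cast hm0
    have hp0' : (0 : ℝ) < (P ∩ U).card := by exact_mod_cast hp0
    have hq : (0 : ℝ) < m * (P ∩ U).card / (2 * N) := by positivity
    obtain ⟨S, hS1, hS2, hS3⟩ := exists_approx_cut (by omega) h.card_children_le hq m Y (by omega)
    have hSY : S ∩ Y ⊆ U := Finset.inter_subset_right.trans hYU
    have hcd : (U \ (S ∩ Y)).card = N - (S ∩ Y).card := Finset.card_sdiff_of_subset hSY
    have h2F : 2 * F < (P ∩ U).card := by
      have : 2 * F * N < (P ∩ U).card * N := hsparse.trans_le (by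
        rw [mul_comm]; exact Nat.mul_le_mul_left _ hm.le)
      exact lt_of_mul_lt_mul_right this (Nat.zero_le _)
    have hrest : (P ∩ U).card ≤ (P ∩ (U \ (S ∩ Y))).card + F := by
      rw [hF, ← hPY]
      refine (Finset.card_le_card ?_).trans (Finset.card_union_le _ _)
      intro u
      simp only [Finset.mem_inter, Finset.mem_union, Finset.mem_sdiff]
      tauto
    -- More than half of the path vertices are still available, which at most doubles the bound 4ΔN
    -- / |P ∩ U| for the exact cut.
    obtain ⟨B₁, hB₁, hB₁c⟩ := h.exists_exact_cut hΔ (U \ (S ∩ Y)) (m - (S ∩ Y).card) (by omega)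
      (Finset.card_pos.1 (by omega))
    obtain ⟨B, hB, hbd⟩ := R.exists_extension
      [Finset.univ.filter fun v => κ v ≤ κ y, Finset.univ.filter fun v => κ v < κ z, S, B₁] U
      ((S ∩ Y) ∪ (B₁ ∩ (U \ (S ∩ Y)))) (by
        intro u hu
        rcases Finset.mem_union.1 hu with hu | hu
        · exact hSY hu
        · exact (Finset.mem_sdiff.1 (Finset.mem_inter.1 hu).2).1) (by
        intro u hu w hw hS huB
        simp only [List.mem_cons, List.not_mem_nil, or_false, forall_eq_or_imp, forall_eq] at hS
        obtain ⟨s1, s2, s3, s4⟩ := hS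
        have e := hYcongr u hu w hw s1 s2
        simp only [Finset.mem_union, Finset.mem_inter, Finset.mem_sdiff] at huB ⊢
        tauto)
    have hS2' : ((m - (S ∩ Y).card : ℕ) : ℝ) ≤ m * (P ∩ U).card / (2 * N) := by
      rw [Nat.cast_sub hS1]
      linarith
    refine ⟨B, ?_, ?_, ?_⟩
    · rw [hB, Finset.card_union_of_disjoint, hB₁]
      · omega
      · rw [Finset.disjoint_left]
        intro u
        simp only [Finset.mem_inter, Finset.mem_sdiff]
        tauto
    · have h1 : (P ∩ (B ∩ U)).card ≤ F + (m - (S ∩ Y).card) := by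
        rw [hB, hF, ← hPY, ← hB₁]
        refine (Finset.card_le_card ?_).trans (Finset.card_union_le _ _)
        intro u
        simp only [Finset.mem_inter, Finset.mem_union, Finset.mem_sdiff]
        tauto
      have h1' : ((P ∩ (B ∩ U)).card : ℝ) ≤ F + (m - (S ∩ Y).card : ℕ) := by exact_mod_cast h1
      have h2 : (2 * F * N : ℝ) < m * (P ∩ U).card := by exact_mod_cast hsparse
      rw [le_div_iff₀ (by positivity)] at hS2'
      have : ((P ∩ (B ∩ U)).card : ℝ) * N ≤ m * (P ∩ U).card := by
        calc ((P ∩ (B ∩ U)).card : ℝ) * N ≤ (F + (m - (S ∩ Y).card : ℕ)) * N := by gcongr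
          _ ≤ m * (P ∩ U).card := by nlinarith
      exact_mod_cast this
    · simp only [List.map_cons, List.map_nil, List.sum_cons, List.sum_nil] at hbd
      have h1 : (R.bd S).card * (P ∩ U).card ≤ 2 * Δ * N := by
        have h2 : ((R.bd S).card : ℝ) * (P ∩ U).card ≤ 2 * Δ * N := by
          rw [← mul_div_assoc, div_le_iff₀ (by positivity)] at hS3
          refine le_of_mul_le_mul_right ?_ hm0'
          linarith
        exact_mod_cast h2
      have h3 : (R.bd B₁).card * (P ∩ U).card ≤ 8 * Δ * N := by
        calc (R.bd B₁).card * (P ∩ U).card ≤ (R.bd B₁).card * (2 * (P ∩ (U \ (S ∩ Y))).card) :=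
              Nat.mul_le_mul_left _ (by omega)
          _ = 2 * ((R.bd B₁).card * (P ∩ (U \ (S ∩ Y))).card) := by ring
          _ ≤ 2 * (4 * Δ * (U \ (S ∩ Y)).card) := Nat.mul_le_mul_left _ hB₁c
          _ = 8 * Δ * (U \ (S ∩ Y)).card := by ring
          _ ≤ 8 * Δ * N := Nat.mul_le_mul_left _ (by omega)
      calc (R.bd B).card * (P ∩ U).card
          ≤ ((Δ + 1) + ((R.bd S).card + (R.bd B₁).card)) * (P ∩ U).card :=
            Nat.mul_le_mul_right _ (by omega)
        _ = (Δ + 1) * (P ∩ U).card + ((R.bd S).card * (P ∩ U).card +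
              (R.bd B₁).card * (P ∩ U).card) := by ring
        _ ≤ (Δ + 1) * (P ∩ U).card + (2 * Δ * N + 8 * Δ * N) := by omega
        _ ≤ (Δ + 1) * (P ∩ U).card + 16 * Δ * N := by nlinarith
  · push Not at hsparse
    have hF0 : 0 < F := by
      by_contra hF0
      have : F = 0 := by omega
      rw [this] at hsparse
      have := Nat.mul_pos hm0 hp0
      omega
    -- Let `w` be the last path vertex in the window. If |Y| > 2m, more than `m` elements separate
    -- `w` from `z`, so the window after `w` contains no path vertex; as F > 0, this contradicts the
    -- minimality of the window after `y`.
    have hY2 : Y.card ≤ 2 * m := by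
      by_contra hcon
      obtain ⟨w, hw, hwmin⟩ := Finset.exists_min_image _ β (Finset.card_pos.1 hF0)
      rw [Finset.mem_filter] at hw
      have hwU := Finset.mem_inter.1 hw.1
      have hle0 := hmin' w hw.1
      have : ((P ∩ U).filter fun x => N - m ≤ cdist N (π x) (π w)) = ∅ := by
        refine Finset.filter_eq_empty_iff.2 fun x hx => ?_
        have hxU := Finset.mem_inter.1 hx
        have hx1 := hπN x hxU.2
        have hw1 := hπN w hwU.2
        have hy1 := hπN y hyU.2
        have k1 : β x < N - m ∧ β x ≤ β z ∨ N - m ≤ β x ∧ β w ≤ β x := by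
          by_cases hxm : β x < N - m
          · exact .inl ⟨hxm, hzmax x (Finset.mem_filter.2 ⟨hx, hxm⟩)⟩
          · exact .inr ⟨by omega, hwmin x (Finset.mem_filter.2 ⟨hx, by omega⟩)⟩
        have k2 := hw.2
        have s1 : π x ≤ π y ∧ β x = π y - π x ∨ π y < π x ∧ β x = π y + N - π x :=
          cdist_spec N (π x) (π y)
        have s2 : π w ≤ π y ∧ β w = π y - π w ∨ π y < π w ∧ β w = π y + N - π w :=
          cdist_spec N (π w) (π y)
        have s3 := cdist_spec N (π x) (π w)
        clear_value β
        omega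
      rw [this, Finset.card_empty] at hle0
      omega
    -- The whole set is taken from `Y`, whose path vertices do not exceed the average. The price
    -- 4Δ|Y| / F is at most 8Δm / F ≤ 16ΔN / |P ∩ U|.
    obtain ⟨B₁, hB₁, hB₁c⟩ := h.exists_exact_cut hΔ Y m (by omega)
      (Finset.card_pos.1 (by rw [hPY]; exact hF0))
    obtain ⟨B, hB, hbd⟩ := R.exists_extension
      [Finset.univ.filter fun v => κ v ≤ κ y, Finset.univ.filter fun v => κ v < κ z, B₁] U
      (B₁ ∩ Y) (Finset.inter_subset_right.trans hYU) (by
        intro u hu w hw hS huB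
        simp only [List.mem_cons, List.not_mem_nil, or_false, forall_eq_or_imp, forall_eq] at hS
        obtain ⟨s1, s2, s3⟩ := hS
        have e := hYcongr u hu w hw s1 s2
        simp only [Finset.mem_inter] at huB ⊢
        tauto)
    refine ⟨B, by rw [hB, hB₁], ?_, ?_⟩
    · refine le_trans (Nat.mul_le_mul_right _ ?_) havg
      rw [hF, ← hPY, hB]
      exact Finset.card_le_card (Finset.inter_subset_inter_left Finset.inter_subset_right)
    · simp only [List.map_cons, List.map_nil, List.sum_cons, List.sum_nil] at hbd
      rw [hPY, ← hF] at hB₁c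
      have h3 : (R.bd B₁).card * (P ∩ U).card ≤ 16 * Δ * N := by
        refine Nat.le_of_mul_le_mul_right ?_ hF0
        calc (R.bd B₁).card * (P ∩ U).card * F = (R.bd B₁).card * F * (P ∩ U).card := by ring
          _ ≤ 4 * Δ * Y.card * (P ∩ U).card := Nat.mul_le_mul_right _ hB₁c
          _ ≤ 4 * Δ * (2 * m) * (P ∩ U).card := by gcongr
          _ = 8 * Δ * (m * (P ∩ U).card) := by ring
          _ ≤ 8 * Δ * (2 * F * N) := Nat.mul_le_mul_left _ hsparse
          _ = 16 * Δ * N * F := by ring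
      calc (R.bd B).card * (P ∩ U).card
          ≤ ((Δ + 1) + (R.bd B₁).card) * (P ∩ U).card := Nat.mul_le_mul_right _ (by omega)
        _ = (Δ + 1) * (P ∩ U).card + (R.bd B₁).card * (P ∩ U).card := by ring
        _ ≤ (Δ + 1) * (P ∩ U).card + 16 * Δ * N := by omega

end ParentTree

/-! ### The spine order, and coding sets by their boundary. -/

namespace ParentTree

variable {V : Type*} [Fintype V] [DecidableEq V] (R : ParentTree V)

open Classical in
/-- The vertices on the path from the root to `b`. -/
noncomputable def trunk (b : V) : Finset V := {u | R.Anc u b}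

theorem mem_trunk {b u : V} : u ∈ R.trunk b ↔ R.Anc u b := by simp [trunk]

theorem card_trunk (b : V) : (R.trunk b).card = R.depth b + 1 := by
  induction hd : R.depth b generalizing b with
  | zero =>
    rw [R.depth_eq_zero] at hd
    subst hd
    refine Finset.card_eq_one.2 ⟨R.root, ?_⟩
    ext u
    rw [mem_trunk, Finset.mem_singleton]
    constructor
    · rintro ⟨j, rfl⟩
      exact Function.iterate_fixed R.par_root j
    · rintro rfl
      exact R.anc_refl _
  | succ k ih =>
    have h1 : R.trunk b = insert b (R.trunk (R.par b)) := by
      ext u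
      rw [Finset.mem_insert, mem_trunk, mem_trunk, R.anc_iff u b]
    have hk : R.depth (R.par b) = k := by rw [R.depth_par, hd, Nat.add_sub_cancel]
    rw [h1, Finset.card_insert_of_notMem, ih _ hk]
    rw [mem_trunk]
    intro hb
    have := hb.depth_le
    omega

/-- The path from the root to any vertex is a spine. -/
theorem exists_isSpine {Δ : ℕ} (hR : ∀ v, (R.children v).card ≤ Δ) (b : V) :
    ∃ κ, R.IsSpine Δ (R.trunk b) κ := by
  classical
  set P := R.trunk b with hP
  set n := Fintype.card V with hn
  set idx : V → ℕ := fun v => Fintype.equivFin V v with hidx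
  have hidxn : ∀ v, idx v < n := fun v => (Fintype.equivFin V v).2
  have hidxinj : Function.Injective idx := fun v w hvw =>
    (Fintype.equivFin V).injective (Fin.ext hvw)
  -- The number of trunk vertices above `v` tells at which trunk vertex the branch of `v` hangs. In
  -- `key`, this trunk vertex precedes the rest of its branch; `idx` breaks the remaining ties.
  set cnt : V → ℕ := fun v => (P.filter fun x => R.Anc x v).card with hcnt
  set key : V → ℕ := fun v => 2 * cnt v + if v ∈ P then 0 else 1 with hkey
  set κ : V → ℕ := fun v => key v * n + idx v with hκ
  have hκlt : ∀ {v x}, key v < key x → κ v < κ x := by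
    intro v x hvx
    have h1 : (key v + 1) * n ≤ key x * n := Nat.mul_le_mul_right _ hvx
    have h2 := hidxn v
    simp only [hκ]
    nlinarith
  have hinj : Function.Injective κ := by
    intro v w hvw
    rcases lt_trichotomy (key v) (key w) with h | h | h
    · exact absurd hvw (hκlt h).ne
    · apply hidxinj
      simp only [hκ, h] at hvw
      omega
    · exact absurd hvw (hκlt h).ne'
  -- So the initial segment before a trunk vertex is the complement of a subtree.
  have hmain : ∀ x ∈ P, ∀ v, κ v < κ x ↔ ¬ R.Anc x v := by
    intro x hx v
    rw [hP, mem_trunk] at hx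
    have hkx : key x = 2 * cnt x := by simp [hkey, hP, mem_trunk, hx]
    constructor
    · intro hlt hxv
      by_cases hvx : v = x
      · subst hvx
        exact lt_irrefl _ hlt
      have hle : cnt x ≤ cnt v := Finset.card_le_card fun y hy => by
        rw [Finset.mem_filter] at hy ⊢
        exact ⟨hy.1, hy.2.trans hxv⟩
      refine absurd hlt (hκlt ?_).le.not_gt
      rw [hkx]
      simp only [hkey]
      by_cases hv : v ∈ P
      · have : cnt x < cnt v := by
          refine Finset.card_lt_card ⟨fun y hy => ?_, fun hsub => ?_⟩
          · rw [Finset.mem_filter] at hy ⊢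
            exact ⟨hy.1, hy.2.trans hxv⟩
          · have := hsub (Finset.mem_filter.2 ⟨hv, R.anc_refl v⟩)
            rw [Finset.mem_filter] at this
            exact hvx (this.2.antisymm hxv)
        omega
      · rw [if_neg hv]
        omega
    · intro hxv
      apply hκlt
      have hlt : cnt v < cnt x := by
        refine Finset.card_lt_card ⟨fun y hy => ?_, fun hsub => ?_⟩
        · rw [Finset.mem_filter] at hy ⊢
          refine ⟨hy.1, ?_⟩
          have hyb := hy.1
          rw [hP, mem_trunk] at hyb
          refine (hyb.total hx).resolve_right fun hxy => hxv (hxy.trans hy.2)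
        · have := hsub (Finset.mem_filter.2 ⟨(by rwa [hP, mem_trunk]), R.anc_refl x⟩)
          rw [Finset.mem_filter] at this
          exact hxv this.2
      rw [hkx]
      simp only [hkey]
      split_ifs <;> omega
  refine ⟨κ, hinj, hR, fun x hx => ?_, fun x hx => ?_⟩
  · have : (Finset.univ.filter fun v => κ v < κ x) = (R.desc x)ᶜ := by
      ext v
      simp [hmain x hx, mem_desc]
    rw [this, bd_compl]
    simpa using Finset.card_le_card (R.bd_desc_subset x)
  · have : (Finset.univ.filter fun v => κ v ≤ κ x) = ((R.desc x).erase x)ᶜ := by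
      ext v
      rw [Finset.mem_filter, Finset.mem_compl, Finset.mem_erase, mem_desc, le_iff_lt_or_eq,
        hmain x hx, hinj.eq_iff]
      simp
      tauto
    rw [this, bd_compl]
    exact (Finset.card_le_card (R.bd_desc_erase_subset x)).trans (hR x)

open Classical in
/-- The parity of the number of vertices `f j` with `j < C` above `v`, shifted by `e`. -/
noncomputable def parity (C e : ℕ) (f : ℕ → V) (v : V) : ℕ :=
  (e + ∑ j ∈ Finset.range C, if R.Anc (f j) v then 1 else 0) % 2

/-- Every set with at most `C` boundary edges is a symmetric difference of subtrees. -/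
theorem exists_parity_eq (C : ℕ) (B : Finset V) (hB : (R.bd B).card ≤ C) :
    ∃ e < 2, ∃ f : ℕ → V, ∀ v, v ∈ B ↔ R.parity C e f v = 1 := by
  classical
  set e₀ : ℕ := if R.root ∈ B then 1 else 0 with he₀
  -- On the way from the root to `v`, membership in `B` changes exactly at the boundary vertices.
  have h1 : ∀ v, v ∈ B ↔ (e₀ + ∑ u ∈ R.bd B, if R.Anc u v then 1 else 0) % 2 = 1 := by
    intro v
    induction hd : R.depth v generalizing v with
    | zero =>
      rw [R.depth_eq_zero] at hd
      subst hd
      rw [Finset.sum_eq_zero]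
      · simp only [he₀]
        split_ifs with h <;> simp [h]
      · intro u hu
        rw [if_neg]
        rintro ⟨j, rfl⟩
        rw [Function.iterate_fixed R.par_root j, mem_bd, R.par_root] at hu
        exact hu Iff.rfl
    | succ k ih =>
      have hk : R.depth (R.par v) = k := by rw [R.depth_par, hd, Nat.add_sub_cancel]
      have ih' := ih (R.par v) hk
      have hnot : ¬R.Anc v (R.par v) := by
        intro hv
        have := hv.depth_le
        omega
      have hsum : (∑ u ∈ R.bd B, if R.Anc u v then 1 else 0) =
          (∑ u ∈ R.bd B, if R.Anc u (R.par v) then 1 else 0) + if v ∈ R.bd B then 1 else 0 := by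
        rw [← Finset.sum_ite_eq' (R.bd B) v (fun _ => 1), ← Finset.sum_add_distrib]
        refine Finset.sum_congr rfl fun u _ => ?_
        rw [R.anc_iff u v]
        by_cases huv : u = v
        · subst huv
          simp [hnot]
        · simp [huv]
      rw [hsum]
      have hbd : v ∈ R.bd B ↔ ¬(v ∈ B ↔ R.par v ∈ B) := R.mem_bd
      by_cases hv : v ∈ R.bd B
      · rw [if_pos hv]
        rw [hbd] at hv
        generalize (∑ u ∈ R.bd B, if R.Anc u (R.par v) then 1 else 0) = s at *
        have : (e₀ + (s + 1)) % 2 = 1 ↔ ¬((e₀ + s) % 2 = 1) := by omega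
        rw [this, ← ih']
        tauto
      · rw [if_neg hv]
        rw [hbd, not_not] at hv
        rw [hv, ih', add_zero]
  set s := (R.bd B).card with hs
  set g := (R.bd B).equivFin.symm with hg
  -- Unused places are filled with the root, which lies above every vertex; `e` compensates for
  -- these `C - s` additional flips.
  refine ⟨(e₀ + (C - s)) % 2, Nat.mod_lt _ (by norm_num),
    fun j => if hj : j < s then g ⟨j, hj⟩ else R.root, fun v => ?_⟩
  rw [h1 v, parity]
  have hsplit : (∑ j ∈ Finset.range C,
      if R.Anc (if hj : j < s then (g ⟨j, hj⟩ : V) else R.root) v then 1 else 0) =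
      (∑ u ∈ R.bd B, if R.Anc u v then 1 else 0) + (C - s) := by
    rw [← Finset.sum_range_add_sum_Ico _ hB]
    congr 1
    · rw [Finset.sum_range, ← Finset.sum_coe_sort (R.bd B), ← g.sum_comp]
      refine Finset.sum_congr rfl fun j _ => ?_
      simp
    · rw [Finset.sum_congr rfl (g := fun _ => 1), Finset.sum_const, Nat.card_Ico, smul_eq_mul,
        mul_one]
      intro j hj
      rw [Finset.mem_Ico] at hj
      rw [dif_neg (by omega), if_pos (R.anc_root v)]
  rw [hsplit]
  omega

/-- Parity can change between `v` and its parent only if `v` is one of the `f j`. So every candidate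
of the search is cheap, and the search need not check the number of cut edges. -/
theorem card_bd_parity_le (C e : ℕ) (f : ℕ → V) :
    (R.bd {v | R.parity C e f v = 1}).card ≤ C := by
  classical
  have hsub : R.bd {v | R.parity C e f v = 1} ⊆ (Finset.range C).image f := by
    intro v hv
    by_contra hcon
    rw [mem_bd] at hv
    apply hv
    have hpar : R.parity C e f v = R.parity C e f (R.par v) := by
      unfold parity
      rw [Finset.sum_congr rfl]
      intro j hj
      have : f j ≠ v := fun h => hcon (Finset.mem_image.2 ⟨j, hj, h⟩)
      rw [R.anc_iff (f j) v]
      simp [this]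
    simp [hpar]
  exact (Finset.card_le_card hsub).trans (Finset.card_image_le.trans (by simp))

end ParentTree

/-! ### Rooting a tree by distances. -/

namespace SimpleGraph

variable {V : Type*} {T : SimpleGraph V}

theorem IsTree.exists_adj_dist_add_one (hT : T.IsTree) {a v : V} (hv : v ≠ a) :
    ∃ w, T.Adj v w ∧ T.dist a w + 1 = T.dist a v := by
  obtain ⟨p, hp⟩ := hT.1.exists_walk_length_eq_dist v a
  cases p with
  | nil => exact absurd rfl hv
  | cons h q =>
    rename_i w
    refine ⟨w, h, ?_⟩
    rw [Walk.length_cons] at hp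
    have h1 := dist_le q
    have h2 := hT.1.dist_triangle (u := a) (v := w) (w := v)
    have h3 : T.dist w v = 1 := dist_eq_one_iff_adj.2 h.symm
    rw [dist_comm] at h1
    rw [dist_comm] at hp
    omega

/-- Both neighbours continue to shortest paths from `v` to `a`, and these coincide in a tree. -/
theorem IsTree.eq_of_adj_of_dist (hT : T.IsTree) {a v w w' : V} (h : T.Adj v w)
    (h' : T.Adj v w') (hd : T.dist a w + 1 = T.dist a v) (hd' : T.dist a w' + 1 = T.dist a v) :
    w = w' := by
  have key : ∀ {w}, T.Adj v w → T.dist a w + 1 = T.dist a v →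
      ∃ p : T.Walk v a, p.IsPath ∧ p.snd = w := by
    intro w h hd
    obtain ⟨p, hp⟩ := hT.1.exists_walk_length_eq_dist w a
    refine ⟨.cons h p, ?_, by simp⟩
    apply Walk.isPath_of_length_eq_dist
    rw [Walk.length_cons, hp, dist_comm, hd, dist_comm]
  obtain ⟨p, hp, rfl⟩ := key h hd
  obtain ⟨q, hq, rfl⟩ := key h' hd'
  rw [(hT.existsUnique_path v a).unique hp hq]

open Classical in
/-- The tree `T`, rooted at `a`. -/
noncomputable def IsTree.parentTree (hT : T.IsTree) (a : V) : ParentTree V where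
  root := a
  par v := if h : v = a then a else (hT.exists_adj_dist_add_one h).choose
  depth v := T.dist a v
  depth_eq_zero v := by rw [hT.1.dist_eq_zero_iff, eq_comm]
  depth_par v := by
    split_ifs with h
    · simp [h]
    · have := (hT.exists_adj_dist_add_one h).choose_spec.2
      omega

theorem IsTree.parentTree_depth (hT : T.IsTree) (a v : V) :
    (hT.parentTree a).depth v = T.dist a v := rfl

theorem IsTree.parentTree_par_spec (hT : T.IsTree) {a v : V} (h : v ≠ a) :
    T.Adj v ((hT.parentTree a).par v) ∧ T.dist a ((hT.parentTree a).par v) + 1 = T.dist a v := by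
  have := (hT.exists_adj_dist_add_one h).choose_spec
  simp only [parentTree, dif_neg h]
  exact this

theorem IsTree.parentTree_par_eq (hT : T.IsTree) {a v w : V} (h : T.Adj v w)
    (hd : T.dist a w + 1 = T.dist a v) : (hT.parentTree a).par v = w := by
  have hv : v ≠ a := by
    rintro rfl
    rw [dist_self] at hd
    omega
  obtain ⟨h1, h2⟩ := hT.parentTree_par_spec hv
  exact hT.eq_of_adj_of_dist h1 h h2 hd

theorem IsTree.parentTree_par_of_adj (hT : T.IsTree) (a : V) {v w : V} (h : T.Adj v w) :
    (hT.parentTree a).par v = w ∨ (hT.parentTree a).par w = v := by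
  rcases hT.dist_eq_dist_add_one_of_adj a h with h' | h'
  · exact .inl (hT.parentTree_par_eq h h'.symm)
  · exact .inr (hT.parentTree_par_eq h.symm h'.symm)

/-- This lets the program test ancestry with the distance matrix alone, without computing parents.
-/
theorem IsTree.parentTree_anc_iff (hT : T.IsTree) (a u v : V) :
    (hT.parentTree a).Anc u v ↔ T.dist a u + T.dist u v = T.dist a v := by
  induction hd : T.dist a v generalizing v with
  | zero =>
    obtain rfl : a = v := (hT.1.dist_eq_zero_iff).1 hd
    have h2 : (hT.parentTree a).Anc u a ↔ u = a := by
      constructor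
      · rintro ⟨j, rfl⟩
        exact Function.iterate_fixed (hT.parentTree a).par_root j
      · rintro rfl
        exact ParentTree.anc_refl _ _
    rw [h2]
    constructor
    · rintro rfl
      simp
    · intro h
      have : T.dist a u = 0 := by omega
      exact ((hT.1.dist_eq_zero_iff).1 this).symm
  | succ k ih =>
    have hv : v ≠ a := by
      rintro rfl
      rw [dist_self] at hd
      omega
    obtain ⟨h1, h2⟩ := hT.parentTree_par_spec hv
    have h3 := ih ((hT.parentTree a).par v) (by omega)
    rw [ParentTree.anc_iff, h3]
    generalize (hT.parentTree a).par v = w at *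
    have hvw : T.dist w v = 1 := dist_eq_one_iff_adj.2 h1.symm
    have t1 := hT.1.dist_triangle (u := u) (v := w) (w := v)
    have t2 := hT.1.dist_triangle (u := a) (v := u) (w := v)
    constructor
    · rintro (rfl | h)
      · simp [hd]
      · omega
    · intro h
      by_cases huv : u = v
      · exact .inl huv
      right
      obtain ⟨w', hw', hd'⟩ := hT.exists_adj_dist_add_one (a := u) (Ne.symm huv)
      have t3 := hT.1.dist_triangle (u := a) (v := u) (w := w')
      have t4 := hT.1.dist_triangle (u := a) (v := w') (w := v)
      have hvw' : T.dist w' v = 1 := dist_eq_one_iff_adj.2 hw'.symm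
      obtain rfl : w = w' := hT.eq_of_adj_of_dist h1 hw' h2 (by omega)
      omega

theorem IsTree.card_children_parentTree_le [Fintype V] [DecidableEq V] [DecidableRel T.Adj]
    (hT : T.IsTree) (a v : V) : ((hT.parentTree a).children v).card ≤ T.maxDegree := by
  refine le_trans (Finset.card_le_card fun c hc => ?_) (T.degree_le_maxDegree v)
  rw [ParentTree.mem_children] at hc
  rw [mem_neighborFinset]
  have hca : c ≠ a := by
    rintro rfl
    exact hc.2 ((ParentTree.par_root (hT.parentTree c)).symm.trans hc.1)
  have := (hT.parentTree_par_spec hca).1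
  rw [hc.1] at this
  exact this.symm

/-- If all degrees were at most 1, the degree sum 2(n - 1) would be at most n. -/
theorem IsTree.two_le_maxDegree [Fintype V] [DecidableRel T.Adj] (hT : T.IsTree)
    (hn : 3 ≤ Fintype.card V) : 2 ≤ T.maxDegree := by
  classical
  have h1 := T.sum_degrees_eq_twice_card_edges
  have h2 := hT.card_edgeFinset
  have h3 : ∑ v, T.degree v ≤ Fintype.card V * T.maxDegree := by
    rw [← smul_eq_mul, ← Finset.card_univ]
    exact Finset.sum_le_card_nsmul _ _ _ fun v _ => T.degree_le_maxDegree v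
  by_contra hcon
  have : Fintype.card V * T.maxDegree ≤ Fintype.card V * 1 :=
    Nat.mul_le_mul_left _ (by omega)
  omega

theorem IsTree.length_eq_dist (hT : T.IsTree) {u v : V} {p : T.Walk u v} (hp : p.IsPath) :
    p.length = T.dist u v := by
  obtain ⟨q, hq, hl⟩ := hT.1.exists_path_of_dist u v
  rw [(hT.existsUnique_path u v).unique hp hq, hl]

end SimpleGraph

/-! ### A language with bounded loops only

Every loop of the following language runs through the numbers below `n`, so that its programs run
in polynomial time. The variable `x` is kept in the register `2 x + 1`, the number `n` in the
register `0`, and the other registers are auxiliary. -/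

namespace RAM

/-- Terms. -/
inductive Tm : Type
  /-- a constant -/
  | const (a : ℕ) : Tm
  /-- the value of the variable `x` -/
  | var (x : ℕ) : Tm
  /-- the bound `n` of all loops -/
  | size : Tm
  /-- an array entry -/
  | get (a : ℕ) (t : Tm) : Tm
  /-- the sum -/
  | add (t u : Tm) : Tm
  /-- the truncated difference -/
  | sub (t u : Tm) : Tm
  /-- the value of `t` if that of `c` is nonzero, otherwise that of `u` -/
  | ite (c t u : Tm) : Tm
  /-- the sum of the values of `t` for `x = 0, …, n - 1` -/
  | sum (x : ℕ) (t : Tm) : Tm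

/-- Statements. -/
inductive Stmt : Type
  /-- assign the value of `t` to the variable `x` -/
  | set (x : ℕ) (t : Tm) : Stmt
  /-- store the value of `t` in the array `a` at the position given by `i` -/
  | put (a : ℕ) (i t : Tm) : Stmt
  /-- run `S`, then `S'` -/
  | seq (S S' : Stmt) : Stmt
  /-- run `S` if the value of `c` is nonzero, otherwise run `S'` -/
  | ite (c : Tm) (S S' : Stmt) : Stmt
  /-- run `S` for `x = 0, …, n - 1` -/
  | each (x : ℕ) (S : Stmt) : Stmt

/-- Change the register `x`. -/
def State.setReg (s : State) (x v : ℕ) : State := { s with reg := Function.update s.reg x v }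

/-- Change an array entry. -/
def State.setArr (s : State) (a i v : ℕ) : State :=
  { s with arr := Function.update s.arr a (Function.update (s.arr a) i v) }

@[simp] theorem State.setReg_reg (s : State) (x v : ℕ) :
    (s.setReg x v).reg = Function.update s.reg x v := rfl

@[simp] theorem State.setReg_arr (s : State) (x v : ℕ) : (s.setReg x v).arr = s.arr := rfl

@[simp] theorem State.setArr_reg (s : State) (a i v : ℕ) : (s.setArr a i v).reg = s.reg := rfl

@[simp] theorem State.setArr_arr (s : State) (a i v : ℕ) :
    (s.setArr a i v).arr = Function.update s.arr a (Function.update (s.arr a) i v) := rfl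

/-- The value of a term. -/
def Tm.eval (n : ℕ) : Tm → State → ℕ
  | const a, _ => a
  | var x, s => s.reg x
  | size, _ => n
  | get a t, s => s.arr a (t.eval n s)
  | add t u, s => t.eval n s + u.eval n s
  | sub t u, s => t.eval n s - u.eval n s
  | ite c t u, s => if c.eval n s ≠ 0 then t.eval n s else u.eval n s
  | sum x t, s => ∑ i ∈ Finset.range n, t.eval n (s.setReg x i)

/-- Apply `f 0`, `f 1`, …, `f (m - 1)`. -/
def iter (f : ℕ → State → State) : ℕ → State → State
  | 0, s => s
  | m + 1, s => f m (iter f m s)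

/-- The effect of a statement. -/
def Stmt.exec (n : ℕ) : Stmt → State → State
  | set x t, s => s.setReg x (t.eval n s)
  | put a i t, s => s.setArr a (i.eval n s) (t.eval n s)
  | seq S S', s => S'.exec n (S.exec n s)
  | ite c S S', s => if c.eval n s ≠ 0 then S.exec n s else S'.exec n s
  | each x S, s => iter (fun i s => S.exec n (s.setReg x i)) n s

/-- The program that computes the value of a term in the register `2 ℓ + 2`. -/
def Tm.code : Tm → ℕ → Prog
  | const a, ℓ => .set (2 * ℓ + 2) (.const a)
  | var x, ℓ => .set (2 * ℓ + 2) (.reg (2 * x + 1))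
  | size, ℓ => .set (2 * ℓ + 2) (.reg 0)
  | get a t, ℓ => .seq (t.code ℓ) (.set (2 * ℓ + 2) (.get a (.reg (2 * ℓ + 2))))
  | add t u, ℓ => .seq (t.code ℓ) (.seq (u.code (ℓ + 1))
      (.set (2 * ℓ + 2) (.add (.reg (2 * ℓ + 2)) (.reg (2 * (ℓ + 1) + 2)))))
  | sub t u, ℓ => .seq (t.code ℓ) (.seq (u.code (ℓ + 1))
      (.set (2 * ℓ + 2) (.sub (.reg (2 * ℓ + 2)) (.reg (2 * (ℓ + 1) + 2)))))
  | ite c t u, ℓ => .seq (c.code ℓ) (.ite (.reg (2 * ℓ + 2)) (t.code ℓ) (u.code ℓ))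
  | sum x t, ℓ => .seq (.set (2 * ℓ + 2) (.const 0)) (.seq
      (.set (2 * (ℓ + 1) + 2) (.reg (2 * x + 1))) (.seq
      (.set (2 * (ℓ + 2) + 2) (.const 0)) (.seq
      (.loop (.sub (.reg 0) (.reg (2 * (ℓ + 2) + 2))) (.seq
        (.set (2 * x + 1) (.reg (2 * (ℓ + 2) + 2))) (.seq
        (t.code (ℓ + 3)) (.seq
        (.set (2 * ℓ + 2) (.add (.reg (2 * ℓ + 2)) (.reg (2 * (ℓ + 3) + 2))))
        (.set (2 * (ℓ + 2) + 2) (.add (.reg (2 * (ℓ + 2) + 2)) (.const 1)))))))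
      (.set (2 * x + 1) (.reg (2 * (ℓ + 1) + 2))))))

/-- The program for a statement; it uses the registers `2 j + 2` with `j ≥ ℓ`. -/
def Stmt.code : Stmt → ℕ → Prog
  | set x t, ℓ => .seq (t.code ℓ) (.set (2 * x + 1) (.reg (2 * ℓ + 2)))
  | put a i t, ℓ => .seq (i.code ℓ) (.seq (t.code (ℓ + 1))
      (.put a (.reg (2 * ℓ + 2)) (.reg (2 * (ℓ + 1) + 2))))
  | seq S S', ℓ => .seq (S.code ℓ) (S'.code ℓ)
  | ite c S S', ℓ => .seq (c.code ℓ) (.ite (.reg (2 * ℓ + 2)) (S.code ℓ) (S'.code ℓ))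
  | each x S, ℓ => .seq (.set (2 * ℓ + 2) (.const 0))
      (.loop (.sub (.reg 0) (.reg (2 * ℓ + 2))) (.seq
        (.set (2 * x + 1) (.reg (2 * ℓ + 2))) (.seq
        (S.code (ℓ + 1))
        (.set (2 * ℓ + 2) (.add (.reg (2 * ℓ + 2)) (.const 1))))))

open Polynomial in
/-- A bound for the running time of the program for a term. -/
noncomputable def Tm.time : Tm → ℕ[X]
  | const _ => C 2
  | var _ => C 2
  | size => C 2
  | get _ t => t.time + C 3
  | add t u => t.time + u.time + C 4
  | sub t u => t.time + u.time + C 4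
  | ite c t u => c.time + t.time + u.time + C 2
  | sum _ t => X * (t.time + C 14) + C 12

open Polynomial in
/-- A bound for the running time of the program for a statement. -/
noncomputable def Stmt.time : Stmt → ℕ[X]
  | set _ t => t.time + C 2
  | put _ i t => i.time + t.time + C 3
  | seq S S' => S.time + S'.time
  | ite c S S' => c.time + S.time + S'.time + C 2
  | each _ S => X * (S.time + C 10) + C 6

/-- The machine state `s` stores the values of the variables and the arrays that `u` describes. -/
structure Represents (n : ℕ) (u s : State) : Prop where
  reg_zero : s.reg 0 = n
  reg_var : ∀ x, s.reg (2 * x + 1) = u.reg x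
  arr : s.arr = u.arr

theorem Represents.setReg {n : ℕ} {u s : State} (h : Represents n u s) (ℓ v : ℕ) :
    Represents n u (s.setReg (2 * ℓ + 2) v) where
  reg_zero := by simp [h.reg_zero]
  reg_var x := by
    rw [State.setReg_reg, Function.update_of_ne (by omega), h.reg_var]
  arr := h.arr

theorem Represents.setVar {n : ℕ} {u s : State} (h : Represents n u s) (x v : ℕ) :
    Represents n (u.setReg x v) (s.setReg (2 * x + 1) v) where
  reg_zero := by simp [h.reg_zero]
  reg_var y := by
    have := h.reg_var y
    simp only [State.setReg_reg, Function.update_apply]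
    split_ifs <;> first | rfl | omega
  arr := h.arr

theorem runs_set (s : State) (x : ℕ) (e : Expr) :
    Runs (.set x e) s (e.cost + 1) (s.setReg x (e.eval s)) := .set s x e

/-- Loops that count up to `n`. -/
theorem runs_loop {n τ c : ℕ} {P : Prog} (Inv : ℕ → State → Prop)
    (h0 : ∀ i s, Inv i s → s.reg 0 = n ∧ s.reg c = i)
    (h1 : ∀ i s, i < n → Inv i s → ∃ t s', Runs P s t s' ∧ t ≤ τ ∧ Inv (i + 1) s')
    (s : State) (hs : Inv 0 s) :
    ∃ t s', Runs (.loop (.sub (.reg 0) (.reg c)) P) s t s' ∧ t ≤ n * (τ + 4) + 4 ∧ Inv n s' := by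
  suffices h : ∀ m i s, i + m = n → Inv i s → ∃ t s',
      Runs (.loop (.sub (.reg 0) (.reg c)) P) s t s' ∧ t ≤ m * (τ + 4) + 4 ∧ Inv n s' from
    h n 0 s (Nat.zero_add n) hs
  intro m
  induction m with
  | zero =>
    intro i s hi hs
    obtain ⟨a, b⟩ := h0 i s hs
    refine ⟨_, s, .loop_false ?_, ?_, ?_⟩
    · simp only [Expr.eval, a, b]; omega
    · simp [Expr.cost]
    · rw [← hi]; exact hs
  | succ m ih =>
    intro i s hi hs
    obtain ⟨a, b⟩ := h0 i s hs
    obtain ⟨t, s', hr, ht, hs'⟩ := h1 i s (by omega) hs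
    obtain ⟨t', s'', hr', ht', hs''⟩ := ih (i + 1) s' (by omega) hs'
    refine ⟨_, s'', .loop_true ?_ hr hr', ?_, hs''⟩
    · simp only [Expr.eval, a, b]; omega
    · simp only [Expr.cost]
      rw [Nat.succ_mul]
      omega

/-- The registers 2j + 2 form a stack of intermediate results: code at level `ℓ` preserves those
with j < ℓ. A sum restores its variable at the end, so evaluation leaves the represented state
unchanged. -/
theorem Tm.runs_code (n : ℕ) (t : Tm) : ∀ (ℓ : ℕ) (u s : State), Represents n u s →
    ∃ τ s', Runs (t.code ℓ) s τ s' ∧ τ ≤ t.time.eval n ∧ Represents n u s' ∧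
      s'.reg (2 * ℓ + 2) = t.eval n u ∧ ∀ j < ℓ, s'.reg (2 * j + 2) = s.reg (2 * j + 2) := by
  have hpres : ∀ (s : State) (ℓ v : ℕ), ∀ j < ℓ,
      (s.setReg (2 * ℓ + 2) v).reg (2 * j + 2) = s.reg (2 * j + 2) := by
    intro s ℓ v j hj
    rw [State.setReg_reg, Function.update_of_ne (by omega)]
  induction t with
  | const a =>
    intro ℓ u s h
    exact ⟨_, _, runs_set _ _ _, by simp [Tm.time, Expr.cost], h.setReg _ _,
      by simp [Tm.eval, Expr.eval], hpres _ _ _⟩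
  | var x =>
    intro ℓ u s h
    exact ⟨_, _, runs_set _ _ _, by simp [Tm.time, Expr.cost], h.setReg _ _,
      by simp [Tm.eval, Expr.eval, h.reg_var], hpres _ _ _⟩
  | size =>
    intro ℓ u s h
    exact ⟨_, _, runs_set _ _ _, by simp [Tm.time, Expr.cost], h.setReg _ _,
      by simp [Tm.eval, Expr.eval, h.reg_zero], hpres _ _ _⟩
  | get a t ih =>
    intro ℓ u s h
    obtain ⟨τ, s', hr, hτ, h', hv, hp⟩ := ih ℓ u s h
    refine ⟨_, _, .seq hr (runs_set _ _ _), by simp [Tm.time, Expr.cost]; omega, h'.setReg _ _,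
      by simp [Tm.eval, Expr.eval, hv, h'.arr], fun j hj => ?_⟩
    rw [hpres _ _ _ _ hj, hp j hj]
  | add t t' ih ih' =>
    intro ℓ u s h
    obtain ⟨τ, s', hr, hτ, h', hv, hp⟩ := ih ℓ u s h
    obtain ⟨τ', s'', hr', hτ', h'', hv', hp'⟩ := ih' (ℓ + 1) u s' h'
    refine ⟨_, _, .seq hr (.seq hr' (runs_set _ _ _)), by simp [Tm.time, Expr.cost]; omega,
      h''.setReg _ _, ?_, fun j hj => ?_⟩
    · simp [Tm.eval, Expr.eval, hv', hp' ℓ (by omega), hv]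
    · rw [hpres _ _ _ _ hj, hp' j (by omega), hp j hj]
  | sub t t' ih ih' =>
    intro ℓ u s h
    obtain ⟨τ, s', hr, hτ, h', hv, hp⟩ := ih ℓ u s h
    obtain ⟨τ', s'', hr', hτ', h'', hv', hp'⟩ := ih' (ℓ + 1) u s' h'
    refine ⟨_, _, .seq hr (.seq hr' (runs_set _ _ _)), by simp [Tm.time, Expr.cost]; omega,
      h''.setReg _ _, ?_, fun j hj => ?_⟩
    · simp [Tm.eval, Expr.eval, hv', hp' ℓ (by omega), hv]
    · rw [hpres _ _ _ _ hj, hp' j (by omega), hp j hj]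
  | ite c t t' ihc ih ih' =>
    intro ℓ u s h
    obtain ⟨τ, s', hr, hτ, h', hv, hp⟩ := ihc ℓ u s h
    by_cases hc : c.eval n u ≠ 0
    · obtain ⟨τ', s'', hr', hτ', h'', hv', hp'⟩ := ih ℓ u s' h'
      refine ⟨_, _, .seq hr (.ite_true (by simpa [Expr.eval, hv] using hc) hr'),
        by simp [Tm.time, Expr.cost]; omega, h'', ?_, fun j hj => ?_⟩
      · simp [Tm.eval, hc, hv']
      · rw [hp' j hj, hp j hj]
    · obtain ⟨τ', s'', hr', hτ', h'', hv', hp'⟩ := ih' ℓ u s' h'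
      refine ⟨_, _, .seq hr (.ite_false (by simpa [Expr.eval, hv] using hc) hr'),
        by simp [Tm.time, Expr.cost]; omega, h'', ?_, fun j hj => ?_⟩
      · simp only [Tm.eval, if_neg hc, hv']
      · rw [hp' j hj, hp j hj]
  | sum x t ih =>
    intro ℓ u s h
    -- The levels `ℓ`, `ℓ + 1` and `ℓ + 2` hold the partial sum, the saved value of `x` and the
    -- counter.
    set s₃ := ((s.setReg (2 * ℓ + 2) 0).setReg (2 * (ℓ + 1) + 2) (u.reg x)).setReg
      (2 * (ℓ + 2) + 2) 0 with hs₃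
    obtain ⟨τ, s₄, hr, hτ, hinv⟩ := runs_loop (n := n) (τ := t.time.eval n + 10)
      (c := 2 * (ℓ + 2) + 2)
      (P := .seq (.set (2 * x + 1) (.reg (2 * (ℓ + 2) + 2))) (.seq (t.code (ℓ + 3)) (.seq
        (.set (2 * ℓ + 2) (.add (.reg (2 * ℓ + 2)) (.reg (2 * (ℓ + 3) + 2))))
        (.set (2 * (ℓ + 2) + 2) (.add (.reg (2 * (ℓ + 2) + 2)) (.const 1))))))
      (fun i s' => (∃ v, Represents n (u.setReg x v) s') ∧ s'.reg (2 * (ℓ + 2) + 2) = i ∧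
        s'.reg (2 * ℓ + 2) = ∑ i ∈ Finset.range i, t.eval n (u.setReg x i) ∧
        s'.reg (2 * (ℓ + 1) + 2) = u.reg x ∧
        ∀ j < ℓ, s'.reg (2 * j + 2) = s.reg (2 * j + 2))
      (fun i s' hi => ⟨hi.1.choose_spec.reg_zero, hi.2.1⟩)
      (by
        rintro i s' hi ⟨⟨v, hv⟩, hc, hacc, hsave, hp⟩
        have hset : ∀ w, (u.setReg x v).setReg x w = u.setReg x w := by
          intro w
          simp [State.setReg]
        have h1 := hv.setVar x i
        rw [hset] at h1
        obtain ⟨τ, s'', hr, hτ, h', hv', hp'⟩ := ih (ℓ + 3) _ _ h1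
        refine ⟨_, _, .seq (runs_set _ _ _) (.seq (t := τ) (s' := s'') ?_ (.seq (runs_set _ _ _) (runs_set _ _ _))),
          ?_, ⟨i, (h'.setReg _ _).setReg _ _⟩, ?_, ?_, ?_, fun j hj => ?_⟩
        · simpa [Expr.eval, hc] using hr
        · simp [Expr.cost]
          omega
        · have := hp' (ℓ + 2) (by omega)
          simp [Expr.eval, Function.update_apply] at this ⊢
          rw [this, hc, if_neg (by omega)]
        · have := hp' ℓ (by omega)
          simp [Expr.eval, Function.update_apply] at this ⊢
          rw [this, hv', if_neg (by omega), hacc, Finset.sum_range_succ]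
        · have := hp' (ℓ + 1) (by omega)
          simp [Expr.eval, Function.update_apply] at this ⊢
          rw [this, if_neg (by omega), hsave]
        · rw [hpres _ _ _ _ (by omega), hpres _ _ _ _ hj, hp' j (by omega)]
          simp [Function.update_apply]
          rw [if_neg (by omega), hp j hj])
      s₃ (by
        refine ⟨⟨u.reg x, ?_⟩, ?_, ?_, ?_, fun j hj => ?_⟩
        · have : u.setReg x (u.reg x) = u := by simp [State.setReg]
          rw [this]
          exact ((h.setReg _ _).setReg _ _).setReg _ _
        · simp [hs₃]
        · simp [hs₃]
        · simp [hs₃]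
        · rw [hs₃, hpres _ _ _ _ (by omega), hpres _ _ _ _ (by omega), hpres _ _ _ _ hj])
    obtain ⟨⟨v, hv⟩, hc, hacc, hsave, hp⟩ := hinv
    have hlast := hv.setVar x (u.reg x)
    have hset : (u.setReg x v).setReg x (u.reg x) = u := by
      simp [State.setReg]
    rw [hset] at hlast
    refine ⟨_, s₄.setReg (2 * x + 1) (u.reg x), .seq (runs_set _ _ _) (.seq (runs_set _ _ _)
      (.seq (runs_set _ _ _) (.seq (t := τ) (t' := 2) (s' := s₄) ?_ ?_))), ?_, hlast, ?_, fun j hj => ?_⟩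
    · convert hr using 1
      have : ¬2 * x = 2 * ℓ + 1 := by omega
      simp [hs₃, Expr.eval, h.reg_var, this]
    · rw [← hsave]
      exact runs_set _ _ _
    · simp [Tm.time, Expr.cost]
      nlinarith
    · rw [State.setReg_reg, Function.update_of_ne (by omega), hacc]
      rfl
    · rw [State.setReg_reg, Function.update_of_ne (by omega), hp j hj]

theorem Stmt.runs_code (n : ℕ) (S : Stmt) : ∀ (ℓ : ℕ) (u s : State), Represents n u s →
    ∃ τ s', Runs (S.code ℓ) s τ s' ∧ τ ≤ S.time.eval n ∧ Represents n (S.exec n u) s' ∧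
      ∀ j < ℓ, s'.reg (2 * j + 2) = s.reg (2 * j + 2) := by
  induction S with
  | set x t =>
    intro ℓ u s h
    obtain ⟨τ, s', hr, hτ, h', hv, hp⟩ := t.runs_code n ℓ u s h
    refine ⟨_, _, .seq hr (runs_set _ _ _), by simp [Stmt.time, Expr.cost]; omega, ?_,
      fun j hj => ?_⟩
    · have := h'.setVar x (t.eval n u)
      simpa [Expr.eval, hv, Stmt.exec] using this
    · rw [State.setReg_reg, Function.update_of_ne (by omega), hp j hj]
  | put a i t =>
    intro ℓ u s h
    obtain ⟨τ, s', hr, hτ, h', hv, hp⟩ := i.runs_code n ℓ u s h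
    obtain ⟨τ', s'', hr', hτ', h'', hv', hp'⟩ := t.runs_code n (ℓ + 1) u s' h'
    refine ⟨_, _, .seq hr (.seq hr' (.put _ _ _ _)), by simp [Stmt.time, Expr.cost]; omega,
      ⟨h''.reg_zero, h''.reg_var, ?_⟩, fun j hj => ?_⟩
    · simp [Stmt.exec, Expr.eval, hv', hp' ℓ (by omega), hv, h''.arr]
    · exact (hp' j (by omega)).trans (hp j hj)
  | seq S S' ih ih' =>
    intro ℓ u s h
    obtain ⟨τ, s', hr, hτ, h', hp⟩ := ih ℓ u s h
    obtain ⟨τ', s'', hr', hτ', h'', hp'⟩ := ih' ℓ _ s' h'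
    exact ⟨_, _, .seq hr hr', by simp [Stmt.time]; omega, h'',
      fun j hj => (hp' j hj).trans (hp j hj)⟩
  | ite c S S' ih ih' =>
    intro ℓ u s h
    obtain ⟨τ, s', hr, hτ, h', hv, hp⟩ := c.runs_code n ℓ u s h
    by_cases hc : c.eval n u ≠ 0
    · obtain ⟨τ', s'', hr', hτ', h'', hp'⟩ := ih ℓ u s' h'
      refine ⟨_, _, .seq hr (.ite_true (by simpa [Expr.eval, hv] using hc) hr'),
        by simp [Stmt.time, Expr.cost]; omega, ?_, fun j hj => (hp' j hj).trans (hp j hj)⟩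
      rw [Stmt.exec, if_pos hc]
      exact h''
    · obtain ⟨τ', s'', hr', hτ', h'', hp'⟩ := ih' ℓ u s' h'
      refine ⟨_, _, .seq hr (.ite_false (by simpa [Expr.eval, hv] using hc) hr'),
        by simp [Stmt.time, Expr.cost]; omega, ?_, fun j hj => (hp' j hj).trans (hp j hj)⟩
      rw [Stmt.exec, if_neg hc]
      exact h''
  | each x S ih =>
    intro ℓ u s h
    obtain ⟨τ, s₄, hr, hτ, hinv⟩ := runs_loop (n := n) (τ := S.time.eval n + 6) (c := 2 * ℓ + 2)
      (P := .seq (.set (2 * x + 1) (.reg (2 * ℓ + 2))) (.seq (S.code (ℓ + 1))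
        (.set (2 * ℓ + 2) (.add (.reg (2 * ℓ + 2)) (.const 1)))))
      (fun i s' => Represents n (iter (fun i s => S.exec n (s.setReg x i)) i u) s' ∧
        s'.reg (2 * ℓ + 2) = i ∧ ∀ j < ℓ, s'.reg (2 * j + 2) = s.reg (2 * j + 2))
      (fun i s' hi => ⟨hi.1.reg_zero, hi.2.1⟩)
      (by
        rintro i s' hi ⟨hv, hc, hp⟩
        obtain ⟨τ, s'', hr, hτ, h', hp'⟩ := ih (ℓ + 1) _ _ (hv.setVar x i)
        refine ⟨_, _, .seq (runs_set _ _ _) (.seq (t := τ) (s' := s'') ?_ (runs_set _ _ _)),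
          ?_, h'.setReg _ _, ?_, fun j hj => ?_⟩
        · simpa [Expr.eval, hc] using hr
        · simp [Expr.cost]
          omega
        · have := hp' ℓ (by omega)
          simp [Expr.eval, Function.update_apply] at this ⊢
          rw [this, hc, if_neg (by omega)]
        · rw [State.setReg_reg, Function.update_of_ne (by omega), hp' j (by omega),
            State.setReg_reg, Function.update_of_ne (by omega), hp j hj])
      (s.setReg (2 * ℓ + 2) 0) (by
        refine ⟨h.setReg _ _, by simp, fun j hj => ?_⟩
        rw [State.setReg_reg, Function.update_of_ne (by omega)])
    refine ⟨_, s₄, .seq (runs_set _ _ _) hr, ?_, hinv.1, hinv.2.2⟩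
    simp [Stmt.time, Expr.cost]
    nlinarith

theorem eval_le_eval_of_le (q : Polynomial ℕ) {a b : ℕ} (h : a ≤ b) : q.eval a ≤ q.eval b := by
  rw [Polynomial.eval_eq_sum, Polynomial.eval_eq_sum]
  exact Finset.sum_le_sum fun i _ => Nat.mul_le_mul_left _ (Nat.pow_le_pow_left h i)

/-- Every statement is implemented by a program that runs in polynomial time. -/
theorem Stmt.exists_prog (S : Stmt) : ∃ (P : Prog) (q : Polynomial ℕ), ∀ w : List ℕ,
    w.getD 0 0 ≤ inputLength w → ∃ t s, Runs P (State.init w) t s ∧ t ≤ q.eval (inputLength w) ∧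
      s.arr = (S.exec (w.getD 0 0) ⟨fun _ => 0, (State.init w).arr⟩).arr := by
  -- The first instruction loads the first input number, the bound of all loops, into register 0;
  -- `hw` turns a polynomial in this number into one in the input length.
  refine ⟨.seq (.set 0 (.get 0 (.const 0))) (S.code 0), S.time + Polynomial.C 3, fun w hw => ?_⟩
  obtain ⟨τ, s', hr, hτ, h', -⟩ := S.runs_code (w.getD 0 0) 0 ⟨fun _ => 0, (State.init w).arr⟩
    ((State.init w).setReg 0 (w.getD 0 0)) ⟨by simp, fun x => by simp [State.init], rfl⟩
  refine ⟨_, s', .seq (runs_set _ _ _) (t' := τ) ?_, ?_, h'.arr⟩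
  · simpa [Expr.eval, State.init] using hr
  · have := eval_le_eval_of_le S.time hw
    simp only [Expr.cost, Polynomial.eval_add, Polynomial.eval_C]
    omega

end RAM

/-! ### The greedy construction of a `k`-section. -/

/-- The size of the `j`-th set of the `k`-sections that we construct. -/
def partSize (n k j : ℕ) : ℕ := n / k + if j < n % k then 1 else 0

theorem sum_partSize {n k : ℕ} (hk : 0 < k) : ∑ j ∈ Finset.range k, partSize n k j = n := by
  unfold partSize
  have h : (Finset.range k).filter (fun j => j < n % k) = Finset.range (n % k) := by
    ext j
    have := Nat.mod_lt n hk
    simp only [Finset.mem_filter, Finset.mem_range]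
    omega
  rw [Finset.sum_add_distrib, ← Finset.card_filter, h]
  simp only [Finset.sum_const, Finset.card_range, smul_eq_mul]
  exact Nat.div_add_mod n k

theorem partSize_pos {n k : ℕ} (hk : 0 < k) (hkn : k ≤ n) (j : ℕ) : 0 < partSize n k j :=
  Nat.add_pos_left (Nat.div_pos hkn hk) _

namespace ParentTree

variable {V : Type*} [Fintype V] [DecidableEq V]

/-- The situation after `i` rounds of the construction of a `k`-section: `σ` is the index of the
set that contains a vertex, and it is `k - 1` if the vertex has not been dealt with. -/
structure IsPartial (R : ParentTree V) (k C : ℕ) (b : V) (i : ℕ) (σ : V → ℕ) : Prop where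
  value : ∀ v, σ v < i ∨ σ v = k - 1
  card : ∀ j < i, (Finset.univ.filter fun v => σ v = j).card = partSize (Fintype.card V) k j
  density : (R.trunk b).card * (Finset.univ.filter fun v => σ v = k - 1).card ≤
    Fintype.card V * (R.trunk b ∩ Finset.univ.filter fun v => σ v = k - 1).card
  cut : ∀ j < i, ∃ B : Finset V, (R.bd B).card ≤ C ∧
    ∀ v, (σ v = j → v ∈ B) ∧ (j < σ v → v ∉ B)

variable {R : ParentTree V} {k C : ℕ} {b : V} {i : ℕ} {σ : V → ℕ}

theorem isPartial_zero (R : ParentTree V) (k C : ℕ) (b : V) :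
    R.IsPartial k C b 0 fun _ => k - 1 where
  value _ := .inr rfl
  card j hj := absurd hj (Nat.not_lt_zero j)
  density := by
    rw [Finset.filter_true_of_mem (fun _ _ => rfl), Finset.inter_univ, Finset.card_univ, mul_comm]
  cut j hj := absurd hj (Nat.not_lt_zero j)

theorem IsPartial.card_rest (h : R.IsPartial k C b i σ) (hi : i ≤ k - 1) (hk : 0 < k) :
    (Finset.univ.filter fun v => σ v = k - 1).card =
      ∑ j ∈ Finset.Ico i k, partSize (Fintype.card V) k j := by
  have h1 : Fintype.card V = ∑ j ∈ insert (k - 1) (Finset.range i),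
      (Finset.univ.filter fun v => σ v = j).card := by
    rw [← Finset.card_univ]
    refine Finset.card_eq_sum_card_fiberwise fun v _ => ?_
    have := h.value v
    simp only [Finset.coe_insert, Set.mem_insert_iff, Finset.mem_coe, Finset.mem_range]
    tauto
  have h3 : ∑ j ∈ Finset.range i, (Finset.univ.filter fun v => σ v = j).card =
      ∑ j ∈ Finset.range i, partSize (Fintype.card V) k j :=
    Finset.sum_congr rfl fun j hj => h.card j (Finset.mem_range.1 hj)
  rw [Finset.sum_insert (by simpa using hi), h3] at h1
  have h2 := sum_partSize (n := Fintype.card V) hk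
  rw [← Finset.sum_range_add_sum_Ico _ (show i ≤ k by omega)] at h2
  exact Nat.add_left_cancel ((Nat.add_comm _ _).trans (h1.symm.trans h2.symm))

/-- At least two sets are still to come, and none is empty because k ≤ n. The strict inequality is
what `IsSpine.exists_part` requires. -/
theorem IsPartial.partSize_lt (h : R.IsPartial k C b i σ) (hi : i < k - 1)
    (hkn : k ≤ Fintype.card V) : partSize (Fintype.card V) k i <
      (Finset.univ.filter fun v => σ v = k - 1).card := by
  rw [h.card_rest hi.le (by omega)]
  have h1 := Finset.add_sum_erase (Finset.Ico i k) (partSize (Fintype.card V) k)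
    (Finset.mem_Ico.2 ⟨le_rfl, show i < k by omega⟩)
  have h2 : partSize (Fintype.card V) k (k - 1) ≤
      ∑ j ∈ (Finset.Ico i k).erase i, partSize (Fintype.card V) k j := by
    refine Finset.single_le_sum (f := partSize (Fintype.card V) k) (fun _ _ => Nat.zero_le _) ?_
    rw [Finset.mem_erase, Finset.mem_Ico]
    omega
  have h3 := partSize_pos (show 0 < k by omega) hkn (k - 1)
  omega

/-- In each round there is a suitable set. -/
theorem IsPartial.exists_parity {Δ : ℕ} {d : ℝ} (h : R.IsPartial k C b i σ) (hi : i < k - 1)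
    (hkn : k ≤ Fintype.card V) (hd : 0 < d) (hΔ : 2 ≤ Δ) (hR : ∀ v, (R.children v).card ≤ Δ)
    (hb : d * Fintype.card V ≤ (R.trunk b).card) (hC : C = ⌊(2 + 16 / d) * Δ⌋₊) :
    ∃ e < 2, ∃ f : ℕ → V,
      (Finset.univ.filter fun v => R.parity C e f v = 1 ∧ σ v = k - 1).card =
        partSize (Fintype.card V) k i ∧
      (R.trunk b ∩ Finset.univ.filter fun v => R.parity C e f v = 1 ∧ σ v = k - 1).card *
        (Finset.univ.filter fun v => σ v = k - 1).card ≤ partSize (Fintype.card V) k i *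
          (R.trunk b ∩ Finset.univ.filter fun v => σ v = k - 1).card := by
  set U := Finset.univ.filter fun v => σ v = k - 1 with hU
  have hm : _ < U.card := h.partSize_lt hi hkn
  have hV : 0 < Fintype.card V := by omega
  have hU0 : 0 < U.card := by omega
  have ht0 : 0 < (R.trunk b).card := by rw [card_trunk]; omega
  have hdens : (R.trunk b).card * U.card ≤ Fintype.card V * (R.trunk b ∩ U).card := h.density
  have hp0 : 0 < (R.trunk b ∩ U).card := by
    by_contra hcon
    have h0 : (R.trunk b ∩ U).card = 0 := by omega
    rw [h0, mul_zero] at hdens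
    have := Nat.mul_pos ht0 hU0
    omega
  obtain ⟨κ, hκ⟩ := R.exists_isSpine hR b
  obtain ⟨B, hB, hBd, hbd⟩ := hκ.exists_part hΔ U _ hm (Finset.card_pos.1 hp0)
  have hV' : (0 : ℝ) < Fintype.card V := by exact_mod_cast hV
  have hp0' : (0 : ℝ) < (R.trunk b ∩ U).card := by exact_mod_cast hp0
  have hdens' : ((R.trunk b).card : ℝ) * U.card ≤
      Fintype.card V * (R.trunk b ∩ U).card := by exact_mod_cast hdens
  have hbd' : ((R.bd B).card : ℝ) * (R.trunk b ∩ U).card ≤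
      (Δ + 1) * (R.trunk b ∩ U).card + 16 * Δ * U.card := by exact_mod_cast hbd
  -- The density invariant and |P| ≥ dn bound |U| / |P ∩ U| by 1 / d.
  have hUp : d * U.card ≤ (R.trunk b ∩ U).card := by
    refine le_of_mul_le_mul_left ?_ hV'
    calc (Fintype.card V : ℝ) * (d * U.card) = d * Fintype.card V * U.card := by ring
      _ ≤ (R.trunk b).card * U.card := by gcongr
      _ ≤ _ := hdens'
  have hUp' : (U.card : ℝ) ≤ (R.trunk b ∩ U).card / d := by
    rw [le_div_iff₀ hd]
    linarith
  have hΔ' : (2 : ℝ) ≤ Δ := by exact_mod_cast hΔ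
  -- Dividing `hbd'` by |P ∩ U| gives Δ + 1 + 16Δ / d, and Δ + 1 ≤ 2Δ.
  have hBC : (R.bd B).card ≤ C := by
    rw [hC]
    apply Nat.le_floor
    refine le_of_mul_le_mul_right ?_ hp0'
    calc ((R.bd B).card : ℝ) * (R.trunk b ∩ U).card ≤
          (Δ + 1) * (R.trunk b ∩ U).card + 16 * Δ * U.card := hbd'
      _ ≤ (Δ + 1) * (R.trunk b ∩ U).card + 16 * Δ * ((R.trunk b ∩ U).card / d) := by gcongr
      _ = ((Δ + 1) + 16 / d * Δ) * (R.trunk b ∩ U).card := by ring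
      _ ≤ (2 + 16 / d) * Δ * (R.trunk b ∩ U).card := by
        gcongr
        linarith
  obtain ⟨e, he, f, hf⟩ := R.exists_parity_eq C B hBC
  have hBU : (Finset.univ.filter fun v => R.parity C e f v = 1 ∧ σ v = k - 1) = B ∩ U := by
    ext v
    simp [hU, hf]
  exact ⟨e, he, f, by rw [hBU, hB], by rw [hBU]; exact hBd⟩

/-- One round. -/
theorem IsPartial.succ (h : R.IsPartial k C b i σ) (hi : i < k - 1)
    (hkn : k ≤ Fintype.card V) {e : ℕ} {f : ℕ → V}
    (hcard : (Finset.univ.filter fun v => R.parity C e f v = 1 ∧ σ v = k - 1).card =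
      partSize (Fintype.card V) k i)
    (hdens : (R.trunk b ∩ Finset.univ.filter fun v => R.parity C e f v = 1 ∧ σ v = k - 1).card *
        (Finset.univ.filter fun v => σ v = k - 1).card ≤ partSize (Fintype.card V) k i *
          (R.trunk b ∩ Finset.univ.filter fun v => σ v = k - 1).card) {σ' : V → ℕ}
    (hσ' : ∀ v, σ' v = if R.parity C e f v = 1 ∧ σ v = k - 1 then i else σ v) :
    R.IsPartial k C b (i + 1) σ' := by
  set U := Finset.univ.filter fun v => σ v = k - 1 with hU
  set B := Finset.univ.filter fun v => R.parity C e f v = 1 ∧ σ v = k - 1 with hB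
  have hU' : (Finset.univ.filter fun v => σ' v = k - 1) = U \ B := by
    ext v
    have := h.value v
    simp only [hU, hB, hσ', Finset.mem_filter, Finset.mem_univ, true_and, Finset.mem_sdiff]
    split_ifs with hv
    · constructor
      · omega
      · tauto
    · tauto
  have hBU : B ⊆ U := by
    intro v
    simp only [hU, hB, Finset.mem_filter, Finset.mem_univ, true_and]
    exact And.right
  have hm : _ < U.card := h.partSize_lt hi hkn
  refine ⟨fun v => ?_, fun j hj => ?_, ?_, fun j hj => ?_⟩
  · have := h.value v
    rw [hσ']
    split_ifs <;> omega
  · rcases Nat.lt_succ_iff_lt_or_eq.1 hj with hj | rfl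
    · rw [← h.card j hj]
      congr 1
      ext v
      simp only [hσ', Finset.mem_filter, Finset.mem_univ, true_and]
      split_ifs with hv <;> omega
    · rw [← hcard]
      congr 1
      ext v
      have := h.value v
      simp only [hσ', hB, Finset.mem_filter, Finset.mem_univ, true_and]
      split_ifs with hv
      · simpa using hv
      · constructor
        · omega
        · tauto
  · rw [hU']
    have h1 : (U \ B).card + B.card = U.card := Finset.card_sdiff_add_card_eq_card hBU
    have h2 : (R.trunk b ∩ (U \ B)).card + (R.trunk b ∩ B).card = (R.trunk b ∩ U).card := by
      rw [← Finset.inter_sdiff_assoc, ← Finset.card_sdiff_add_card_inter (R.trunk b ∩ U) B,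
        Finset.inter_assoc, Finset.inter_eq_right.2 hBU]
    have h3 : (R.trunk b).card * U.card ≤ Fintype.card V * (R.trunk b ∩ U).card := h.density
    rw [hcard] at h1
    have hU0 : 0 < U.card := by omega
    -- Below, x = |U \ B|, m = |B|, and y and z are the numbers of trunk vertices in these sets. By
    -- `hdens` the removed set has at most its share of the trunk, which after cancellation reads zx
    -- ≤ my.
    refine Nat.le_of_mul_le_mul_right (c := U.card) ?_ hU0
    generalize (U \ B).card = x at *
    generalize (R.trunk b ∩ (U \ B)).card = y at *
    generalize (R.trunk b ∩ B).card = z at *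
    generalize partSize (Fintype.card V) k i = m at *
    rw [← h2] at h3 hdens
    rw [← h1] at h3 hdens ⊢
    generalize (R.trunk b).card = t at *
    generalize Fintype.card V = n at *
    have h4 : z * x ≤ m * y := by nlinarith
    calc t * x * (x + m) = t * (x + m) * x := by ring
      _ ≤ n * (y + z) * x := Nat.mul_le_mul_right _ h3
      _ = n * (y * x + z * x) := by ring
      _ ≤ n * (y * x + m * y) := by gcongr
      _ = n * y * (x + m) := by ring
  · rcases Nat.lt_succ_iff_lt_or_eq.1 hj with hj | rfl
    · obtain ⟨B', hB', hv⟩ := h.cut j hj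
      refine ⟨B', hB', fun v => ?_⟩
      have h1 := hv v
      have h2 := h.value v
      rw [hσ']
      split_ifs with hc
      -- A vertex that is moved now had the value k - 1 > j before, so it was already outside the
      -- earlier set `B'`.
      · refine ⟨by omega, fun _ => h1.2 (by omega)⟩
      · exact h1
    · refine ⟨_, R.card_bd_parity_le C e f, fun v => ?_⟩
      have h2 := h.value v
      rw [hσ', Finset.mem_filter]
      split_ifs with hc
      · exact ⟨fun _ => ⟨Finset.mem_univ _, hc.1⟩, fun hlt => absurd hlt (lt_irrefl _)⟩
      · refine ⟨by omega, fun hlt hp => hc ⟨hp.2, ?_⟩⟩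
        omega

end ParentTree

/-! ### Widths: the upper bound, the lower bound, and the case n ≤ k. -/

theorem isKSection_of_isPartial {V : Type*} [Fintype V] [DecidableEq V] {R : ParentTree V}
    {k C : ℕ} {b : V} {σ : V → ℕ} (h : R.IsPartial k C b (k - 1) σ) (hk : 2 ≤ k)
    (τ : V → Fin k) (hτ : ∀ v, σ v = τ v) : IsKSection τ := by
  intro l
  have hset : {v : V | τ v = l}.ncard = (Finset.univ.filter fun v => σ v = l).card := by
    rw [Set.ncard_eq_toFinset_card']
    congr 1
    ext v
    simp [hτ, Fin.ext_iff]
  have hcard : (Finset.univ.filter fun v => σ v = l).card = partSize (Fintype.card V) k l := by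
    by_cases hl : (l : ℕ) < k - 1
    · exact h.card l hl
    · have hl' : (l : ℕ) = k - 1 := by omega
      rw [hl', h.card_rest le_rfl (by omega)]
      have : Finset.Ico (k - 1) k = {k - 1} := by
        ext j
        simp only [Finset.mem_Ico, Finset.mem_singleton]
        omega
      rw [this, Finset.sum_singleton]
  rw [hset, hcard, Nat.ceilDiv_eq_add_pred_div, partSize]
  refine ⟨Nat.le_add_right _ _, ?_⟩
  rw [Nat.le_div_iff_mul_le (by omega)]
  have h1 := Nat.div_add_mod (Fintype.card V) k
  have h2 : (Fintype.card V / k + if (l : ℕ) < Fintype.card V % k then 1 else 0) * k =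
      k * (Fintype.card V / k) + (if (l : ℕ) < Fintype.card V % k then 1 else 0) * k := by ring
  rw [h2]
  split_ifs <;> omega

/-- Charge a cut edge to the smaller index j of its two ends: it is in the boundary of the set used
in round j. The index k - 1 is never the smaller one, so k - 1 rounds pay for everything. -/
theorem cutWidth_le_of_isPartial {V : Type*} [Fintype V] [DecidableEq V] {T : SimpleGraph V}
    (hT : T.IsTree) {a b : V} {k C : ℕ} {σ : V → ℕ}
    (h : (hT.parentTree a).IsPartial k C b (k - 1) σ)
    (τ : V → Fin k) (hτ : ∀ v, σ v = τ v) : cutWidth T τ ≤ (k - 1) * C := by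
  classical
  choose! B hB hBσ using h.cut
  have hsub : {e ∈ T.edgeSet | ∃ v w : V, e = s(v, w) ∧ τ v ≠ τ w} ⊆
      (((Finset.range (k - 1)).biUnion fun j => (hT.parentTree a).bd (B j)).image
        fun v => s(v, (hT.parentTree a).par v) : Finset (Sym2 V)) := by
    have key : ∀ v w, T.Adj v w → σ v < σ w → s(v, w) ∈
        (((Finset.range (k - 1)).biUnion fun j => (hT.parentTree a).bd (B j)).image
          fun v => s(v, (hT.parentTree a).par v) : Finset (Sym2 V)) := by
      intro v w hadj hlt
      have hw : σ w ≤ k - 1 := by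
        have := h.value w
        omega
      have hj : σ v < k - 1 := by omega
      have h1 := (hBσ (σ v) hj v).1 rfl
      have h2 := (hBσ (σ v) hj w).2 hlt
      rw [Finset.mem_image]
      rcases hT.parentTree_par_of_adj a hadj with hp | hp
      · refine ⟨v, Finset.mem_biUnion.2 ⟨σ v, Finset.mem_range.2 hj, ?_⟩, by rw [hp]⟩
        rw [ParentTree.mem_bd, hp]
        tauto
      · refine ⟨w, Finset.mem_biUnion.2 ⟨σ v, Finset.mem_range.2 hj, ?_⟩,
          by rw [hp, Sym2.eq_swap]⟩
        rw [ParentTree.mem_bd, hp]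
        tauto
    rintro e ⟨he, v, w, rfl, hvw⟩
    rw [SimpleGraph.mem_edgeSet] at he
    have hne : σ v ≠ σ w := by
      rw [hτ, hτ]
      exact fun h => hvw (Fin.ext h)
    rcases lt_or_gt_of_ne hne with hlt | hlt
    · exact key v w he hlt
    · rw [Sym2.eq_swap]
      exact key w v he.symm hlt
  refine (Set.ncard_le_ncard hsub (Finset.finite_toSet _)).trans ?_
  rw [Set.ncard_coe_finset]
  refine Finset.card_image_le.trans ?_
  refine (Finset.card_biUnion_le_card_mul _ _ C fun j hj => hB j (Finset.mem_range.1 hj)).trans ?_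
  rw [Finset.card_range]

/-- In a connected graph, every partition into `k` non-empty sets has width at least `k - 1`. -/
theorem pred_le_cutWidth {V : Type*} [Finite V] {G : SimpleGraph V} (hG : G.Connected) {k : ℕ}
    (σ : V → Fin k) (hσ : Function.Surjective σ) : k - 1 ≤ cutWidth G σ := by
  classical
  -- The quotient of `G` by the partition is connected on `k` vertices, so it has at least k - 1
  -- edges; each is the image of a cut edge.
  set H : SimpleGraph (Fin k) := SimpleGraph.fromRel fun i j => ∃ v w, G.Adj v w ∧ σ v = i ∧ σ w = j
    with hH
  have hreach : ∀ {v w : V}, G.Walk v w → H.Reachable (σ v) (σ w) := by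
    intro v w p
    induction p with
    | nil => exact SimpleGraph.Reachable.refl _
    | cons hadj _ ih =>
      rename_i u v w _
      by_cases huv : σ u = σ v
      · rw [huv]
        exact ih
      · refine SimpleGraph.Reachable.trans (SimpleGraph.Adj.reachable ?_) ih
        rw [hH, SimpleGraph.fromRel_adj]
        exact ⟨huv, .inl ⟨u, v, hadj, rfl, rfl⟩⟩
  have hconn : H.Connected := by
    have : Nonempty (Fin k) := hG.nonempty.map σ
    refine ⟨fun i j => ?_⟩
    obtain ⟨v, rfl⟩ := hσ i
    obtain ⟨w, rfl⟩ := hσ j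
    obtain ⟨p⟩ := hG.preconnected v w
    exact hreach p
  have h1 := hconn.card_vert_le_card_edgeSet_add_one
  rw [Nat.card_eq_fintype_card, Fintype.card_fin, Nat.card_coe_set_eq] at h1
  have h2 : H.edgeSet.ncard ≤ cutWidth G σ := by
    unfold cutWidth
    refine (Set.ncard_le_ncard (t := Sym2.map σ '' _) ?_ (Set.toFinite _)).trans
      (Set.ncard_image_le (Set.toFinite _))
    intro e
    induction e with
    | _ i j =>
      rw [SimpleGraph.mem_edgeSet, hH, SimpleGraph.fromRel_adj]
      rintro ⟨hij, ⟨v, w, hadj, rfl, rfl⟩ | ⟨v, w, hadj, rfl, rfl⟩⟩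
      · exact ⟨s(v, w), ⟨hadj, v, w, rfl, hij⟩, rfl⟩
      · exact ⟨s(w, v), ⟨hadj.symm, w, v, rfl, hij⟩, rfl⟩
  omega

theorem IsKSection.surjective {V : Type*} [Fintype V] {k : ℕ} {σ : V → Fin k}
    (h : IsKSection σ) (hk : k ≤ Fintype.card V) : Function.Surjective σ := by
  intro l
  have h1 := (h l).1
  have h2 : 0 < Fintype.card V / k := Nat.div_pos hk (Nat.zero_lt_of_lt l.2)
  have h3 : {v : V | σ v = l}.ncard ≠ 0 := by omega
  obtain ⟨v, hv⟩ := Set.nonempty_of_ncard_ne_zero h3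
  exact ⟨v, hv⟩

theorem pred_le_minSec {V : Type*} [Fintype V] {G : SimpleGraph V} (hG : G.Connected) {k : ℕ}
    (hk : k ≤ Fintype.card V) (hne : ∃ σ : V → Fin k, IsKSection σ) : k - 1 ≤ minSec k G := by
  obtain ⟨σ, hσ⟩ := hne
  refine le_csInf ⟨_, σ, hσ, rfl⟩ ?_
  rintro w ⟨τ, hτ, rfl⟩
  exact pred_le_cutWidth hG τ (hτ.surjective hk)

theorem IsKSection.injective {V : Type*} [Fintype V] {k : ℕ} {σ : V → Fin k}
    (h : IsKSection σ) (hk : Fintype.card V ≤ k) : Function.Injective σ := by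
  intro v w hvw
  have h1 := (h (σ v)).2
  have hk0 : 0 < k := Nat.zero_lt_of_lt (σ v).2
  have h2 : Fintype.card V ⌈/⌉ k ≤ 1 := by
    rw [Nat.ceilDiv_eq_add_pred_div]
    refine Nat.le_of_lt_succ ((Nat.div_lt_iff_lt_mul hk0).2 ?_)
    omega
  have h3 := (Set.ncard_le_one (Set.toFinite _)).1 (h1.trans h2)
  exact h3 v rfl w hvw.symm

theorem cutWidth_eq_of_injective {V : Type*} {k : ℕ} {G : SimpleGraph V} {σ : V → Fin k}
    (hσ : Function.Injective σ) : cutWidth G σ = G.edgeSet.ncard := by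
  unfold cutWidth
  congr 1
  ext e
  refine ⟨fun he => he.1, fun he => ⟨he, ?_⟩⟩
  induction e with
  | _ v w => exact ⟨v, w, rfl, fun h => (SimpleGraph.Adj.ne he) (hσ h)⟩

/-- All sets have at most one element, so every `k`-section cuts every edge. -/
theorem cutWidth_eq_minSec {V : Type*} [Fintype V] {k : ℕ} {G : SimpleGraph V}
    (hk : Fintype.card V ≤ k) {σ : V → Fin k} (hσ : IsKSection σ) :
    cutWidth G σ = minSec k G := by
  have : {w : ℕ | ∃ σ : V → Fin k, IsKSection σ ∧ cutWidth G σ = w} = {cutWidth G σ} := by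
    ext w
    simp only [Set.mem_ofPred_eq, Set.mem_singleton_iff]
    constructor
    · rintro ⟨τ, hτ, rfl⟩
      rw [cutWidth_eq_of_injective (hτ.injective hk), cutWidth_eq_of_injective (hσ.injective hk)]
    · rintro rfl
      exact ⟨σ, hσ, rfl⟩
  rw [minSec, this, csInf_singleton]

theorem isKSection_of_injective {V : Type*} [Fintype V] {k : ℕ} {σ : V → Fin k}
    (hσ : Function.Injective σ) (hV : 0 < Fintype.card V) (hk : Fintype.card V ≤ k) :
    IsKSection σ := by
  classical
  intro l
  have hk0 : 0 < k := by omega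
  have h1 : {v : V | σ v = l}.ncard ≤ 1 :=
    (Set.ncard_le_one (Set.toFinite _)).2 fun v hv w hw => hσ (Eq.trans hv (Eq.symm hw))
  refine ⟨?_, ?_⟩
  · rcases hk.lt_or_eq with h | h
    · rw [Nat.div_eq_of_lt h]
      exact Nat.zero_le _
    · rw [h, Nat.div_self hk0]
      obtain ⟨v, hv⟩ := ((Fintype.bijective_iff_injective_and_card σ).2
        ⟨hσ, by rw [Fintype.card_fin, h]⟩).2 l
      exact (Set.ncard_pos (Set.toFinite _)).2 ⟨v, hv⟩
  · refine h1.trans ?_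
    rw [Nat.ceilDiv_eq_add_pred_div, Nat.le_div_iff_mul_le hk0]
    omega

/-! ### Arithmetic terms and reading the input. -/

namespace RAM

theorem iter_invariant (I : ℕ → State → Prop) {f : ℕ → State → State} {n : ℕ} {s : State}
    (h0 : I 0 s) (h : ∀ i < n, ∀ s, I i s → I (i + 1) (f i s)) : I n (iter f n s) := by
  suffices hm : ∀ m ≤ n, I m (iter f m s) from hm n le_rfl
  intro m
  induction m with
  | zero => exact fun _ => h0
  | succ m ih => exact fun hm => h m hm _ (ih (by omega))

namespace Tm

/-- The product; the variable `0` must not occur. -/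
def mul (t u : Tm) : Tm := .sum 0 (.ite (.sub t (.var 0)) u (.const 0))

/-- Equality. -/
def eq (t u : Tm) : Tm := .ite (.add (.sub t u) (.sub u t)) (.const 0) (.const 1)

/-- An entry of a square matrix, kept in an array row by row from the position `p` on. -/
def entry (a p x y : ℕ) : Tm := .get a (.add (.const p) (.add (mul (.var x) .size) (.var y)))

variable {n : ℕ} {s : State}

/-- The product is a sum of `t` copies of `u` among the `n` summands of the loop; hence the
condition that the first factor is at most `n`. -/
theorem eval_mul {t u : Tm} (ht : ∀ i, t.eval n (s.setReg 0 i) = t.eval n s)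
    (hu : ∀ i, u.eval n (s.setReg 0 i) = u.eval n s) (h : t.eval n s ≤ n) :
    (mul t u).eval n s = t.eval n s * u.eval n s := by
  simp only [mul, eval, ht, hu, State.setReg_reg, Function.update_self]
  rw [← Finset.sum_filter, Finset.sum_const, smul_eq_mul]
  congr 1
  have := card_filter_range_Ico (N := n) (a := 0) (b := t.eval n s) h
  rw [Nat.sub_zero] at this
  refine Eq.trans ?_ this
  congr 1
  ext i
  simp only [Finset.mem_filter, Finset.mem_range]
  omega

theorem eval_eq (t u : Tm) : (eq t u).eval n s = if t.eval n s = u.eval n s then 1 else 0 := by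
  simp only [eq, eval]
  by_cases h : t.eval n s = u.eval n s
  · simp [h]
  · rw [if_neg h]
    exact if_pos (by omega)

theorem eval_entry {a p x y : ℕ} (hx : x ≠ 0) (h : s.reg x ≤ n) :
    (entry a p x y).eval n s = s.arr a (p + (s.reg x * n + s.reg y)) := by
  have : (mul (.var x) .size).eval n s = s.reg x * n :=
    eval_mul (fun i => by simp [eval, hx]) (fun i => rfl) h
  simp only [entry, eval, this]

theorem eval_sum_ite {x : ℕ} {t : Tm} {Q : Fin n → Prop} [DecidablePred Q]
    (h : ∀ v : Fin n, t.eval n (s.setReg x v) = if Q v then 1 else 0) :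
    (Tm.sum x t).eval n s = (Finset.univ.filter Q).card := by
  rw [Tm.eval, Finset.sum_range, Finset.card_filter]
  exact Finset.sum_congr rfl fun v _ => h v

end Tm

theorem matrix_index_inj {n : ℕ} {x y x' y' : Fin n} :
    (x : ℕ) * n + y = x' * n + y' ↔ x = x' ∧ y = y' := by
  constructor
  · intro h
    have hn : 0 < n := Fin.pos x
    have h1 := congrArg (· / n) h
    have h2 := congrArg (· % n) h
    simp only [Nat.mul_comm _ n, Nat.mul_add_div hn, Nat.mul_add_mod, Nat.div_eq_of_lt y.2,
      Nat.div_eq_of_lt y'.2, Nat.mod_eq_of_lt y.2, Nat.mod_eq_of_lt y'.2, Nat.add_zero] at h1 h2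
    exact ⟨Fin.ext h1, Fin.ext h2⟩
  · rintro ⟨rfl, rfl⟩
    rfl

section Input

variable {n : ℕ} (G : SimpleGraph (Fin n)) (k : ℕ)

theorem init_arr_one : (State.init (encodeInstance G k)).arr 0 1 = k := by
  simp [State.init, encodeInstance]

open Classical in
theorem init_arr_adj (x y : Fin n) :
    (State.init (encodeInstance G k)).arr 0 (2 + (x * n + y)) = if G.Adj x y then 1 else 0 := by
  have hn : 0 < n := Fin.pos x
  have hlt : (x : ℕ) * n + y < n * n := by
    have := Nat.mul_le_mul_right n x.2
    have := y.2
    rw [Nat.succ_mul] at *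
    omega
  have hd : (⟨x * n + y, hlt⟩ : Fin (n * n)).divNat = x := by
    apply Fin.ext
    simp [Fin.coe_divNat, Nat.mul_comm _ n, Nat.mul_add_div hn, Nat.div_eq_of_lt y.2]
  have hm : (⟨x * n + y, hlt⟩ : Fin (n * n)).modNat = y := by
    apply Fin.ext
    simp [Fin.coe_modNat, Nat.mul_comm _ n, Nat.mod_eq_of_lt y.2]
  rw [Nat.add_comm 2]
  simp [State.init, encodeInstance, List.getD_eq_getElem?_getD, hlt, hd, hm]

theorem le_inputLength : n ≤ inputLength (encodeInstance G k) := by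
  have h : ∀ w : List ℕ, w.length ≤ inputLength w := by
    intro w
    induction w with
    | nil => simp
    | cons a w ih =>
      simp only [inputLength, List.map_cons, List.sum_cons, List.length_cons] at ih ⊢
      omega
  refine le_trans ?_ (h _)
  simp only [encodeInstance, List.length_cons, List.length_ofFn]
  nlinarith [Nat.zero_le n, Nat.le_mul_self n]

end Input

/-! ### Distances -/

/-- Initialize the matrix of the distances, which is kept in the array `2`. -/
def initDist : Stmt :=
  .each 10 (.each 11 (.put 2 (.add (.mul (.var 10) .size) (.var 11))
    (.ite (.eq (.var 10) (.var 11)) (.const 0) .size)))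

/-- Use the edge between `13` and `11` for a shorter path from `10` to `11`. -/
def relax : Stmt :=
  .put 2 (.add (.mul (.var 10) .size) (.var 11))
    (.ite (.entry 0 2 13 11)
      (.ite (.sub (.entry 2 0 10 11) (.add (.entry 2 0 10 13) (.const 1)))
        (.add (.entry 2 0 10 13) (.const 1)) (.entry 2 0 10 11))
      (.entry 2 0 10 11))

/-- Compute the distances. -/
def computeDist : Stmt := .seq initDist (.each 12 (.each 10 (.each 11 (.each 13 relax))))

/-- Find two vertices, kept in the variables `2` and `3`, with the largest distance. -/
def findEnds : Stmt :=
  .seq (.set 2 (.const 0)) (.seq (.set 3 (.const 0)) (.each 10 (.each 11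
    (.ite (.sub (.entry 2 0 10 11) (.entry 2 0 2 3))
      (.seq (.set 2 (.var 10)) (.set 3 (.var 11))) (.set 9 (.const 0))))))

section Dist

variable {n : ℕ} {k : ℕ} {T : SimpleGraph (Fin n)}

/-- The input is in the array `0`, and `k` in the variable `1`. -/
def HasInput (T : SimpleGraph (Fin n)) (k : ℕ) (s : State) : Prop :=
  s.arr 0 = (State.init (encodeInstance T k)).arr 0 ∧ s.reg 1 = k

theorem HasInput.setReg {s : State} (h : HasInput T k s) {x : ℕ} (hx : x ≠ 1) (v : ℕ) :
    HasInput T k (s.setReg x v) := by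
  refine ⟨h.1, ?_⟩
  rw [State.setReg_reg, Function.update_of_ne hx.symm, h.2]

theorem HasInput.setArr {s : State} (h : HasInput T k s) {a : ℕ} (ha : a ≠ 0) (i v : ℕ) :
    HasInput T k (s.setArr a i v) := by
  refine ⟨?_, h.2⟩
  rw [State.setArr_arr, Function.update_of_ne ha.symm, h.1]

/-- The matrix in the array `2`. -/
def dm (n : ℕ) (s : State) (x y : Fin n) : ℕ := s.arr 2 (x * n + y)

theorem dm_setReg (s : State) (x v : ℕ) : dm n (s.setReg x v) = dm n s := rfl

theorem dm_setArr (s : State) (i j : Fin n) (v : ℕ) (x y : Fin n) :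
    dm n (s.setArr 2 (i * n + j) v) x y = if x = i ∧ y = j then v else dm n s x y := by
  simp only [dm, State.setArr_arr, Function.update_self, Function.update_apply, matrix_index_inj]

theorem eval_entry_dm {s : State} {x y : ℕ} {i j : Fin n} (hx0 : x ≠ 0) (hx : s.reg x = i)
    (hy : s.reg y = j) : (Tm.entry 2 0 x y).eval n s = dm n s i j := by
  rw [Tm.eval_entry hx0 (by omega), hx, hy, Nat.zero_add, dm]

theorem eval_index {s : State} {x y : ℕ} {i j : Fin n} (hx0 : x ≠ 0) (hx : s.reg x = i)
    (hy : s.reg y = j) :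
    (Tm.add (.mul (.var x) .size) (.var y)).eval n s = (i * n + j : ℕ) := by
  have : (Tm.mul (.var x) .size).eval n s = s.reg x * n :=
    Tm.eval_mul (fun i => by simp [Tm.eval, hx0]) (fun i => rfl)
      (by simp only [Tm.eval]; omega)
  simp only [Tm.eval, this, hx, hy]

theorem exec_initDist {s : State} (h : HasInput T k s) :
    HasInput T k (initDist.exec n s) ∧
      ∀ x y : Fin n, dm n (initDist.exec n s) x y = if x = y then 0 else n := by
  have hmain := iter_invariant (n := n) (s := s)
    (f := fun i s => (Stmt.each 11 (.put 2 (.add (.mul (.var 10) .size) (.var 11))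
      (.ite (.eq (.var 10) (.var 11)) (.const 0) .size))).exec n (s.setReg 10 i))
    (fun i s => HasInput T k s ∧ ∀ x y : Fin n, (x : ℕ) < i → dm n s x y = if x = y then 0 else n)
    ⟨h, fun x y hx => absurd hx (Nat.not_lt_zero _)⟩ (by
      rintro i hi s ⟨hs, hd⟩
      have hinner := iter_invariant (n := n) (s := s.setReg 10 i)
        (f := fun j s => (Stmt.put 2 (.add (.mul (.var 10) .size) (.var 11))
          (.ite (.eq (.var 10) (.var 11)) (.const 0) .size)).exec n (s.setReg 11 j))
        (fun j s => HasInput T k s ∧ s.reg 10 = i ∧ ∀ x y : Fin n,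
          ((x : ℕ) < i ∨ (x : ℕ) = i ∧ (y : ℕ) < j) → dm n s x y = if x = y then 0 else n)
        ⟨hs.setReg (by norm_num) _, by simp, fun x y hx => by
          rw [dm_setReg]
          exact hd x y (by omega)⟩ (by
          rintro j hj s ⟨hs, hr, hd⟩
          have hs' := hs.setReg (x := 11) (by norm_num) j
          have hr' : (s.setReg 11 j).reg 10 = (⟨i, hi⟩ : Fin n) := by simp [hr]
          have hj' : (s.setReg 11 j).reg 11 = (⟨j, hj⟩ : Fin n) := by simp
          rw [Stmt.exec, eval_index (by norm_num) hr' hj']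
          refine ⟨hs'.setArr (by norm_num) _ _, by simpa using hr, fun x y hxy => ?_⟩
          rw [dm_setArr, dm_setReg]
          by_cases hc : x = ⟨i, hi⟩ ∧ y = ⟨j, hj⟩
          · rw [if_pos hc, hc.1, hc.2]
            simp only [Tm.eval, Tm.eval_eq, hr', hj', Fin.ext_iff]
            split_ifs <;> simp_all
          · rw [if_neg hc]
            apply hd
            rw [Fin.ext_iff, Fin.ext_iff] at hc
            simp only at hc
            omega)
      refine ⟨hinner.1, fun x y hx => hinner.2.2 x y ?_⟩
      have := y.2
      omega)
  exact ⟨hmain.1, fun x y => hmain.2 x y x.2⟩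

/-- Entries never grow and never fall below the true distance; an edge at `j` improves the entry for
`j`. These are the ingredients of the invariant in `exec_computeDist`. -/
theorem exec_relax {s : State} {i j l : Fin n} (h : HasInput T k s) (h10 : s.reg 10 = i)
    (h11 : s.reg 11 = j) (h13 : s.reg 13 = l) :
    HasInput T k (relax.exec n s) ∧ (relax.exec n s).reg = s.reg ∧
      (∀ x y, dm n (relax.exec n s) x y ≤ dm n s x y) ∧
      (T.Adj l j → dm n (relax.exec n s) i j ≤ dm n s i l + 1) ∧
      (T.IsTree → (∀ x y, T.dist x y ≤ dm n s x y) →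
        ∀ x y, T.dist x y ≤ dm n (relax.exec n s) x y) := by
  classical
  have hadj : (Tm.entry 0 2 13 11).eval n s = if T.Adj l j then 1 else 0 := by
    rw [Tm.eval_entry (by norm_num) (by omega), h13, h11, h.1, init_arr_adj]
  have e1 := eval_entry_dm (by norm_num) h10 h11
  have e2 := eval_entry_dm (by norm_num) h10 h13
  have hexec : relax.exec n s = s.setArr 2 (i * n + j) (if T.Adj l j then
      (if dm n s i l + 1 < dm n s i j then dm n s i l + 1 else dm n s i j) else dm n s i j) := by
    rw [relax, Stmt.exec, eval_index (by norm_num) h10 h11]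
    congr 1
    simp only [Tm.eval, hadj, e1, e2]
    split_ifs <;> first | rfl | omega
  rw [hexec]
  refine ⟨h.setArr (by norm_num) _ _, rfl, fun x y => ?_, fun hlj => ?_, fun hT hd x y => ?_⟩
  · rw [dm_setArr]
    split_ifs with h1 <;> first
      | exact le_rfl
      | (obtain ⟨rfl, rfl⟩ := h1; first | exact le_rfl | omega)
  · rw [dm_setArr, if_pos ⟨rfl, rfl⟩, if_pos hlj]
    split_ifs <;> omega
  · rw [dm_setArr]
    split_ifs with h1 h2 h3
    · rw [h1.1, h1.2]
      have := hd i l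
      have h4 := hT.1.dist_triangle (u := i) (v := l) (w := j)
      rw [SimpleGraph.dist_eq_one_iff_adj.2 h2] at h4
      omega
    · rw [h1.1, h1.2]; exact hd i j
    · rw [h1.1, h1.2]; exact hd i j
    · exact hd x y

/-- This is the Bellman–Ford method for all pairs: after `t` rounds all distances up to `t` are
exact. Distances are below `n`, so `n` serves as infinity and `n` rounds suffice. -/
theorem exec_computeDist {s : State} (hT : T.IsTree) (h : HasInput T k s) :
    HasInput T k (computeDist.exec n s) ∧
      ∀ x y : Fin n, dm n (computeDist.exec n s) x y = T.dist x y := by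
  obtain ⟨hi, hd⟩ := exec_initDist h
  have hdist : ∀ x y : Fin n, T.dist x y < n := by
    intro x y
    obtain ⟨p, hp, hl⟩ := hT.1.exists_path_of_dist x y
    rw [← hl]
    simpa using hp.length_lt
  set L : State → Prop := fun s => HasInput T k s ∧ ∀ x y, T.dist x y ≤ dm n s x y with hL
  have hLreg : ∀ {s x} v, x ≠ 1 → L s → L (s.setReg x v) :=
    fun v hx hs => ⟨hs.1.setReg hx v, hs.2⟩
  have inner : ∀ (t : ℕ) (i j : Fin n) (s : State), L s → s.reg 10 = i → s.reg 11 = j →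
      (∀ x y, T.dist x y ≤ t → dm n s x y ≤ T.dist x y) →
      L ((Stmt.each 13 relax).exec n s) ∧
        ((Stmt.each 13 relax).exec n s).reg 10 = i ∧
        (∀ x y, dm n ((Stmt.each 13 relax).exec n s) x y ≤ dm n s x y) ∧
        (T.dist i j ≤ t + 1 → dm n ((Stmt.each 13 relax).exec n s) i j ≤ T.dist i j) := by
    intro t i j s hs h10 h11 hU
    have hinv := iter_invariant (n := n) (s := s) (f := fun l s => relax.exec n (s.setReg 13 l))
      (fun m s' => L s' ∧ s'.reg 10 = i ∧ s'.reg 11 = j ∧ (∀ x y, dm n s' x y ≤ dm n s x y) ∧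
        ∀ l : Fin n, (l : ℕ) < m → T.Adj l j → dm n s' i j ≤ dm n s i l + 1)
      ⟨hs, h10, h11, fun _ _ => le_rfl, fun l hl => absurd hl (Nat.not_lt_zero _)⟩ (by
        rintro m hm s' ⟨hs', h10', h11', hle, hb⟩
        obtain ⟨r1, r2, r3, r4, r5⟩ := exec_relax (l := ⟨m, hm⟩)
          (hs'.1.setReg (x := 13) (by norm_num) m) (by simpa using h10') (by simpa using h11')
          (by simp)
        refine ⟨⟨r1, r5 hT hs'.2⟩, by rw [r2]; simpa using h10', by rw [r2]; simpa using h11',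
          fun x y => (r3 x y).trans (hle x y), fun l hl hadj => ?_⟩
        by_cases hlm : (l : ℕ) = m
        · obtain rfl : l = ⟨m, hm⟩ := Fin.ext hlm
          exact (r4 hadj).trans (Nat.succ_le_succ (hle _ _))
        · exact (r3 i j).trans (hb l (by omega) hadj))
    obtain ⟨q1, q2, q3, q4, q5⟩ := hinv
    refine ⟨q1, q2, q4, fun ht => ?_⟩
    rcases Nat.lt_or_ge t (T.dist i j) with hlt | hge
    · have hne : j ≠ i := by
        rintro rfl
        rw [SimpleGraph.dist_self] at hlt
        omega
      -- The neighbour of `j` towards `i` is at distance at most `t` from `i`, so its entry was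
      -- already exact.
      obtain ⟨l, hadj, hl⟩ := hT.exists_adj_dist_add_one hne
      have h1 := q5 l l.2 hadj.symm
      have h2 := hU i l (by omega)
      exact h1.trans (by omega)
    · exact (q4 i j).trans (hU i j hge)
  have middle : ∀ (t : ℕ) (i : Fin n) (s : State), L s → s.reg 10 = i →
      (∀ x y, T.dist x y ≤ t → dm n s x y ≤ T.dist x y) →
      L ((Stmt.each 11 (.each 13 relax)).exec n s) ∧
        (∀ x y, dm n ((Stmt.each 11 (.each 13 relax)).exec n s) x y ≤ dm n s x y) ∧
        ∀ j, T.dist i j ≤ t + 1 →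
          dm n ((Stmt.each 11 (.each 13 relax)).exec n s) i j ≤ T.dist i j := by
    intro t i s hs h10 hU
    have hinv := iter_invariant (n := n) (s := s)
      (f := fun l s => (Stmt.each 13 relax).exec n (s.setReg 11 l))
      (fun m s' => L s' ∧ s'.reg 10 = i ∧ (∀ x y, dm n s' x y ≤ dm n s x y) ∧
        ∀ j : Fin n, (j : ℕ) < m → T.dist i j ≤ t + 1 → dm n s' i j ≤ T.dist i j)
      ⟨hs, h10, fun _ _ => le_rfl, fun l hl => absurd hl (Nat.not_lt_zero _)⟩ (by
        rintro m hm s' ⟨hs', h10', hle, hb⟩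
        obtain ⟨r1, r2, r3, r4⟩ := inner t i ⟨m, hm⟩ (s'.setReg 11 m) (hLreg m (by norm_num) hs')
          (by simpa using h10') (by simp) (fun x y hxy => (hle x y).trans (hU x y hxy))
        refine ⟨r1, r2, fun x y => (r3 x y).trans (hle x y), fun j hj hd => ?_⟩
        by_cases hjm : (j : ℕ) = m
        · obtain rfl : j = ⟨m, hm⟩ := Fin.ext hjm
          exact r4 hd
        · exact (r3 i j).trans (hb j (by omega) hd))
    exact ⟨hinv.1, hinv.2.2.1, fun j => hinv.2.2.2 j j.2⟩
  have outer : ∀ (t : ℕ) (s : State), L s →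
      (∀ x y, T.dist x y ≤ t → dm n s x y ≤ T.dist x y) →
      L ((Stmt.each 10 (.each 11 (.each 13 relax))).exec n s) ∧
        ∀ i j, T.dist i j ≤ t + 1 →
          dm n ((Stmt.each 10 (.each 11 (.each 13 relax))).exec n s) i j ≤ T.dist i j := by
    intro t s hs hU
    have hinv := iter_invariant (n := n) (s := s)
      (f := fun l s => (Stmt.each 11 (.each 13 relax)).exec n (s.setReg 10 l))
      (fun m s' => L s' ∧ (∀ x y, dm n s' x y ≤ dm n s x y) ∧
        ∀ i : Fin n, (i : ℕ) < m → ∀ j, T.dist i j ≤ t + 1 → dm n s' i j ≤ T.dist i j)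
      ⟨hs, fun _ _ => le_rfl, fun l hl => absurd hl (Nat.not_lt_zero _)⟩ (by
        rintro m hm s' ⟨hs', hle, hb⟩
        obtain ⟨r1, r3, r4⟩ := middle t ⟨m, hm⟩ (s'.setReg 10 m) (hLreg m (by norm_num) hs')
          (by simp) (fun x y hxy => (hle x y).trans (hU x y hxy))
        refine ⟨r1, fun x y => (r3 x y).trans (hle x y), fun i hi j hd => ?_⟩
        by_cases him : (i : ℕ) = m
        · obtain rfl : i = ⟨m, hm⟩ := Fin.ext him
          exact r4 j hd
        · exact (r3 i j).trans (hb i (by omega) j hd))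
    exact ⟨hinv.1, fun i => hinv.2.2 i i.2⟩
  have hinv := iter_invariant (n := n) (s := initDist.exec n s)
    (f := fun l s => (Stmt.each 10 (.each 11 (.each 13 relax))).exec n (s.setReg 12 l))
    (fun t s' => L s' ∧ ∀ i j, T.dist i j ≤ t → dm n s' i j ≤ T.dist i j)
    ⟨⟨hi, fun x y => by
        rw [hd]
        split_ifs with hxy
        · rw [hxy, SimpleGraph.dist_self]
        · exact (hdist x y).le⟩, fun i j hij => by
        rw [hd, if_pos]
        · exact Nat.zero_le _
        · exact hT.1.dist_eq_zero_iff.1 (by omega)⟩ (by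
      rintro t ht s' ⟨hs', hU⟩
      exact outer t (s'.setReg 12 t) (hLreg t (by norm_num) hs') hU)
  exact ⟨hinv.1.1, fun x y => le_antisymm (hinv.2 x y (hdist x y).le) (hinv.1.2 x y)⟩

theorem exec_findEnds {s : State} (hn : 0 < n) (h : HasInput T k s)
    (hd : ∀ x y : Fin n, dm n s x y = T.dist x y) :
    HasInput T k (findEnds.exec n s) ∧
      (∀ x y : Fin n, dm n (findEnds.exec n s) x y = T.dist x y) ∧
      ∃ a b : Fin n, (findEnds.exec n s).reg 2 = a ∧ (findEnds.exec n s).reg 3 = b ∧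
        ∀ x y, T.dist x y ≤ T.dist a b := by
  set J : (Fin n → Fin n → Prop) → State → Prop := fun Q s => HasInput T k s ∧
    (∀ x y : Fin n, dm n s x y = T.dist x y) ∧ ∃ a b : Fin n, s.reg 2 = a ∧ s.reg 3 = b ∧
      ∀ x y, Q x y → T.dist x y ≤ T.dist a b with hJ
  have hmain := iter_invariant (n := n) (s := (s.setReg 2 0).setReg 3 0)
    (f := fun i s => (Stmt.each 11 (.ite (.sub (.entry 2 0 10 11) (.entry 2 0 2 3))
      (.seq (.set 2 (.var 10)) (.set 3 (.var 11))) (.set 9 (.const 0)))).exec n (s.setReg 10 i))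
    (fun i => J fun x _ => (x : ℕ) < i)
    ⟨(h.setReg (by norm_num) _).setReg (by norm_num) _, hd, ⟨0, hn⟩, ⟨0, hn⟩, by simp, by simp,
      fun x y hx => absurd hx (Nat.not_lt_zero _)⟩ (by
      rintro i hi s hs
      have hinner := iter_invariant (n := n) (s := s.setReg 10 i)
        (f := fun j s => (Stmt.ite (.sub (.entry 2 0 10 11) (.entry 2 0 2 3))
          (.seq (.set 2 (.var 10)) (.set 3 (.var 11))) (.set 9 (.const 0))).exec n (s.setReg 11 j))
        (fun j s => s.reg 10 = i ∧ J (fun x y => (x : ℕ) < i ∨ (x : ℕ) = i ∧ (y : ℕ) < j) s)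
        (by
          obtain ⟨h1, h2, a, b, ha, hb, h3⟩ := hs
          exact ⟨by simp, h1.setReg (by norm_num) _, h2, a, b, by simpa using ha,
            by simpa using hb, fun x y hxy => h3 x y (by omega)⟩) (by
          rintro j hj s ⟨hr, h1, h2, a, b, ha, hb, h3⟩
          have hr' : (s.setReg 11 j).reg 10 = (⟨i, hi⟩ : Fin n) := by simp [hr]
          have hj' : (s.setReg 11 j).reg 11 = (⟨j, hj⟩ : Fin n) := by simp
          have ha' : (s.setReg 11 j).reg 2 = a := by simpa using ha
          have hb' : (s.setReg 11 j).reg 3 = b := by simpa using hb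
          have e1 := eval_entry_dm (by norm_num) hr' hj'
          have e2 := eval_entry_dm (by norm_num) ha' hb'
          have h1' := h1.setReg (x := 11) (by norm_num) j
          rw [dm_setReg, h2] at e1 e2
          simp only [Stmt.exec, Tm.eval, e1, e2]
          split_ifs with hc
          · refine ⟨by simp [hr], (h1'.setReg (by norm_num) _).setReg (by norm_num) _, h2,
              ⟨i, hi⟩, ⟨j, hj⟩, by simp [hr], by simp, fun x y hxy => ?_⟩
            by_cases hxy' : (x : ℕ) = i ∧ (y : ℕ) = j
            · obtain rfl : x = ⟨i, hi⟩ := Fin.ext hxy'.1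
              obtain rfl : y = ⟨j, hj⟩ := Fin.ext hxy'.2
              exact le_rfl
            · exact (h3 x y (by omega)).trans (by omega)
          · refine ⟨by simp [hr], h1'.setReg (by norm_num) _, h2, a, b, by simpa using ha,
              by simpa using hb, fun x y hxy => ?_⟩
            by_cases hxy' : (x : ℕ) = i ∧ (y : ℕ) = j
            · obtain rfl : x = ⟨i, hi⟩ := Fin.ext hxy'.1
              obtain rfl : y = ⟨j, hj⟩ := Fin.ext hxy'.2
              omega
            · exact h3 x y (by omega))
      obtain ⟨-, h1, h2, a, b, ha, hb, h3⟩ := hinner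
      refine ⟨h1, h2, a, b, ha, hb, fun x y hx => h3 x y ?_⟩
      have := y.2
      omega)
  obtain ⟨h1, h2, a, b, ha, hb, h3⟩ := hmain
  exact ⟨h1, h2, a, b, ha, hb, fun x y => h3 x y x.2⟩

end Dist

end RAM

namespace RAM

/-! ### The search for the next set -/

/-- Whether the vertex in the variable `9` has not been dealt with. -/
def restT : Tm := .eq (.get 1 (.var 9)) (.sub (.var 1) (.const 1))

/-- Whether the vertex in `x` is an ancestor of the one in `y`; the root is in the variable `2`. -/
def ancT (x y : ℕ) : Tm := .eq (.add (.entry 2 0 2 x) (.entry 2 0 x y)) (.entry 2 0 2 y)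

/-- The parity of the vertex in the variable `9` with respect to the candidate in the variables
from `20` on. -/
def parT : ℕ → Tm
  | 0 => .ite (.var 20) (.const 1) (.const 0)
  | j + 1 => .ite (ancT (21 + j) 9) (.sub (.const 1) (parT j)) (parT j)

/-- Whether the candidate has the size in the variable `7` and the right density on the trunk. -/
def testT (C : ℕ) : Tm :=
  .ite (.eq (.sum 9 (.ite restT (parT C) (.const 0))) (.var 7))
    (.sub (.add (.mul (.var 7) (.sum 9 (.ite restT (ancT 9 3) (.const 0)))) (.const 1))
      (.mul (.sum 9 (.ite restT (.ite (ancT 9 3) (parT C) (.const 0)) (.const 0)))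
        (.sum 9 restT)))
    (.const 0)

/-- Store the values of `t` in the array `1`. -/
def fill (t : Tm) : Stmt := .each 9 (.put 1 (.var 9) t)

/-- The new value for the vertex in the variable `9` in the round `6`. -/
def nextT (C : ℕ) : Tm := .ite restT (.ite (parT C) (.var 6) (.get 1 (.var 9))) (.get 1 (.var 9))

/-- Use the candidate if it is suitable and none has been used before in this round. -/
def tryCandidate (C : ℕ) : Stmt :=
  .ite (.ite (.var 8) (.const 0) (testT C)) (.seq (fill (nextT C)) (.set 8 (.const 1)))
    (.set 9 (.const 0))

/-- Run `S` for all values of the variables `20`, …, `20 + j - 1`. -/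
def search (S : Stmt) : ℕ → Stmt
  | 0 => S
  | j + 1 => .each (20 + j) (search S j)

/-- A round. -/
def round (C : ℕ) : Stmt :=
  .ite (.sub (.sub (.var 1) (.const 1)) (.var 6))
    (.seq (.set 7 (.add (.var 4) (.ite (.sub (.var 5) (.var 6)) (.const 1) (.const 0))))
      (.seq (.set 8 (.const 0)) (search (tryCandidate C) (C + 1))))
    (.set 9 (.const 0))

/-- Divide `n` by `k`. -/
def divide : Stmt :=
  .seq (.set 4 (.sum 9 (.ite (.sub (.add .size (.const 1))
      (.mul (.add (.var 9) (.const 1)) (.var 1))) (.const 1) (.const 0))))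
    (.set 5 (.sub .size (.mul (.var 4) (.var 1))))

/-- The algorithm for `k < n`. -/
def greedy (C : ℕ) : Stmt :=
  .seq computeDist (.seq findEnds (.seq divide
    (.seq (fill (.sub (.var 1) (.const 1))) (.each 6 (round C)))))

/-- The algorithm. -/
def algorithm (C : ℕ) : Stmt :=
  .seq (.set 1 (.get 0 (.const 1))) (.ite (.sub .size (.var 1)) (greedy C) (fill (.var 9)))

/-- The array `1` is overwritten while `t` is being evaluated, so of this array the value at `v` may
use only the entry at `v`, which is still the old one. -/
theorem exec_fill {n : ℕ} {t : Tm} {s : State} {g : Fin n → ℕ}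
    (h : ∀ (s' : State) (v : Fin n), (∀ x, x ≠ 9 → s'.reg x = s.reg x) → s'.reg 9 = v →
      (∀ a, a ≠ 1 → s'.arr a = s.arr a) → s'.arr 1 v = s.arr 1 v → t.eval n s' = g v) :
    (∀ x, x ≠ 9 → ((fill t).exec n s).reg x = s.reg x) ∧
      (∀ a, a ≠ 1 → ((fill t).exec n s).arr a = s.arr a) ∧
      ∀ v : Fin n, ((fill t).exec n s).arr 1 v = g v := by
  have hinv := iter_invariant (n := n) (s := s)
    (f := fun i s => (Stmt.put 1 (.var 9) t).exec n (s.setReg 9 i))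
    (fun m s' => (∀ x, x ≠ 9 → s'.reg x = s.reg x) ∧ (∀ a, a ≠ 1 → s'.arr a = s.arr a) ∧
      (∀ v : Fin n, m ≤ v → s'.arr 1 v = s.arr 1 v) ∧ ∀ v : Fin n, (v : ℕ) < m → s'.arr 1 v = g v)
    ⟨fun _ _ => rfl, fun _ _ => rfl, fun _ _ => rfl, fun v hv => absurd hv (Nat.not_lt_zero _)⟩ (by
      rintro m hm s' ⟨h1, h2, h3, h4⟩
      have hv := h (s'.setReg 9 m) ⟨m, hm⟩ (fun x hx => by
        rw [State.setReg_reg, Function.update_of_ne hx, h1 x hx]) (by simp) h2 (h3 ⟨m, hm⟩ le_rfl)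
      simp only [Stmt.exec, Tm.eval, hv]
      refine ⟨fun x hx => ?_, fun a ha => ?_, fun v hv => ?_, fun v hv => ?_⟩
      · rw [State.setArr_reg, State.setReg_reg, Function.update_of_ne hx, h1 x hx]
      · rw [State.setArr_arr, Function.update_of_ne ha, State.setReg_arr, h2 a ha]
      · rw [State.setArr_arr, Function.update_self, Function.update_of_ne (by simp; omega)]
        exact h3 v (by omega)
      · rw [State.setArr_arr, Function.update_self, Function.update_apply]
        simp only [State.setReg_reg, Function.update_self]
        split_ifs with hvm
        · congr 1
          exact (Fin.ext hvm).symm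
        · exact h4 v (by omega))
  exact ⟨hinv.1, hinv.2.1, fun v => hinv.2.2.2 v v.2⟩

/-- If a candidate is good, then the search finds one. -/
theorem exec_search {n c : ℕ} {S : Stmt} {Q D : State → Prop} {good : (ℕ → ℕ) → Prop}
    (hQ : ∀ s x v, 20 ≤ x → Q s → Q (s.setReg x v)) (hD : ∀ s x v, 20 ≤ x → D s → D (s.setReg x v))
    (hgood : ∀ r r' : ℕ → ℕ, (∀ i < c, r (20 + i) = r' (20 + i)) → good r → good r')
    (hreg : ∀ s x, 20 ≤ x → (S.exec n s).reg x = s.reg x)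
    (hSD : ∀ s, D s → D (S.exec n s))
    (hSQ : ∀ s, (∀ i < c, s.reg (20 + i) < n) → Q s →
      D (S.exec n s) ∨ (¬ good s.reg ∧ Q (S.exec n s)))
    {s : State} (hs : Q s) (hg : ∃ g, good g ∧ ∀ i < c, g (20 + i) < n) :
    D ((search S c).exec n s) := by
  -- `Q` means that nothing has been found yet and `D` that a candidate has been used. The outer
  -- loops fix the variables from `20 + j` on; the last conjunct says that the inner loops succeed
  -- if some good candidate agrees with these values.
  have claim : ∀ j ≤ c, ∀ s : State, (∀ i, j ≤ i → i < c → s.reg (20 + i) < n) →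
      (∀ x, 20 + j ≤ x → ((search S j).exec n s).reg x = s.reg x) ∧
      (D s → D ((search S j).exec n s)) ∧
      (Q s → Q ((search S j).exec n s) ∨ D ((search S j).exec n s)) ∧
      ∀ g, good g → (∀ i < c, g (20 + i) < n) →
        (∀ i, j ≤ i → i < c → g (20 + i) = s.reg (20 + i)) → Q s →
          D ((search S j).exec n s) := by
    intro j
    induction j with
    | zero =>
      intro _ s hlt
      have hlt' : ∀ i < c, s.reg (20 + i) < n := fun i hi => hlt i (Nat.zero_le _) hi
      refine ⟨fun x hx => hreg s x hx, hSD s, fun h => ?_, fun g hg _ hgs h => ?_⟩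
      · rcases hSQ s hlt' h with h1 | h1
        · exact .inr h1
        · exact .inl h1.2
      · rcases hSQ s hlt' h with h1 | h1
        · exact h1
        · exact absurd (hgood _ _ (fun i hi => hgs i (Nat.zero_le _) hi) hg) h1.1
    | succ j ih =>
      intro hj s hlt
      have hinv := iter_invariant (n := n) (s := s)
        (f := fun i s => (search S j).exec n (s.setReg (20 + j) i))
        (fun m s' => (∀ x, 20 + (j + 1) ≤ x → s'.reg x = s.reg x) ∧ (D s → D s') ∧
          (Q s → Q s' ∨ D s') ∧ ∀ g, good g → (∀ i < c, g (20 + i) < n) →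
            (∀ i, j + 1 ≤ i → i < c → g (20 + i) = s.reg (20 + i)) → g (20 + j) < m → Q s → D s')
        ⟨fun _ _ => rfl, id, .inl, fun g _ _ _ h => absurd h (Nat.not_lt_zero _)⟩ (by
          rintro m hm s' ⟨h1, h2, h3, h4⟩
          have hother : ∀ x, 20 + (j + 1) ≤ x → (s'.setReg (20 + j) m).reg x = s.reg x := by
            intro x hx
            rw [State.setReg_reg, Function.update_of_ne (by omega), h1 x hx]
          have hself : (s'.setReg (20 + j) m).reg (20 + j) = m := by simp
          obtain ⟨r1, r2, r3, r4⟩ := ih (by omega) (s'.setReg (20 + j) m) (fun i hi hi' => by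
            rcases hi.eq_or_lt with rfl | hi
            · rw [hself]; exact hm
            · rw [hother _ (by omega)]
              exact hlt i hi hi')
          have hD' := hD s' (20 + j) m (by omega)
          have hQ' := hQ s' (20 + j) m (by omega)
          refine ⟨fun x hx => ?_, fun h => r2 (hD' (h2 h)), fun h => ?_,
            fun g hg hgn hgs hgm h => ?_⟩
          · rw [r1 x (by omega), hother x hx]
          · rcases h3 h with h | h
            · exact r3 (hQ' h)
            · exact .inr (r2 (hD' h))
          · by_cases hgm' : g (20 + j) = m
            · rcases h3 h with h | h
              · refine r4 g hg hgn (fun i hi hi' => ?_) (hQ' h)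
                rcases hi.eq_or_lt with rfl | hi
                · rw [hself, hgm']
                · rw [hother _ (by omega)]
                  exact hgs i hi hi'
              · exact r2 (hD' h)
            · exact r2 (hD' (h4 g hg hgn hgs (by omega) h)))
      obtain ⟨h1, h2, h3, h4⟩ := hinv
      exact ⟨h1, h2, h3, fun g hg hgn hgs h => h4 g hg hgn hgs (hgn j (by omega)) h⟩
  obtain ⟨g, hg, hgn⟩ := hg
  exact (claim c le_rfl s (fun i hi hi' => absurd hi' (by omega))).2.2.2 g hg hgn
    (fun i hi hi' => absurd hi' (by omega)) hs

section Round

variable {n : ℕ} {T : SimpleGraph (Fin n)} {k : ℕ} {a b : Fin n}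

/-- What has been computed before the rounds. -/
structure Ready (T : SimpleGraph (Fin n)) (k : ℕ) (a b : Fin n) (s : State) : Prop where
  dist : ∀ x y : Fin n, s.arr 2 (x * n + y) = T.dist x y
  reg_one : s.reg 1 = k
  reg_two : s.reg 2 = a
  reg_three : s.reg 3 = b
  reg_four : s.reg 4 = n / k
  reg_five : s.reg 5 = n % k

theorem Ready.congr {s s' : State} (h : Ready T k a b s) (harr : s'.arr 2 = s.arr 2)
    (hreg : ∀ x, 1 ≤ x → x < 6 → s'.reg x = s.reg x) : Ready T k a b s' where
  dist x y := by rw [harr, h.dist]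
  reg_one := by rw [hreg 1 (by norm_num) (by norm_num), h.reg_one]
  reg_two := by rw [hreg 2 (by norm_num) (by norm_num), h.reg_two]
  reg_three := by rw [hreg 3 (by norm_num) (by norm_num), h.reg_three]
  reg_four := by rw [hreg 4 (by norm_num) (by norm_num), h.reg_four]
  reg_five := by rw [hreg 5 (by norm_num) (by norm_num), h.reg_five]

theorem Ready.setReg {s : State} (h : Ready T k a b s) {x : ℕ} (hx : x = 0 ∨ 6 ≤ x) (v : ℕ) :
    Ready T k a b (s.setReg x v) :=
  h.congr rfl fun y hy hy' => by rw [State.setReg_reg, Function.update_of_ne (by omega)]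

open Classical in
theorem Ready.eval_ancT {s : State} (h : Ready T k a b s) (hT : T.IsTree) {x y : ℕ} {u v : Fin n}
    (hx0 : x ≠ 0) (hx : s.reg x = u) (hy : s.reg y = v) :
    (ancT x y).eval n s = if (hT.parentTree a).Anc u v then 1 else 0 := by
  rw [ancT, Tm.eval_eq, Tm.eval, eval_entry_dm (by norm_num) h.reg_two hx,
    eval_entry_dm hx0 hx hy, eval_entry_dm (by norm_num) h.reg_two hy]
  simp only [dm, h.dist, hT.parentTree_anc_iff]

theorem Ready.eval_parT {s : State} (h : Ready T k a b s) (hT : T.IsTree) (f : ℕ → Fin n)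
    {v : Fin n} (hv : s.reg 9 = v) : ∀ C : ℕ, (∀ j < C, s.reg (21 + j) = f j) →
      (parT C).eval n s = (hT.parentTree a).parity C (if s.reg 20 ≠ 0 then 1 else 0) f v
  | 0, _ => by
    simp only [parT, Tm.eval, ParentTree.parity, Finset.range_zero, Finset.sum_empty]
    by_cases h0 : s.reg 20 = 0 <;> simp [h0]
  | C + 1, hf => by
    have ih := h.eval_parT hT f hv C fun j hj => hf j (by omega)
    simp only [parT, Tm.eval, ih, h.eval_ancT hT (show 21 + C ≠ 0 by omega) (hf C (by omega)) hv]
    simp only [ParentTree.parity, Finset.sum_range_succ]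
    split_ifs <;> simp_all <;> omega

theorem Ready.eval_restT {s : State} (h : Ready T k a b s) :
    restT.eval n s = if s.arr 1 (s.reg 9) = k - 1 then 1 else 0 := by
  rw [restT, Tm.eval_eq]
  simp only [Tm.eval, h.reg_one]

/-- The conditions on a candidate. -/
def Suitable (R : ParentTree (Fin n)) (k C : ℕ) (b : Fin n) (m : ℕ) (σ : Fin n → ℕ) (e : ℕ)
    (f : ℕ → Fin n) : Prop :=
  (Finset.univ.filter fun v => R.parity C e f v = 1 ∧ σ v = k - 1).card = m ∧
    (R.trunk b ∩ Finset.univ.filter fun v => R.parity C e f v = 1 ∧ σ v = k - 1).card *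
        (Finset.univ.filter fun v => σ v = k - 1).card ≤ m *
          (R.trunk b ∩ Finset.univ.filter fun v => σ v = k - 1).card

theorem Ready.eval_testT {s : State} (h : Ready T k a b s) (hT : T.IsTree) {C : ℕ}
    {f : ℕ → Fin n} (hf : ∀ j < C, s.reg (21 + j) = f j) :
    (testT C).eval n s ≠ 0 ↔ Suitable (hT.parentTree a) k C b (s.reg 7) (fun v => s.arr 1 v)
      (if s.reg 20 ≠ 0 then 1 else 0) f := by
  classical
  set R := hT.parentTree a with hR
  set e := if s.reg 20 ≠ 0 then 1 else 0 with he
  have key : ∀ s' : State, Ready T k a b s' → s'.reg 20 = s.reg 20 → s'.arr 1 = s.arr 1 →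
      (∀ j < C, s'.reg (21 + j) = f j) →
      (Tm.sum 9 (.ite restT (parT C) (.const 0))).eval n s' =
          (Finset.univ.filter fun v => R.parity C e f v = 1 ∧ s.arr 1 v = k - 1).card ∧
      (Tm.sum 9 (.ite restT (.ite (ancT 9 3) (parT C) (.const 0)) (.const 0))).eval n s' =
          (R.trunk b ∩ Finset.univ.filter
            fun v : Fin n => R.parity C e f v = 1 ∧ s.arr 1 v = k - 1).card ∧
      (Tm.sum 9 restT).eval n s' =
          (Finset.univ.filter fun v : Fin n => s.arr 1 v = k - 1).card ∧
      (Tm.sum 9 (.ite restT (ancT 9 3) (.const 0))).eval n s' =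
          (R.trunk b ∩ Finset.univ.filter fun v : Fin n => s.arr 1 v = k - 1).card := by
    intro s' h' h20 harr hf'
    have hu : ∀ v : Fin n, Ready T k a b (s'.setReg 9 v) := fun v => h'.setReg (by norm_num) _
    have h9 : ∀ v : Fin n, (s'.setReg 9 v).reg 9 = v := fun v => by simp
    have hrest : ∀ v : Fin n, restT.eval n (s'.setReg 9 v) = if s.arr 1 v = k - 1 then 1 else 0 := by
      intro v
      rw [(hu v).eval_restT, h9, State.setReg_arr, harr]
    have hpar : ∀ v : Fin n, (parT C).eval n (s'.setReg 9 v) = R.parity C e f v := by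
      intro v
      rw [(hu v).eval_parT hT f (h9 v) C, he, ← h20]
      · simp [hR]
      · intro j hj
        rw [State.setReg_reg, Function.update_of_ne (by omega), hf' j hj]
    have hanc : ∀ v : Fin n, (ancT 9 3).eval n (s'.setReg 9 v) = if R.Anc v b then 1 else 0 :=
      fun v => (hu v).eval_ancT hT (by norm_num) (h9 v) (hu v).reg_three
    have hpar' : ∀ v : Fin n, R.parity C e f v = 0 ∨ R.parity C e f v = 1 := by
      intro v
      have : R.parity C e f v < 2 := Nat.mod_lt _ (by norm_num)
      omega
    have htrunk : ∀ (p : Fin n → Prop) [DecidablePred p], R.trunk b ∩ Finset.univ.filter p =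
        Finset.univ.filter fun v => R.Anc v b ∧ p v := by
      intro p _
      ext v
      simp [ParentTree.mem_trunk]
    rw [htrunk, htrunk]
    refine ⟨Tm.eval_sum_ite fun v => ?_, Tm.eval_sum_ite fun v => ?_, Tm.eval_sum_ite fun v => ?_,
      Tm.eval_sum_ite fun v => ?_⟩
    · simp only [Tm.eval, hrest, hpar]
      rcases hpar' v with hv | hv <;> simp [hv]
    · simp only [Tm.eval, hrest, hpar, hanc]
      rcases hpar' v with hv | hv <;> by_cases h1 : R.Anc v b <;> simp [hv, h1]
    · exact hrest v
    · simp only [Tm.eval, hrest, hanc]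
      by_cases h1 : R.Anc v b <;> simp [h1]
  have k1 := key s h rfl rfl hf
  -- Products use the variable `0` for their loop, so the sums must not depend on it.
  have k2 : ∀ i, _ := fun i => key (s.setReg 0 i) (h.setReg (.inl rfl) i) rfl rfl fun j hj => by
    rw [State.setReg_reg, Function.update_of_ne (by omega), hf j hj]
  set x1 := (Finset.univ.filter fun v : Fin n => R.parity C e f v = 1 ∧ s.arr 1 v = k - 1).card
    with hx1
  have hx1n : x1 ≤ n := by
    rw [hx1]
    exact (Finset.card_le_univ _).trans (by simp)
  set x2 := (R.trunk b ∩ Finset.univ.filter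
    fun v : Fin n => R.parity C e f v = 1 ∧ s.arr 1 v = k - 1).card with hx2
  have hx2n : x2 ≤ n := by
    rw [hx2]
    exact (Finset.card_le_univ _).trans (by simp)
  -- `Tm.eval_mul` needs this bound. It is known only when the variable `7` equals the size of the
  -- candidate, which is why the size is tested before the density.
  have hmul1 : s.reg 7 ≤ n →
      (Tm.mul (.var 7) (.sum 9 (.ite restT (ancT 9 3) (.const 0)))).eval n s =
        s.reg 7 * (R.trunk b ∩ Finset.univ.filter fun v : Fin n => s.arr 1 v = k - 1).card := by
    intro h7
    rw [Tm.eval_mul (fun i => rfl) (fun i => by rw [(k2 i).2.2.2, k1.2.2.2]) h7, k1.2.2.2]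
    rfl
  have hmul2 : (Tm.mul (.sum 9 (.ite restT (.ite (ancT 9 3) (parT C) (.const 0)) (.const 0)))
      (.sum 9 restT)).eval n s = x2 *
        (Finset.univ.filter fun v : Fin n => s.arr 1 v = k - 1).card := by
    rw [Tm.eval_mul (fun i => by rw [(k2 i).2.1, k1.2.1])
      (fun i => by rw [(k2 i).2.2.1, k1.2.2.1]) (by rw [k1.2.1]; exact hx2n), k1.2.1, k1.2.2.1]
  have hc : (Tm.eq (.sum 9 (.ite restT (parT C) (.const 0))) (.var 7)).eval n s =
      if x1 = s.reg 7 then 1 else 0 := by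
    rw [Tm.eval_eq, k1.1]
    rfl
  have hsuit : Suitable R k C b (s.reg 7) (fun v => s.arr 1 v) e f ↔ x1 = s.reg 7 ∧
      x2 * (Finset.univ.filter fun v : Fin n => s.arr 1 v = k - 1).card ≤
        s.reg 7 * (R.trunk b ∩ Finset.univ.filter fun v : Fin n => s.arr 1 v = k - 1).card := Iff.rfl
  rw [hsuit]
  simp only [testT, Tm.eval, hc, hmul2]
  by_cases h7 : x1 = s.reg 7
  · rw [if_pos h7, hmul1 (by omega)]
    simp only [h7, true_and, ne_eq, one_ne_zero, not_false_eq_true, if_true]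
    omega
  · simp [h7]

end Round

end RAM

/-! ### Correctness of the search, the rounds and the algorithm. -/

namespace RAM

section Round

variable {n : ℕ} {T : SimpleGraph (Fin n)} {k : ℕ} {a b : Fin n}

theorem exec_fill_reg (t : Tm) (s : State) {x : ℕ} (hx : x ≠ 9) :
    ((fill t).exec n s).reg x = s.reg x :=
  iter_invariant (n := n) (s := s) (f := fun i s => (Stmt.put 1 (.var 9) t).exec n (s.setReg 9 i))
    (fun _ s' => s'.reg x = s.reg x) rfl fun i _ s' h => by
      rw [Stmt.exec, State.setArr_reg, State.setReg_reg, Function.update_of_ne hx, h]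

theorem exec_tryCandidate_reg (C : ℕ) (s : State) {x : ℕ} (hx : 20 ≤ x) :
    ((tryCandidate C).exec n s).reg x = s.reg x := by
  rw [tryCandidate, Stmt.exec]
  split_ifs
  · rw [Stmt.exec, Stmt.exec, State.setReg_reg, Function.update_of_ne (by omega),
      exec_fill_reg _ _ (by omega)]
  · rw [Stmt.exec, State.setReg_reg, Function.update_of_ne (by omega)]

theorem Ready.exec_nextT {s : State} (h : Ready T k a b s) (hT : T.IsTree) {C : ℕ}
    {f : ℕ → Fin n} (hf : ∀ j < C, s.reg (21 + j) = f j) :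
    Ready T k a b ((fill (nextT C)).exec n s) ∧
      ∀ v : Fin n, ((fill (nextT C)).exec n s).arr 1 v =
        if (hT.parentTree a).parity C (if s.reg 20 ≠ 0 then 1 else 0) f v = 1 ∧ s.arr 1 v = k - 1
        then s.reg 6 else s.arr 1 v := by
  obtain ⟨h1, h2, h3⟩ := exec_fill (t := nextT C) (s := s) (g := fun v =>
    if (hT.parentTree a).parity C (if s.reg 20 ≠ 0 then 1 else 0) f v = 1 ∧ s.arr 1 v = k - 1
    then s.reg 6 else s.arr 1 v) (by
      intro s' v hr h9 ha hv
      have h' : Ready T k a b s' := h.congr (ha 2 (by norm_num)) fun x _ hx => hr x (by omega)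
      have hp := h'.eval_parT hT f h9 C fun j hj => by rw [hr _ (by omega), hf j hj]
      have hp' : (hT.parentTree a).parity C (if s.reg 20 ≠ 0 then 1 else 0) f v < 2 :=
        Nat.mod_lt _ (by norm_num)
      rw [hr 20 (by norm_num)] at hp
      simp only [nextT, Tm.eval, h'.eval_restT, hp, h9, hv, hr 6 (by norm_num)]
      generalize (hT.parentTree a).parity C (if s.reg 20 ≠ 0 then 1 else 0) f v = p at *
      interval_cases p <;> by_cases hk : s.arr 1 v = k - 1 <;> simp [hk])
  exact ⟨h.congr (h2 2 (by norm_num)) fun x _ hx => h1 x (by omega), h3⟩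

theorem Ready.exec_search {s : State} (h : Ready T k a b s) (hT : T.IsTree) (hn : 2 ≤ n)
    {C i m : ℕ} {σ : Fin n → ℕ} (h6 : s.reg 6 = i) (h7 : s.reg 7 = m) (h8 : s.reg 8 = 0)
    (hσ : ∀ v : Fin n, s.arr 1 v = σ v)
    (hex : ∃ e < 2, ∃ f, Suitable (hT.parentTree a) k C b m σ e f) :
    Ready T k a b ((search (tryCandidate C) (C + 1)).exec n s) ∧
      ∃ e f, Suitable (hT.parentTree a) k C b m σ e f ∧
        ∀ v : Fin n, ((search (tryCandidate C) (C + 1)).exec n s).arr 1 v =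
          if (hT.parentTree a).parity C e f v = 1 ∧ σ v = k - 1 then i else σ v := by
  have hmain := RAM.exec_search (n := n) (c := C + 1) (S := tryCandidate C)
    (Q := fun s => Ready T k a b s ∧ s.reg 6 = i ∧ s.reg 7 = m ∧ s.reg 8 = 0 ∧
      ∀ v : Fin n, s.arr 1 v = σ v)
    (D := fun s => Ready T k a b s ∧ s.reg 8 = 1 ∧
      ∃ e f, Suitable (hT.parentTree a) k C b m σ e f ∧ ∀ v : Fin n, s.arr 1 v =
        if (hT.parentTree a).parity C e f v = 1 ∧ σ v = k - 1 then i else σ v)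
    (good := fun r => ∃ f : ℕ → Fin n, (∀ j < C, r (21 + j) = f j) ∧
      Suitable (hT.parentTree a) k C b m σ (if r 20 ≠ 0 then 1 else 0) f)
    (s := s) ?_ ?_ ?_ ?_ ?_ ?_ ⟨h, h6, h7, h8, hσ⟩ ?_
  · exact ⟨hmain.1, hmain.2.2⟩
  · rintro s x v hx ⟨q1, q2, q3, q4, q5⟩
    refine ⟨q1.setReg (by omega) _, ?_, ?_, ?_, q5⟩ <;>
      rw [State.setReg_reg, Function.update_of_ne (by omega)] <;> assumption
  · rintro s x v hx ⟨q1, q2, q3⟩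
    refine ⟨q1.setReg (by omega) _, ?_, q3⟩
    rw [State.setReg_reg, Function.update_of_ne (by omega)]
    exact q2
  · rintro r r' hr ⟨f, hf, hs⟩
    refine ⟨f, fun j hj => ?_, ?_⟩
    · have := hr (1 + j) (by omega)
      rw [← hf j hj, show 21 + j = 20 + (1 + j) by omega, this]
    · have := hr 0 (by omega)
      rw [Nat.add_zero] at this
      rwa [← this]
  · exact fun s x hx => exec_tryCandidate_reg C s hx
  · rintro s ⟨q1, q2, q3⟩
    rw [tryCandidate, Stmt.exec, if_neg (by simp [Tm.eval, q2])]
    refine ⟨q1.setReg (by norm_num) _, ?_, q3⟩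
    simp [Stmt.exec, q2]
  · rintro s hlt ⟨q1, q2, q3, q4, q5⟩
    obtain ⟨f, hf⟩ : ∃ f : ℕ → Fin n, ∀ j < C, s.reg (21 + j) = f j := by
      refine ⟨fun j => ⟨s.reg (21 + j) % n, Nat.mod_lt _ (by omega)⟩, fun j hj => ?_⟩
      have := hlt (1 + j) (by omega)
      rw [show 20 + (1 + j) = 21 + j by omega] at this
      exact (Nat.mod_eq_of_lt this).symm
    have hq5 : (fun v : Fin n => s.arr 1 v) = σ := funext q5
    have htest := q1.eval_testT hT hf
    rw [q3, hq5] at htest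
    rw [tryCandidate, Stmt.exec]
    have hval : (Tm.ite (.var 8) (.const 0) (testT C)).eval n s = (testT C).eval n s := by
      simp [Tm.eval, q4]
    rw [hval]
    by_cases hs : (testT C).eval n s ≠ 0
    · rw [if_pos hs]
      left
      obtain ⟨r1, r2⟩ := q1.exec_nextT hT hf
      refine ⟨r1.setReg (by norm_num) _, by simp [Stmt.exec, Tm.eval], _, f, htest.1 hs,
        fun v => ?_⟩
      rw [Stmt.exec, Stmt.exec, State.setReg_arr, r2 v, q5 v, q2]
    · rw [if_neg hs]
      right
      refine ⟨?_, q1.setReg (by norm_num) _, by simpa [Stmt.exec] using q2,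
        by simpa [Stmt.exec] using q3, by simpa [Stmt.exec] using q4, q5⟩
      rintro ⟨f', hf', hs'⟩
      have := q1.eval_testT hT hf'
      rw [q3, hq5] at this
      exact hs (this.2 hs')
  -- The variable `20` holds `e` and `21 + j` holds `f j`; since e < 2 ≤ n, the loops reach this
  -- code.
  · obtain ⟨e, he, f, hf⟩ := hex
    refine ⟨fun x => if x = 20 then e else f (x - 21), ⟨f, fun j hj => ?_, ?_⟩, fun j hj => ?_⟩
    · dsimp only
      rw [if_neg (by omega), Nat.add_sub_cancel_left]
    · have : (if (if (20 : ℕ) = 20 then e else (f (20 - 21) : ℕ)) ≠ 0 then 1 else 0) = e := by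
        interval_cases e <;> simp
      rw [this]
      exact hf
    · dsimp only
      split_ifs
      · omega
      · exact Fin.is_lt _

theorem Ready.exec_rounds {s : State} (h : Ready T k a b s) (hT : T.IsTree) (hkn : k < n)
    {C Δ : ℕ} {d : ℝ} (hd : 0 < d) (hΔ : 2 ≤ Δ)
    (hR : ∀ v, ((hT.parentTree a).children v).card ≤ Δ)
    (hb : d * n ≤ ((hT.parentTree a).trunk b).card) (hC : C = ⌊(2 + 16 / d) * Δ⌋₊)
    (hk : 2 ≤ k) (hs : ∀ v : Fin n, s.arr 1 v = k - 1) :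
    (hT.parentTree a).IsPartial k C b (k - 1)
      fun v : Fin n => ((Stmt.each 6 (round C)).exec n s).arr 1 v := by
  have hcard : Fintype.card (Fin n) = n := Fintype.card_fin n
  -- The loop makes n > k - 1 passes, but only the first k - 1 of them are rounds; hence the
  -- minimum.
  have hinv := iter_invariant (n := n) (s := s) (f := fun i s => (round C).exec n (s.setReg 6 i))
    (fun i s => Ready T k a b s ∧
      (hT.parentTree a).IsPartial k C b (min i (k - 1)) fun v : Fin n => s.arr 1 v)
    ⟨h, by
      rw [Nat.zero_min, funext hs]
      exact ParentTree.isPartial_zero _ _ _ _⟩ (by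
      rintro i hi s ⟨q1, q2⟩
      have q1' := q1.setReg (x := 6) (by norm_num) i
      have hc : (((Tm.var 1).sub (.const 1)).sub (.var 6)).eval n (s.setReg 6 i) = k - 1 - i := by
        simp [Tm.eval, q1.reg_one]
      rw [round, Stmt.exec, hc]
      by_cases hik : i < k - 1
      · rw [if_pos (by omega)]
        rw [min_eq_left hik.le] at q2
        obtain ⟨e, he, f, hf⟩ := q2.exists_parity hik (by omega) hd hΔ hR (by rwa [hcard]) hC
        simp only [Stmt.exec]
        have hm : ((Tm.var 4).add (.ite (.sub (.var 5) (.var 6)) (.const 1) (.const 0))).eval n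
            (s.setReg 6 i) = partSize n k i := by
          simp only [Tm.eval, q1'.reg_four, q1'.reg_five, partSize]
          simp [Nat.sub_ne_zero_iff_lt]
        rw [hm]
        have q1'' := (q1'.setReg (x := 7) (by norm_num) (partSize n k i)).setReg (x := 8)
          (by norm_num) ((Tm.const 0).eval n ((s.setReg 6 i).setReg 7 (partSize n k i)))
        rw [hcard] at hf
        obtain ⟨r1, e', f', r2, r3⟩ := q1''.exec_search hT (by omega) (C := C) (i := i)
          (m := partSize n k i) (σ := fun v => s.arr 1 v) (by simp) (by simp) (by simp [Tm.eval])
          (fun _ => rfl) ⟨e, he, f, hf⟩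
        refine ⟨r1, ?_⟩
        rw [min_eq_left (by omega)]
        exact q2.succ hik (by omega) (by rw [hcard]; exact r2.1) (by rw [hcard]; exact r2.2) r3
      · rw [if_neg (by omega)]
        refine ⟨q1'.setReg (by norm_num) _, ?_⟩
        rw [min_eq_right (by omega)] at q2 ⊢
        exact q2)
  have := hinv.2
  rwa [min_eq_right (by omega)] at this

/-- The quotient n / k is the number of v < n with (v + 1)k ≤ n. -/
theorem exec_divide {s : State} (h : HasInput T k s) (hk : 2 ≤ k) :
    HasInput T k (divide.exec n s) ∧ (divide.exec n s).reg 4 = n / k ∧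
      (divide.exec n s).reg 5 = n % k ∧ (divide.exec n s).reg 2 = s.reg 2 ∧
      (divide.exec n s).reg 3 = s.reg 3 ∧ (divide.exec n s).arr = s.arr := by
  have hdiv : (Tm.sum 9 (.ite (.sub (.add .size (.const 1))
      (.mul (.add (.var 9) (.const 1)) (.var 1))) (.const 1) (.const 0))).eval n s = n / k := by
    rw [Tm.eval_sum_ite (Q := fun v : Fin n => (v : ℕ) < n / k), Fin.card_filter_val_lt,
      min_eq_right (Nat.div_le_self n k)]
    intro v
    have hmul : (Tm.mul (.add (.var 9) (.const 1)) (.var 1)).eval n (s.setReg 9 v) =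
        (v + 1) * k := by
      rw [Tm.eval_mul (fun i => by simp [Tm.eval]) (fun i => by simp [Tm.eval])
        (by simp [Tm.eval])]
      simp [Tm.eval, h.2]
    simp only [Tm.eval, hmul]
    have := Nat.le_div_iff_mul_le (show 0 < k by omega) (x := v + 1) (y := n)
    simp only [Nat.sub_ne_zero_iff_lt, Nat.lt_succ_iff, ← this, Nat.succ_le_iff]
  have h1 := h.setReg (x := 4) (by norm_num) (n / k)
  have hmul : (Tm.mul (.var 4) (.var 1)).eval n (s.setReg 4 (n / k)) = n / k * k := by
    rw [Tm.eval_mul (fun i => by simp [Tm.eval]) (fun i => by simp [Tm.eval])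
      (by simpa [Tm.eval] using Nat.div_le_self n k)]
    simp [Tm.eval, h.2]
  have hmod : n - n / k * k = n % k := by
    have := Nat.div_add_mod n k
    rw [Nat.mul_comm] at this
    omega
  have hset : (Tm.sub .size (.mul (.var 4) (.var 1))).eval n (s.setReg 4 (n / k)) = n % k := by
    rw [Tm.eval, hmul, Tm.eval, hmod]
  have hexec : divide.exec n s = (s.setReg 4 (n / k)).setReg 5 (n % k) := by
    rw [← hset]
    nth_rewrite 1 2 [← hdiv]
    rfl
  rw [hexec]
  exact ⟨h1.setReg (by norm_num) _, by simp, by simp, by simp, by simp, rfl⟩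

end Round

theorem exec_greedy {n k C Δ : ℕ} {T : SimpleGraph (Fin n)} (hT : T.IsTree) {s : State}
    (h : HasInput T k s) (hk : 2 ≤ k) (hkn : k < n) {d : ℝ} (hd : 0 < d) (hΔ : 2 ≤ Δ)
    (hR : ∀ a v, ((hT.parentTree a).children v).card ≤ Δ)
    (hb : ∃ a b, d * n ≤ T.dist a b) (hC : C = ⌊(2 + 16 / d) * Δ⌋₊) :
    ∃ a b, (hT.parentTree a).IsPartial k C b (k - 1)
      fun v : Fin n => ((greedy C).exec n s).arr 1 v := by
  obtain ⟨h1, d1⟩ := exec_computeDist hT h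
  obtain ⟨h2, d2, a, b, ha, hb', hab⟩ := exec_findEnds (by omega) h1 d1
  obtain ⟨h3, r4, r5, r2, r3, harr⟩ := exec_divide h2 hk
  set s3 := divide.exec n (findEnds.exec n (computeDist.exec n s)) with hs3
  have hready : Ready T k a b s3 :=
    ⟨fun x y => by rw [harr]; exact d2 x y, h3.2, r2.trans ha, r3.trans hb', r4, r5⟩
  obtain ⟨f1, f2, f3⟩ := exec_fill (n := n) (t := .sub (.var 1) (.const 1)) (s := s3)
    (g := fun _ => k - 1) (by
      intro s' v hr _ _ _
      simp only [Tm.eval, hr 1 (by norm_num), h3.2])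
  refine ⟨a, b, (hready.congr (f2 2 (by norm_num)) fun x _ hx => f1 x (by omega)).exec_rounds
    hT hkn hd hΔ (hR a) ?_ hC hk f3⟩
  obtain ⟨a', b', hd'⟩ := hb
  rw [ParentTree.card_trunk, hT.parentTree_depth]
  have : (T.dist a' b' : ℝ) ≤ T.dist a b := by exact_mod_cast hab a' b'
  push_cast
  linarith

theorem exec_algorithm {n k C Δ : ℕ} {T : SimpleGraph (Fin n)} (hT : T.IsTree) {s : State}
    (h : s.arr = (State.init (encodeInstance T k)).arr) (hk : 2 ≤ k) {d : ℝ} (hd : 0 < d)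
    (hR : ∀ a v, ((hT.parentTree a).children v).card ≤ Δ)
    (hb : ∃ a b, d * n ≤ T.dist a b) (hC : C = ⌊(2 + 16 / d) * Δ⌋₊) :
    (2 ≤ Δ → k < n → ∃ a b, (hT.parentTree a).IsPartial k C b (k - 1)
      fun v : Fin n => ((algorithm C).exec n s).arr 1 v) ∧
    (n ≤ k → ∀ v : Fin n, ((algorithm C).exec n s).arr 1 v = v) := by
  have h0 : (Tm.get 0 (.const 1)).eval n s = k := by
    rw [Tm.eval, Tm.eval, h, init_arr_one]
  have h1 : HasInput T k (s.setReg 1 k) := ⟨by rw [State.setReg_arr, h], by simp⟩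
  have hc : ((Tm.size).sub (.var 1)).eval n (s.setReg 1 k) = n - k := by
    simp [Tm.eval]
  rw [algorithm, Stmt.exec, Stmt.exec, h0, Stmt.exec, hc]
  constructor
  · intro hΔ hkn
    rw [if_pos (by omega)]
    exact exec_greedy hT h1 hk hkn hd hΔ hR hb hC
  · intro hnk
    rw [if_neg (by omega)]
    exact (exec_fill (n := n) (t := .var 9) (g := fun v => v) fun s' v _ h9 _ _ => h9).2.2

end RAM

/-! ### The approximation ratio. -/

theorem SimpleGraph.IsTree.exists_longestPathLength_le {V : Type*} [Finite V] {T : SimpleGraph V}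
    (hT : T.IsTree) : ∃ a b, longestPathLength T ≤ T.dist a b := by
  have hne : Nonempty V := hT.1.nonempty
  obtain ⟨⟨a, b⟩, hab⟩ := Finite.exists_max fun p : V × V => T.dist p.1 p.2
  obtain ⟨v⟩ := hne
  refine ⟨a, b, csSup_le ⟨0, v, v, .nil, .nil, rfl⟩ ?_⟩
  rintro l ⟨u, v, p, hp, rfl⟩
  rw [hT.length_eq_dist hp]
  exact hab (u, v)

theorem one_lt_approximation_constant {Δ : ℕ} {d : ℝ} (hd : 0 < d) (hΔ : 1 ≤ Δ) :
    1 < (2 + 16 / d) * Δ := by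
  have hd' : 0 < 16 / d := by positivity
  have hΔ' : (1 : ℝ) ≤ Δ := by exact_mod_cast hΔ
  nlinarith

theorem hasPolyTimeApprox_trees {Δ : ℕ} {d : ℝ} (hd : 0 < d) (hΔ : 1 ≤ Δ)
    {𝒯 : ∀ n : ℕ, Set (SimpleGraph (Fin n))} (h𝒯 : IsBoundedTreeClass Δ d 𝒯) :
    HasPolyTimeApprox ((2 + 16 / d) * Δ) 𝒯 := by
  classical
  set C := ⌊(2 + 16 / d) * Δ⌋₊ with hC
  have hc1 := (one_lt_approximation_constant hd hΔ).le
  obtain ⟨P, q, hP⟩ := RAM.Stmt.exists_prog (RAM.algorithm C)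
  refine ⟨P, q, fun n T hT k hk => ?_⟩
  obtain ⟨hTree, hdeg, hlong⟩ := h𝒯 n T hT
  have hR : ∀ a v, ((hTree.parentTree a).children v).card ≤ Δ := fun a v =>
    (hTree.card_children_parentTree_le a v).trans hdeg
  obtain ⟨a, b, hab⟩ := hTree.exists_longestPathLength_le
  have hab' : (longestPathLength T : ℝ) ≤ T.dist a b := by exact_mod_cast hab
  obtain ⟨t, s, hrun, ht, harr⟩ := hP (encodeInstance T k) (RAM.le_inputLength T k)
  obtain ⟨h1, h2⟩ := RAM.exec_algorithm (k := k) (s := ⟨fun _ => 0, _⟩) hTree rfl hk hd hR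
    ⟨a, b, hlong.trans hab'⟩ hC
  replace harr : s.arr = ((RAM.algorithm C).exec n
    ⟨fun _ => 0, (RAM.State.init (encodeInstance T k)).arr⟩).arr := harr
  rw [← harr] at h1 h2
  have hcard : Fintype.card (Fin n) = n := Fintype.card_fin n
  rcases Nat.lt_or_ge k n with hkn | hnk
  -- Here n > k ≥ 2, so the tree has at least three vertices.
  · have hΔ2 : 2 ≤ Δ := (hTree.two_le_maxDegree (by omega)).trans hdeg
    obtain ⟨a, b, hpart⟩ := h1 hΔ2 hkn
    have hlt : ∀ v : Fin n, s.arr 1 v < k := fun v => by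
      have := hpart.value v
      omega
    have hsec : IsKSection fun v : Fin n => (⟨s.arr 1 v, hlt v⟩ : Fin k) :=
      isKSection_of_isPartial hpart hk _ fun _ => rfl
    refine ⟨t, s, _, hrun, ht, fun v => rfl, hsec, ?_⟩
    have hw := cutWidth_le_of_isPartial hTree hpart (fun v => ⟨s.arr 1 v, hlt v⟩) fun _ => rfl
    have hmin := pred_le_minSec hTree.1 (by omega) ⟨_, hsec⟩
    have hCle : (C : ℝ) ≤ (2 + 16 / d) * Δ := Nat.floor_le (by linarith)
    calc _ ≤ (((k - 1) * C : ℕ) : ℝ) := by exact_mod_cast hw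
      _ ≤ ((minSec k T * C : ℕ) : ℝ) := by exact_mod_cast Nat.mul_le_mul_right C hmin
      _ = C * minSec k T := by push_cast; ring
      _ ≤ _ := by gcongr
  · have hn : 0 < n := Fin.pos a
    have hsec : IsKSection (Fin.castLE hnk) :=
      isKSection_of_injective (Fin.castLE_injective hnk) (by omega) (by omega)
    refine ⟨t, s, Fin.castLE hnk, hrun, ht, fun v => h2 hnk v, hsec, ?_⟩
    rw [cutWidth_eq_minSec (by omega) hsec]
    exact le_mul_of_one_le_left (Nat.cast_nonneg _) hc1

/-- There is no tree of maximum degree `0` that has a path of positive length. -/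
theorem IsBoundedTreeClass.eq_empty {d : ℝ} (hd : 0 < d)
    {𝒯 : ∀ n : ℕ, Set (SimpleGraph (Fin n))} (h𝒯 : IsBoundedTreeClass 0 d 𝒯) (n : ℕ) :
    𝒯 n = ∅ := by
  classical
  refine Set.eq_empty_of_forall_notMem fun T hT => ?_
  obtain ⟨hTree, hdeg, hlong⟩ := h𝒯 n T hT
  obtain ⟨a, b, hab⟩ := hTree.exists_longestPathLength_le
  have hn : 0 < n := Fin.pos a
  have hlen : longestPathLength T ≠ 0 := by
    rintro h0
    rw [h0, Nat.cast_zero] at hlong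
    have : 0 < d * n := by positivity
    linarith
  have hne : a ≠ b := by
    rintro rfl
    rw [SimpleGraph.dist_self] at hab
    omega
  obtain ⟨w, hw, -⟩ := hTree.exists_adj_dist_add_one hne
  have h1 := (T.degree_pos_iff_exists_adj a).2 ⟨w, hw⟩
  have h2 := (T.degree_le_maxDegree a).trans hdeg
  omega

theorem hasPolyTimeApprox_of_forall_eq_empty (c : ℝ) {𝒢 : ∀ n : ℕ, Set (SimpleGraph (Fin n))}
    (h : ∀ n, 𝒢 n = ∅) : HasPolyTimeApprox c 𝒢 :=
  ⟨.skip, 0, fun n G hG => absurd hG (by rw [h]; exact Set.notMem_empty G)⟩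

theorem corollary2 (Δ₀ : ℕ) (d : ℝ) (hd : 0 < d) :
    (∃ c : ℝ, 1 < c ∧
      ∀ 𝒯 : ∀ n : ℕ, Set (SimpleGraph (Fin n)), IsBoundedTreeClass Δ₀ d 𝒯 →
        HasPolyTimeApprox c 𝒯) ∧
    (1 ≤ Δ₀ → 1 < (2 + 16 / d) * Δ₀) ∧
    (∀ 𝒯 : ∀ n : ℕ, Set (SimpleGraph (Fin n)), IsBoundedTreeClass Δ₀ d 𝒯 →
      HasPolyTimeApprox ((2 + 16 / d) * Δ₀) 𝒯) := by
  rcases Nat.eq_zero_or_pos Δ₀ with rfl | hΔ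
  -- For Δ₀ = 0 the explicit constant is 0, which does no harm as the class is empty; any number
  -- above 1, here 2, serves in the first claim.
  · exact ⟨⟨2, by norm_num, fun 𝒯 h => hasPolyTimeApprox_of_forall_eq_empty _ (h.eq_empty hd)⟩,
      fun h => absurd h (by norm_num),
      fun 𝒯 h => hasPolyTimeApprox_of_forall_eq_empty _ (h.eq_empty hd)⟩
  · have hmain : ∀ 𝒯 : ∀ n : ℕ, Set (SimpleGraph (Fin n)), IsBoundedTreeClass Δ₀ d 𝒯 →
        HasPolyTimeApprox ((2 + 16 / d) * Δ₀) 𝒯 := fun 𝒯 h => hasPolyTimeApprox_trees hd hΔ h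
    exact ⟨⟨_, one_lt_approximation_constant hd hΔ, hmain⟩,
      fun h => one_lt_approximation_constant hd h, hmain⟩
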